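/- Let $N\ge 1$. Let $X_i=\sum_{j=1}^N A_i^j(x)\,\partial/\partial x^j$, $i=1,\dots,N$, be a global frame of vector fields on $\mathbb R^N$ whose coefficients $A_i^j$ are real-valued, $C^\infty$ and have all derivatives (of every order, including order $0$) bounded on $\mathbb R^N$, and such that $|\det(A_i^j(x))|\ge c>0$ for all $x$. (The frame is adapted to the distribution of hyperplanes $\mathcal D_x=\mathrm{span}(X_1,\dots,X_{N-1})$.) Let $(B_j^k)$ be the inverse matrix, $\sum_j A_i^jB_j^k=\delta_i^k$, and put $$\rho_x(\xi)=\Big(\sum_{i=1}^{N-1}\Big|\sum_{j=1}^N A_i^j(x)\xi_j\Big|^2\Big)^{1/2},\qquad d(x,y)=|x-y|+\Big|\sum_{j=1}^N B_j^N(x)(x^j-y^j)\Big|^{1/2}.$$ On functions of $(x,\xi)$ let $$D_\xi=\sum_{j} B_j^N(x)\frac{\partial}{\partial \xi_j},\qquad D_i=\frac{\partial}{\partial x^i}+\sum_{k,p,l}\frac{\partial B_k^p}{\partial x^i}(x)A_p^l(x)\,\xi_l\,\frac{\partial}{\partial\xi_k},\qquad D^I=D_{i_1}\cdots D_{i_r}\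 \text{ for } I=(i_1,\dots,i_r).$$ For $m,n\in\mathbb R$, $S^{m,n}$ is the class of all $a\in C^\infty(\mathbb R^N\times\mathbb R^N;\mathbb C)$ such that for all $\alpha,\beta,I$ there is a constant $C_{\alpha,\beta,I}$ with $$|\partial_\xi^\alpha D_\xi^\beta D^I a(x,\xi)|\le C_{\alpha,\beta,I}\,(1+|\xi|)^{m-\beta}\,(1+\rho_x(\xi)+|\xi|^{1/2})^{n-|\alpha|}\qquad\text{for all }x,\xi .$$ For $f\in\mathcal S(\mathbb R^N)$ put $T_af(x)=\int a(x,\xi)\hat f(\xi)e^{2\pi i x\cdot\xi}\,d\xi$, where $\hat f(\xi)=\int f(y)e^{-2\pi i y\cdot\xi}\,dy$. On functions of $(x,y)$ let $$D_{x,y,i}=\frac{\partial}{\partial x^i}+\frac{\partial}{\partial y^i}+\sum_{k,p,l}\frac{\partial B_k^p}{\partial x^i}(x)A_p^l(x)(x^k-y^k)\frac{\partial}{\partial y^l},\qquad D_{x,y}^I=D_{x,y,i_1}\cdots D_{x,y,i_r}.$$ Let $(X'_{x,y})^\gamma$ denote any composition of $|\gamma|$ operators, each of which is one of $X_1,\dots,X_{N-1}$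 acting either in the variable $x$ or in the variable $y$, and let $\partial_{x,y}^\lambda$ denote any composition of $|\lambda|$ coordinate derivatives $\partial/\partial x^j$, $\partial/\partial y^j$, $1\le j\le N$. **Theorem.** Suppose $m>-1$, $n>-(N-1)$, and let $a\in S^{m,n}$. Then the integrals defining $T_af(x)$, and the integrals $\int T_af(x)\,g(x)\,dx$, converge absolutely for all $f,g\in\mathcal S(\mathbb R^N)$ and $x\in\mathbb R^N$, and there is a tempered distribution $K(x,y)$ on $\mathbb R^N\times\mathbb R^N$ such that: (a) $\displaystyle\int_{\mathbb R^N} T_af(x)\,g(x)\,dx=\langle K(x,y),\,f(y)g(x)\rangle$ for all $f,g\in\mathcal S(\mathbb R^N)$. (b) On the complement of the diagonal $\{x=y\}$, $K$ is given by a $C^\infty$ function, again denoted $K(x,y)$, and for all $I,\gamma,\lambda$ as above and all real $M\ge 0$ there is a constant $C$ such that $$\big|D_{x,y}^I\,(X'_{x,y})^\gamma\,\partial_{x,y}^\lambda K(x,y)\big|\le \frac{C}{|x-y|^{(N-1)+n+|\gamma|+M}\;d(x,y)^{2(1+m+|\lambda|)}}\qquad\text{for all }x\ne y.$$ -/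

import Mathlib

open MeasureTheory SchwartzMap
open scoped ContDiff FourierTransform

noncomputable section

namespace MixedPDO

/-- Euclidean space `ℝ^N` with `N = q + 1`. The coordinates `0, …, q - 1` (that is,
`Fin.castSucc i` with `i : Fin q`) are the first `N - 1` ones, and `Fin.last q` is the `N`-th. -/
abbrev Pt (q : ℕ) := EuclideanSpace ℝ (Fin (q + 1))

/-- The `j`-th standard basis vector of `ℝ^N`. -/
def basisVec {q : ℕ} (j : Fin (q + 1)) : Pt q := EuclideanSpace.single j 1

/-- The partial derivative `∂f/∂x^i` of a real function on `ℝ^N`. -/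
def pd {q : ℕ} (i : Fin (q + 1)) (f : Pt q → ℝ) (x : Pt q) : ℝ := fderiv ℝ f x (basisVec i)

/-- The partial derivative in the `j`-th coordinate of the first variable of a function
on `ℝ^N × ℝ^N`. -/
def pdFst {q : ℕ} (j : Fin (q + 1)) (F : Pt q × Pt q → ℂ) : Pt q × Pt q → ℂ :=
  fun z => fderiv ℝ F z (basisVec j, 0)

/-- The partial derivative in the `j`-th coordinate of the second variable of a function
on `ℝ^N × ℝ^N`. -/
def pdSnd {q : ℕ} (j : Fin (q + 1)) (F : Pt q × Pt q → ℂ) : Pt q × Pt q → ℂ :=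
  fun z => fderiv ℝ F z (0, basisVec j)

/-- A global frame `X_i = ∑_j A_i^j(x) ∂/∂x^j`, `i = 1, …, N`, on `ℝ^N`, with
`A x i j = A_i^j(x)` smooth, all derivatives of all coefficients bounded, and `|det A|` bounded
below. The distribution of hyperplanes is the span of the first `N - 1` fields
`X_1, …, X_{N-1}`. -/
structure Frame (q : ℕ) where
  A : Pt q → Matrix (Fin (q + 1)) (Fin (q + 1)) ℝ
  smooth : ∀ i j, ContDiff ℝ ∞ (fun x => A x i j)
  bounded : ∀ k : ℕ, ∃ C : ℝ, ∀ i j x, ‖iteratedFDeriv ℝ k (fun x => A x i j) x‖ ≤ C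
  det_bound : ∃ c : ℝ, 0 < c ∧ ∀ x, c ≤ |(A x).det|

namespace Frame

variable {q : ℕ} (X : Frame q)

/-- The inverse matrix: `X.B x j k = B_j^k(x)`, so that `∑_j A_i^j B_j^k = δ_i^k`. -/
def B (x : Pt q) : Matrix (Fin (q + 1)) (Fin (q + 1)) ℝ := (X.A x)⁻¹

/-- The components `(M_x ξ)_i = ∑_j A_i^j(x) ξ_j`. -/
def M (x ξ : Pt q) (i : Fin (q + 1)) : ℝ := ∑ j, X.A x i j * ξ j

/-- The variable seminorm `ρ_x(ξ) = (∑_{i ≤ N-1} |(M_x ξ)_i|^2)^{1/2}`. -/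
def rho (x ξ : Pt q) : ℝ := √(∑ i : Fin q, X.M x ξ i.castSucc ^ 2)

/-- The components `Θ_0(x,y)_i = ∑_j B_j^i(x) (x^j - y^j)`. -/
def Theta0 (x y : Pt q) (i : Fin (q + 1)) : ℝ := ∑ j, X.B x j i * (x j - y j)

/-- The quasi-distance `d(x,y) = |x - y| + |Θ_0(x,y)_N|^{1/2}`. -/
def qdist (x y : Pt q) : ℝ := ‖x - y‖ + √|X.Theta0 x y (Fin.last q)|

/-! ### Derivatives of symbols, functions of `(x, ξ)` -/

/-- `D_ξ = ∑_j B_j^N(x) ∂/∂ξ_j`. -/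
def Dxi (F : Pt q × Pt q → ℂ) : Pt q × Pt q → ℂ :=
  fun z => ∑ j, (X.B z.1 j (Fin.last q) : ℂ) * pdSnd j F z

/-- `D_i = ∂/∂x^i + ∑_{k,p,l} (∂B_k^p/∂x^i)(x) A_p^l(x) ξ_l ∂/∂ξ_k`. -/
def Dsym (i : Fin (q + 1)) (F : Pt q × Pt q → ℂ) : Pt q × Pt q → ℂ :=
  fun z => pdFst i F z + ∑ k, ∑ p, ∑ l,
    ((pd i (fun x => X.B x k p) z.1 * X.A z.1 p l * z.2 l : ℝ) : ℂ) * pdSnd k F z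

/-- The symbol class `S^{m,n}`: smooth functions `a` of `(x, ξ)` such that
`|∂_ξ^α D_ξ^β D^I a| ≤ C_{α,β,I} (1+|ξ|)^{m-β} (1+ρ_x(ξ)+|ξ|^{1/2})^{n-|α|}`. A multi-index `α` is
given as the list of the coordinates of the successive derivatives, and
`D^I = D_{i_1} ⋯ D_{i_k}` for `I = [i_1, …, i_k]`. -/
structure IsSymbol (m n : ℝ) (a : Pt q × Pt q → ℂ) : Prop where
  smooth : ContDiff ℝ ∞ a
  bound : ∀ (α : List (Fin (q + 1))) (β : ℕ) (I : List (Fin (q + 1))),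
    ∃ C : ℝ, ∀ x ξ : Pt q,
      ‖α.foldr pdSnd (X.Dxi^[β] (I.foldr X.Dsym a)) (x, ξ)‖ ≤
        C * (1 + ‖ξ‖) ^ (m - β) * (1 + X.rho x ξ + √‖ξ‖) ^ (n - α.length)

/-! ### Derivatives of kernels, functions of `(x, y)` -/

/-- `D_{x,y,i} = ∂/∂x^i + ∂/∂y^i
  + ∑_{k,p,l} (∂B_k^p/∂x^i)(x) A_p^l(x) (x^k - y^k) ∂/∂y^l`. -/
def Dker (i : Fin (q + 1)) (F : Pt q × Pt q → ℂ) : Pt q × Pt q → ℂ :=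
  fun z => pdFst i F z + pdSnd i F z + ∑ k, ∑ p, ∑ l,
    ((pd i (fun x => X.B x k p) z.1 * X.A z.1 p l * (z.1 k - z.2 k) : ℝ) : ℂ) * pdSnd l F z

/-- The good derivatives `(X_i)_x` (for `Sum.inl i`) and `(X_i)_y` (for `Sum.inr i`),
`i = 1, …, N-1`. -/
def Xker : Fin q ⊕ Fin q → (Pt q × Pt q → ℂ) → Pt q × Pt q → ℂ
  | Sum.inl i, F => fun z => ∑ j, (X.A z.1 i.castSucc j : ℂ) * pdFst j F z
  | Sum.inr i, F => fun z => ∑ j, (X.A z.2 i.castSucc j : ℂ) * pdSnd j F z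

end Frame

/-- The coordinate derivatives `∂/∂x^j` (for `Sum.inl j`) and `∂/∂y^j` (for `Sum.inr j`). -/
def pdker {q : ℕ} : Fin (q + 1) ⊕ Fin (q + 1) → (Pt q × Pt q → ℂ) → Pt q × Pt q → ℂ
  | Sum.inl j => pdFst j
  | Sum.inr j => pdSnd j

/-- The integrand `ξ ↦ a(x,ξ) f̂(ξ) e^{2πi x·ξ}`, where `f̂(ξ) = ∫ f(y) e^{-2πi y·ξ} dy`. -/
def opIntegrand {q : ℕ} (a : Pt q × Pt q → ℂ) (f : 𝓢(Pt q, ℂ)) (x ξ : Pt q) : ℂ :=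
  a (x, ξ) * 𝓕 (f : Pt q → ℂ) ξ * Complex.exp (2 * Real.pi * Complex.I * (inner ℝ x ξ : ℝ))

/-- The operator `T_a f(x) = ∫ a(x,ξ) f̂(ξ) e^{2πi x·ξ} dξ`. -/
def op {q : ℕ} (a : Pt q × Pt q → ℂ) (f : 𝓢(Pt q, ℂ)) (x : Pt q) : ℂ :=
  ∫ ξ : Pt q, opIntegrand a f x ξ

/-- The complement of the diagonal in `ℝ^N × ℝ^N`. -/
def offDiag (q : ℕ) : Set (Pt q × Pt q) := {z | z.1 ≠ z.2}

theorem norm_iteratedFDeriv_comp_le {q : ℕ} (f : 𝓢(Pt q, ℂ)) (L : Pt q × Pt q →L[ℝ] Pt q)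
    (hL : ‖L‖ ≤ 1) (i : ℕ) (z : Pt q × Pt q) :
    ‖iteratedFDeriv ℝ i (fun w => f (L w)) z‖ ≤ ‖iteratedFDeriv ℝ i f (L z)‖ := by
  have h := L.iteratedFDeriv_comp_right (f.smooth i) z (le_refl (i : WithTop ℕ∞))
  have h2 : (fun w => f (L w)) = f ∘ L := rfl
  rw [h2, h]
  refine (ContinuousMultilinearMap.norm_compContinuousLinearMap_le _ _).trans ?_
  refine mul_le_of_le_one_right (norm_nonneg _) ?_
  exact Finset.prod_le_one (fun _ _ => norm_nonneg _) (fun _ _ => hL)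

/-- The Schwartz function `(x, y) ↦ g(x) f(y)` on `ℝ^N × ℝ^N`. -/
def tensor {q : ℕ} (g f : 𝓢(Pt q, ℂ)) : 𝓢(Pt q × Pt q, ℂ) where
  toFun z := g z.1 * f z.2
  smooth' := (g.smooth'.comp contDiff_fst).mul (f.smooth'.comp contDiff_snd)
  decay' k n := by
    set Cg := fun i : ℕ => 2 ^ k * (Finset.Iic (k, i)).sup
      (fun m => SchwartzMap.seminorm ℝ m.1 m.2) g with hCg
    set Cf := fun i : ℕ => 2 ^ k * (Finset.Iic (k, i)).sup
      (fun m => SchwartzMap.seminorm ℝ m.1 m.2) f with hCf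
    refine ⟨∑ i ∈ Finset.range (n + 1), (n.choose i : ℝ) * Cg i * Cf (n - i), fun z => ?_⟩
    have hg : ContDiff ℝ n (fun w : Pt q × Pt q => g w.1) := (g.smooth n).comp contDiff_fst
    have hf : ContDiff ℝ n (fun w : Pt q × Pt q => f w.2) := (f.smooth n).comp contDiff_snd
    have h1 := norm_iteratedFDeriv_mul_le hg hf z (le_refl (n : WithTop ℕ∞))
    refine (mul_le_mul_of_nonneg_left h1 (by positivity)).trans ?_
    rw [Finset.mul_sum]
    refine Finset.sum_le_sum fun i _ => ?_
    have hz : ‖z‖ ^ k ≤ (1 + ‖z.1‖) ^ k * (1 + ‖z.2‖) ^ k := by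
      rw [← mul_pow]
      refine pow_le_pow_left₀ (norm_nonneg _) ?_ k
      rw [Prod.norm_def]
      have := norm_nonneg z.1
      have := norm_nonneg z.2
      refine max_le ?_ ?_ <;> nlinarith
    have hgi := SchwartzMap.one_add_le_sup_seminorm_apply (𝕜 := ℝ) (m := (k, i))
      (le_refl k) (le_refl i) g z.1
    have hfi := SchwartzMap.one_add_le_sup_seminorm_apply (𝕜 := ℝ) (m := (k, n - i))
      (le_refl k) (le_refl (n - i)) f z.2
    have hgc := norm_iteratedFDeriv_comp_le g (ContinuousLinearMap.fst ℝ _ _)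
      (ContinuousLinearMap.norm_fst_le ..) i z
    have hfc := norm_iteratedFDeriv_comp_le f (ContinuousLinearMap.snd ℝ _ _)
      (ContinuousLinearMap.norm_snd_le ..) (n - i) z
    simp only [ContinuousLinearMap.coe_fst', ContinuousLinearMap.coe_snd'] at hgc hfc
    calc _ ≤ ((1 + ‖z.1‖) ^ k * (1 + ‖z.2‖) ^ k) * ((n.choose i : ℝ) *
          ‖iteratedFDeriv ℝ i g z.1‖ * ‖iteratedFDeriv ℝ (n - i) f z.2‖) := by gcongr
      _ = (n.choose i : ℝ) * ((1 + ‖z.1‖) ^ k * ‖iteratedFDeriv ℝ i g z.1‖) *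
          ((1 + ‖z.2‖) ^ k * ‖iteratedFDeriv ℝ (n - i) f z.2‖) := by ring
      _ ≤ _ := by
        have h0 : 0 ≤ Cg i := le_trans (by positivity) hgi
        gcongr

/-- `k` is the density of the tempered distribution `K` off the diagonal: `⟨K, Φ⟩ = ∫ k Φ` for
all test functions `Φ` whose support is a compact subset of the complement of the diagonal. -/
def IsDensityOffDiag {q : ℕ} (K : 𝓢'(Pt q × Pt q, ℂ)) (k : Pt q × Pt q → ℂ) : Prop :=
  ∀ Φ : 𝓢(Pt q × Pt q, ℂ), HasCompactSupport Φ → tsupport Φ ⊆ offDiag q →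
    K Φ = ∫ z, k z * Φ z

end MixedPDO

end

open MixedPDO

noncomputable section

namespace MixedPDO

/-! ### Families of functions with weighted derivative bounds -/

/-- A family `f t` of functions on `ℝ^N` is bounded by the weights `p t`, and each derivative of
order at most `n` in the coordinates `g k` costs a factor `wt k t`. -/
def WB {q : ℕ} {ι κ : Type} (g : κ → Fin (q + 1)) (wt : κ → ι → Pt q → ℝ) :
    ℕ → (ι → Pt q → ℝ) → (ι → Pt q → ℂ) → Prop
  | 0, p, f => ∃ C : ℝ, ∀ t ζ, ‖f t ζ‖ ≤ C * p t ζ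
  | n + 1, p, f => (∃ C : ℝ, ∀ t ζ, ‖f t ζ‖ ≤ C * p t ζ) ∧
      ∀ k, WB g wt n (fun t ζ => p t ζ * wt k t ζ) (fun t ζ => fderiv ℝ (f t) ζ (basisVec (g k)))

section WB

variable {q : ℕ} {ι κ : Type} {g : κ → Fin (q + 1)} {wt : κ → ι → Pt q → ℝ}

theorem WB.bound {n : ℕ} {p : ι → Pt q → ℝ} {f : ι → Pt q → ℂ} (h : WB g wt n p f) :
    ∃ C : ℝ, ∀ t ζ, ‖f t ζ‖ ≤ C * p t ζ := by
  cases n with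
  | zero => exact h
  | succ n => exact h.1

theorem WB.mono_order {n : ℕ} {p : ι → Pt q → ℝ} {f : ι → Pt q → ℂ} (h : WB g wt (n + 1) p f) :
    WB g wt n p f := by
  induction n generalizing p f with
  | zero => exact h.1
  | succ n ih => exact ⟨h.1, fun k => ih (h.2 k)⟩

theorem WB.reindex {κ' : Type} {e : κ' → κ} {wt' : κ' → ι → Pt q → ℝ} {c : ℝ}
    (hwt0 : ∀ k t ζ, 0 ≤ wt k t ζ) (hwt : ∀ k t ζ, wt (e k) t ζ ≤ wt' k t ζ) {n : ℕ}
    {p p' : ι → Pt q → ℝ} {f : ι → Pt q → ℂ}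
    (hp : ∀ t ζ, 0 ≤ p t ζ) (hpp : ∀ t ζ, p t ζ ≤ c * p' t ζ) (h : WB g wt n p f) :
    WB (g ∘ e) wt' n p' f := by
  have key : ∀ {p p' : ι → Pt q → ℝ} {f : ι → Pt q → ℂ}, (∀ t ζ, 0 ≤ p t ζ) →
      (∀ t ζ, p t ζ ≤ c * p' t ζ) → (∃ C : ℝ, ∀ t ζ, ‖f t ζ‖ ≤ C * p t ζ) →
      ∃ C : ℝ, ∀ t ζ, ‖f t ζ‖ ≤ C * p' t ζ := by
    rintro p p' f hp hpp ⟨C, hC⟩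
    refine ⟨|C| * c, fun t ζ => (hC t ζ).trans ?_⟩
    rw [mul_assoc]
    exact mul_le_mul (le_abs_self C) (hpp t ζ) (hp t ζ) (abs_nonneg C)
  induction n generalizing p p' f with
  | zero => exact key hp hpp h
  | succ n ih =>
    refine ⟨key hp hpp h.1, fun k => ih (fun t ζ => mul_nonneg (hp t ζ) (hwt0 _ t ζ)) ?_
      (h.2 (e k))⟩
    intro t ζ
    rw [← mul_assoc]
    exact mul_le_mul (hpp t ζ) (hwt k t ζ) (hwt0 _ t ζ) ((hp t ζ).trans (hpp t ζ))

theorem WB.mono {n : ℕ} {p p' : ι → Pt q → ℝ} {f : ι → Pt q → ℂ}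
    (hwt0 : ∀ k t ζ, 0 ≤ wt k t ζ) (c : ℝ)
    (hp : ∀ t ζ, 0 ≤ p t ζ) (hpp : ∀ t ζ, p t ζ ≤ c * p' t ζ) (h : WB g wt n p f) :
    WB g wt n p' f :=
  WB.reindex (e := id) hwt0 (fun _ _ _ => le_rfl) hp hpp h

theorem WB.comp_index {ι' : Type} (e : ι' → ι) {n : ℕ} {p : ι → Pt q → ℝ} {f : ι → Pt q → ℂ}
    (h : WB g wt n p f) :
    WB g (fun k t => wt k (e t)) n (fun t => p (e t)) (fun t => f (e t)) := by
  induction n generalizing p f with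
  | zero => exact h.imp fun C hC t => hC (e t)
  | succ n ih => exact ⟨h.1.imp fun C hC t => hC (e t), fun k => ih (h.2 k)⟩

theorem contDiff_fderiv_apply {E : Type} [NormedAddCommGroup E] [NormedSpace ℝ E]
    {f : E → ℂ} (hf : ContDiff ℝ ∞ f) (v : E) :
    ContDiff ℝ ∞ (fun ζ => fderiv ℝ f ζ v) :=
  (hf.fderiv_right (m := ∞) (by norm_num)).clm_apply contDiff_const

theorem WB.add {n : ℕ} {p : ι → Pt q → ℝ} {f f' : ι → Pt q → ℂ}
    (hf : ∀ t, ContDiff ℝ ∞ (f t)) (hf' : ∀ t, ContDiff ℝ ∞ (f' t))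
    (h : WB g wt n p f) (h' : WB g wt n p f') : WB g wt n p (fun t ζ => f t ζ + f' t ζ) := by
  have key : ∀ {p : ι → Pt q → ℝ} {f f' : ι → Pt q → ℂ},
      (∃ C : ℝ, ∀ t ζ, ‖f t ζ‖ ≤ C * p t ζ) → (∃ C : ℝ, ∀ t ζ, ‖f' t ζ‖ ≤ C * p t ζ) →
      ∃ C : ℝ, ∀ t ζ, ‖f t ζ + f' t ζ‖ ≤ C * p t ζ := by
    rintro p f f' ⟨C, hC⟩ ⟨C', hC'⟩
    refine ⟨C + C', fun t ζ => (norm_add_le _ _).trans ?_⟩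
    rw [add_mul]
    exact add_le_add (hC t ζ) (hC' t ζ)
  induction n generalizing p f f' with
  | zero => exact key h h'
  | succ n ih =>
    refine ⟨key h.1 h'.1, fun k => ?_⟩
    have := ih (fun t => contDiff_fderiv_apply (hf t) (basisVec (g k)))
      (fun t => contDiff_fderiv_apply (hf' t) (basisVec (g k))) (h.2 k) (h'.2 k)
    convert this using 3 with t ζ
    change fderiv ℝ (f t + f' t) ζ _ = _
    rw [fderiv_add ((hf t).differentiable (by simp) ζ) ((hf' t).differentiable (by simp) ζ)]
    rfl

theorem WB.mul {n : ℕ} {p p' : ι → Pt q → ℝ} {f f' : ι → Pt q → ℂ}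
    (hf : ∀ t, ContDiff ℝ ∞ (f t)) (hf' : ∀ t, ContDiff ℝ ∞ (f' t))
    (h : WB g wt n p f) (h' : WB g wt n p' f') :
    WB g wt n (fun t ζ => p t ζ * p' t ζ) (fun t ζ => f t ζ * f' t ζ) := by
  have key : ∀ {p p' : ι → Pt q → ℝ} {f f' : ι → Pt q → ℂ},
      (∃ C : ℝ, ∀ t ζ, ‖f t ζ‖ ≤ C * p t ζ) → (∃ C : ℝ, ∀ t ζ, ‖f' t ζ‖ ≤ C * p' t ζ) →
      ∃ C : ℝ, ∀ t ζ, ‖f t ζ * f' t ζ‖ ≤ C * (p t ζ * p' t ζ) := by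
    rintro p p' f f' ⟨C, hC⟩ ⟨C', hC'⟩
    refine ⟨C * C', fun t ζ => ?_⟩
    rw [norm_mul, mul_mul_mul_comm]
    exact mul_le_mul (hC t ζ) (hC' t ζ) (norm_nonneg _) ((norm_nonneg _).trans (hC t ζ))
  induction n generalizing p p' f f' with
  | zero => exact key h h'
  | succ n ih =>
    refine ⟨key h.1 h'.1, fun k => ?_⟩
    have d := fun t => contDiff_fderiv_apply (hf t) (basisVec (g k))
    have d' := fun t => contDiff_fderiv_apply (hf' t) (basisVec (g k))
    have h1 := ih hf d' h.mono_order (h'.2 k)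
    have h2 := ih d hf' (h.2 k) h'.mono_order
    have e1 : (fun t ζ => p t ζ * (p' t ζ * wt k t ζ)) = fun t ζ => p t ζ * p' t ζ * wt k t ζ := by
      funext t ζ; ring
    have e2 : (fun t ζ => p t ζ * wt k t ζ * p' t ζ) = fun t ζ => p t ζ * p' t ζ * wt k t ζ := by
      funext t ζ; ring
    rw [e1] at h1
    rw [e2] at h2
    have := WB.add (fun t => (hf t).mul (d' t)) (fun t => (d t).mul (hf' t)) h1 h2
    convert this using 3 with t ζ
    change fderiv ℝ (f t * f' t) ζ _ = _
    rw [fderiv_mul ((hf t).differentiable (by simp) ζ) ((hf' t).differentiable (by simp) ζ)]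
    simp [mul_comm]

theorem WB.const_mul {n : ℕ} {p : ι → Pt q → ℝ} {f : ι → Pt q → ℂ}
    (hf : ∀ t, ContDiff ℝ ∞ (f t)) {c : ι → ℂ} {w : ι → ℝ} (hc : ∀ t, ‖c t‖ ≤ w t)
    (h : WB g wt n p f) : WB g wt n (fun t ζ => w t * p t ζ) (fun t ζ => c t * f t ζ) := by
  have key : ∀ {p : ι → Pt q → ℝ} {f : ι → Pt q → ℂ},
      (∃ C : ℝ, ∀ t ζ, ‖f t ζ‖ ≤ C * p t ζ) →
      ∃ C : ℝ, ∀ t ζ, ‖c t * f t ζ‖ ≤ C * (w t * p t ζ) := by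
    rintro p f ⟨C, hC⟩
    refine ⟨C, fun t ζ => ?_⟩
    rw [norm_mul, mul_left_comm]
    exact mul_le_mul (hc t) (hC t ζ) (norm_nonneg _) ((norm_nonneg _).trans (hc t))
  induction n generalizing p f with
  | zero => exact key h
  | succ n ih =>
    refine ⟨key h.1, fun k => ?_⟩
    have := ih (fun t => contDiff_fderiv_apply (hf t) (basisVec (g k))) (h.2 k)
    convert this using 3 with t ζ t ζ
    · ring
    · rw [fderiv_const_mul ((hf t).differentiable (by simp) ζ)]
      simp

/-- The iterated derivative `∂_v^L f`. -/
def iterD {q : ℕ} (v : Pt q) (L : ℕ) (f : Pt q → ℂ) : Pt q → ℂ :=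
  (fun h ζ => fderiv ℝ h ζ v)^[L] f

theorem iterD_succ (v : Pt q) (L : ℕ) (f : Pt q → ℂ) :
    iterD v (L + 1) f = iterD v L (fun ζ => fderiv ℝ f ζ v) := rfl

theorem contDiff_iterD (v : Pt q) (L : ℕ) {f : Pt q → ℂ} (hf : ContDiff ℝ ∞ f) :
    ContDiff ℝ ∞ (iterD v L f) := by
  induction L generalizing f with
  | zero => exact hf
  | succ L ih => exact ih (contDiff_fderiv_apply hf v)

theorem hasCompactSupport_fderiv_apply {f : Pt q → ℂ} (hf : HasCompactSupport f) (v : Pt q) :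
    HasCompactSupport (fun ζ => fderiv ℝ f ζ v) :=
  hf.fderiv_apply (𝕜 := ℝ) v

theorem hasCompactSupport_iterD (v : Pt q) (L : ℕ) {f : Pt q → ℂ} (hf : HasCompactSupport f) :
    HasCompactSupport (iterD v L f) := by
  induction L generalizing f with
  | zero => exact hf
  | succ L ih => exact ih (hasCompactSupport_fderiv_apply hf v)

theorem WB.iterD {n L : ℕ} {p : ι → Pt q → ℝ} {f : ι → Pt q → ℂ} (k : κ)
    (h : WB g wt (n + L) p f) :
    WB g wt n (fun t ζ => p t ζ * wt k t ζ ^ L) (fun t => iterD (basisVec (g k)) L (f t)) := by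
  induction L generalizing p f with
  | zero => simpa [MixedPDO.iterD] using h
  | succ L ih =>
    have := ih (h.2 k)
    simp only [iterD_succ]
    convert this using 3
    ring

/-! ### Dilations -/

/-- The diagonal linear map `ζ ↦ (r_k ζ_k)_k`. -/
def dil {q : ℕ} (r : Fin (q + 1) → ℝ) : Pt q →L[ℝ] Pt q :=
  LinearMap.toContinuousLinearMap
    { toFun := fun ζ => WithLp.toLp 2 (fun k => r k * ζ k)
      map_add' := fun x y => by ext k; simp [mul_add]
      map_smul' := fun c x => by ext k; simp [mul_left_comm] }

@[simp] theorem dil_apply (r : Fin (q + 1) → ℝ) (ζ : Pt q) (k : Fin (q + 1)) :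
    dil r ζ k = r k * ζ k := rfl

theorem dil_basisVec (r : Fin (q + 1) → ℝ) (k : Fin (q + 1)) :
    dil r (basisVec k) = r k • basisVec k := by
  ext j
  by_cases h : j = k
  · subst h; simp [basisVec]
  · simp [basisVec, h]

theorem WB_dil {r : ι → Fin (q + 1) → ℝ} {Z : Set (Pt q)} (hZ : IsClosed Z) {c₀ : ℝ}
    (hwt0 : ∀ k t ζ, 0 ≤ wt k t ζ)
    (hr : ∀ k t ζ, dil (r t) ζ ∈ Z → |r t (g k)| ≤ c₀ * wt k t ζ) (n : ℕ) {Φ : Pt q → ℂ}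
    (hΦ : ContDiff ℝ ∞ Φ) (hΦc : HasCompactSupport Φ) (hΦZ : ∀ z ∉ Z, Φ z = 0) {c : ι → ℂ}
    {p : ι → Pt q → ℝ} (hp : ∀ t ζ, 0 ≤ p t ζ) {c₁ : ℝ}
    (hc : ∀ t ζ, dil (r t) ζ ∈ Z → ‖c t‖ ≤ c₁ * p t ζ) :
    WB g wt n p (fun t ζ => c t * Φ (dil (r t) ζ)) := by
  have key : ∀ {Φ : Pt q → ℂ}, Continuous Φ → HasCompactSupport Φ → (∀ z ∉ Z, Φ z = 0) →
      ∀ {c : ι → ℂ} {p : ι → Pt q → ℝ}, (∀ t ζ, 0 ≤ p t ζ) → ∀ {c₁ : ℝ},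
      (∀ t ζ, dil (r t) ζ ∈ Z → ‖c t‖ ≤ c₁ * p t ζ) →
      ∃ C : ℝ, ∀ t ζ, ‖c t * Φ (dil (r t) ζ)‖ ≤ C * p t ζ := by
    intro Φ hΦ hΦc hΦZ c p hp c₁ hc
    obtain ⟨C, hC⟩ := hΦc.exists_bound_of_continuous hΦ
    refine ⟨|c₁| * |C|, fun t ζ => ?_⟩
    by_cases hz : dil (r t) ζ ∈ Z
    · rw [norm_mul, mul_right_comm]
      refine mul_le_mul ((hc t ζ hz).trans ?_) ((hC _).trans (le_abs_self C)) (norm_nonneg _)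
        (mul_nonneg (abs_nonneg _) (hp t ζ))
      exact mul_le_mul_of_nonneg_right (le_abs_self _) (hp t ζ)
    · rw [hΦZ _ hz, mul_zero, norm_zero]
      have := hp t ζ
      positivity
  induction n generalizing Φ c p c₁ with
  | zero => exact key hΦ.continuous hΦc hΦZ hp hc
  | succ n ih =>
    refine ⟨key hΦ.continuous hΦc hΦZ hp hc, fun k => ?_⟩
    have hZ' : ∀ z ∉ Z, fderiv ℝ Φ z (basisVec (g k)) = 0 := by
      intro z hz
      have : Φ =ᶠ[nhds z] fun _ => 0 := by
        filter_upwards [hZ.isOpen_compl.mem_nhds hz] with y hy using hΦZ y hy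
      rw [this.fderiv_eq]
      simp
    have := ih (contDiff_fderiv_apply hΦ (basisVec (g k)))
      (hasCompactSupport_fderiv_apply hΦc _) hZ' (c := fun t => c t * (r t (g k) : ℂ))
      (p := fun t ζ => p t ζ * wt k t ζ)
      (fun t ζ => mul_nonneg (hp t ζ) (hwt0 k t ζ)) (c₁ := c₁ * c₀) (fun t ζ hz => by
        rw [norm_mul, mul_mul_mul_comm]
        refine mul_le_mul (hc t ζ hz) ?_ (norm_nonneg _) ((norm_nonneg _).trans (hc t ζ hz))
        simpa using hr k t ζ hz)
    convert this using 3 with t ζ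
    have hd : HasFDerivAt (fun ζ => c t * Φ (dil (r t) ζ))
        (c t • (fderiv ℝ Φ (dil (r t) ζ)).comp (dil (r t))) ζ :=
      ((hΦ.differentiable (by simp) _).hasFDerivAt.comp ζ (dil (r t)).hasFDerivAt).const_mul (c t)
    rw [hd.fderiv]
    simp [dil_basisVec, mul_assoc]

end WB

/-! ### Integration by parts against exponentials -/

section IBP

variable {q : ℕ}

/-- The character `e^{2πi θ·ζ}`. -/
def chr (θ ζ : Pt q) : ℂ := Complex.exp (2 * Real.pi * Complex.I * (inner ℝ θ ζ : ℝ))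

theorem norm_chr (θ ζ : Pt q) : ‖chr θ ζ‖ = 1 := by
  have : (2 * Real.pi * Complex.I * (inner ℝ θ ζ : ℝ) : ℂ)
      = ((2 * Real.pi * inner ℝ θ ζ : ℝ) : ℂ) * Complex.I := by push_cast; ring
  rw [chr, this, Complex.norm_exp_ofReal_mul_I]

theorem contDiff_chr_uncurry {n : WithTop ℕ∞} : ContDiff ℝ n (fun z : Pt q × Pt q => chr z.1 z.2) := by
  unfold chr
  have h : ContDiff ℝ n (fun z : Pt q × Pt q => ((inner ℝ z.1 z.2 : ℝ) : ℂ)) :=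
    Complex.ofRealCLM.contDiff.comp (contDiff_fst.inner ℝ contDiff_snd)
  exact (contDiff_const.mul h).cexp

theorem contDiff_chr (θ : Pt q) {n : WithTop ℕ∞} : ContDiff ℝ n (chr θ) :=
  contDiff_chr_uncurry.comp (contDiff_const.prodMk contDiff_id)

theorem hasFDerivAt_chr (θ ζ : Pt q) :
    HasFDerivAt (chr θ) ((2 * Real.pi * Complex.I * chr θ ζ) •
      Complex.ofRealCLM.comp (innerSL ℝ θ)) ζ := by
  have h1 : HasFDerivAt (fun ζ => ((inner ℝ θ ζ : ℝ) : ℂ))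
      (Complex.ofRealCLM.comp (innerSL ℝ θ)) ζ :=
    (Complex.ofRealCLM.comp (innerSL ℝ θ)).hasFDerivAt
  have := (h1.const_mul (2 * Real.pi * Complex.I)).cexp
  rw [smul_smul, mul_comm _ (2 * Real.pi * Complex.I : ℂ)] at this
  exact this

theorem inner_basisVec (θ : Pt q) (k : Fin (q + 1)) : inner ℝ θ (basisVec k) = θ k := by
  simp [basisVec, EuclideanSpace.inner_single_right]

theorem fderiv_chr_basisVec (θ ζ : Pt q) (k : Fin (q + 1)) :
    fderiv ℝ (chr θ) ζ (basisVec k) = 2 * Real.pi * Complex.I * θ k * chr θ ζ := by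
  rw [(hasFDerivAt_chr θ ζ).fderiv]
  simp [inner_basisVec]
  ring

theorem integral_fderiv_mul_chr {f : Pt q → ℂ} (hf : ContDiff ℝ ∞ f) (hc : HasCompactSupport f)
    (θ : Pt q) (k : Fin (q + 1)) :
    ∫ ζ, fderiv ℝ f ζ (basisVec k) * chr θ ζ
      = (-(2 * Real.pi * Complex.I * θ k)) * ∫ ζ, f ζ * chr θ ζ := by
  have cint : ∀ {h e : Pt q → ℂ}, Continuous h → HasCompactSupport h → Continuous e →
      Integrable (fun ζ => h ζ * e ζ) := fun hh hhc he =>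
    (hh.mul he).integrable_of_hasCompactSupport hhc.mul_right
  have hd := contDiff_fderiv_apply hf (basisVec k)
  have hdc := contDiff_fderiv_apply (contDiff_chr (n := ∞) θ) (basisVec k)
  have := integral_mul_fderiv_eq_neg_fderiv_mul_of_integrable (μ := volume) (f := f) (g := chr θ)
    (v := basisVec k)
    (cint hd.continuous (hasCompactSupport_fderiv_apply hc _) (contDiff_chr (n := 0) θ).continuous)
    (cint hf.continuous hc hdc.continuous)
    (cint hf.continuous hc (contDiff_chr (n := 0) θ).continuous)
    (fun x _ => hf.differentiable (by simp) x)
    (fun x _ => (contDiff_chr (n := ∞) θ).differentiable (by simp) x)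
  rw [← neg_eq_iff_eq_neg.mpr this]
  rw [neg_mul, ← integral_const_mul]
  congr 2
  funext ζ
  rw [fderiv_chr_basisVec]
  ring

theorem integral_iterD_mul_chr {f : Pt q → ℂ} (hf : ContDiff ℝ ∞ f) (hc : HasCompactSupport f)
    (θ : Pt q) (k : Fin (q + 1)) (L : ℕ) :
    ∫ ζ, iterD (basisVec k) L f ζ * chr θ ζ
      = (-(2 * Real.pi * Complex.I * θ k)) ^ L * ∫ ζ, f ζ * chr θ ζ := by
  induction L generalizing f with
  | zero => simp [iterD]
  | succ L ih =>
    rw [iterD_succ, ih (contDiff_fderiv_apply hf _) (hasCompactSupport_fderiv_apply hc _),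
      integral_fderiv_mul_chr hf hc, pow_succ]
    ring

theorem norm_two_pi_I_mul (a : ℝ) : ‖(2 * Real.pi * Complex.I * a : ℂ)‖ = 2 * Real.pi * |a| := by
  simp [abs_of_pos Real.pi_pos]

end IBP

/-! ### Weights -/

/-- The weight `1 + |ζ|`. -/
def wR {q : ℕ} (ζ : Pt q) : ℝ := 1 + ‖ζ‖

/-- The Euclidean norm of the first `N - 1` coordinates. -/
def pn {q : ℕ} (ζ : Pt q) : ℝ := √(∑ i : Fin q, ζ i.castSucc ^ 2)

/-- The weight `1 + |ζ'| + |ζ|^{1/2}`. -/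
def wS {q : ℕ} (ζ : Pt q) : ℝ := 1 + pn ζ + √‖ζ‖

section weights

variable {q : ℕ} (ζ : Pt q)

theorem pn_nonneg : 0 ≤ pn ζ := Real.sqrt_nonneg _

theorem one_le_wR : 1 ≤ wR ζ := by
  have := norm_nonneg ζ
  unfold wR; linarith

theorem one_le_wS : 1 ≤ wS ζ := by
  have := pn_nonneg ζ
  have := Real.sqrt_nonneg ‖ζ‖
  unfold wS; linarith

theorem wR_pos : 0 < wR ζ := zero_lt_one.trans_le (one_le_wR ζ)

theorem wS_pos : 0 < wS ζ := zero_lt_one.trans_le (one_le_wS ζ)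

theorem norm_sq_eq_pn : ‖ζ‖ ^ 2 = pn ζ ^ 2 + ζ (Fin.last q) ^ 2 := by
  rw [EuclideanSpace.norm_sq_eq, Fin.sum_univ_castSucc, pn, Real.sq_sqrt]
  · simp
  · positivity

theorem pn_le_norm : pn ζ ≤ ‖ζ‖ := by
  refine abs_le_of_sq_le_sq' ?_ (norm_nonneg _) |>.2
  rw [norm_sq_eq_pn]
  nlinarith [sq_nonneg (ζ (Fin.last q))]

theorem abs_coord_le_norm (k : Fin (q + 1)) : |ζ k| ≤ ‖ζ‖ := by
  simpa using PiLp.norm_apply_le ζ k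

theorem norm_le_pn_add : ‖ζ‖ ≤ pn ζ + |ζ (Fin.last q)| := by
  refine abs_le_of_sq_le_sq' ?_ (add_nonneg (pn_nonneg _) (abs_nonneg _)) |>.2
  rw [norm_sq_eq_pn, add_sq, sq_abs]
  nlinarith [mul_nonneg (pn_nonneg ζ) (abs_nonneg (ζ (Fin.last q)))]

theorem abs_coord_le_pn (i : Fin q) : |ζ i.castSucc| ≤ pn ζ := by
  rw [pn]
  refine Real.abs_le_sqrt ?_
  exact Finset.single_le_sum (f := fun i : Fin q => ζ i.castSucc ^ 2) (fun i _ => sq_nonneg _)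
    (Finset.mem_univ i)

theorem pn_le_wS : 1 + pn ζ ≤ wS ζ := by
  have := Real.sqrt_nonneg ‖ζ‖
  unfold wS; linarith

theorem wR_le_sq : wR ζ ≤ wS ζ ^ 2 := by
  have h1 := pn_nonneg ζ
  have h2 := Real.sqrt_nonneg ‖ζ‖
  have h3 := Real.sq_sqrt (norm_nonneg ζ)
  unfold wS wR
  nlinarith [mul_nonneg h1 h2]

theorem wS_le_two_wR : wS ζ ≤ 2 * wR ζ := by
  have h1 := pn_le_norm ζ
  have h2 := Real.sqrt_nonneg ‖ζ‖
  have h3 := Real.sq_sqrt (norm_nonneg ζ)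
  unfold wS wR
  nlinarith [sq_nonneg (√‖ζ‖ - 1)]

theorem continuous_pn : Continuous (pn : Pt q → ℝ) := by unfold pn; fun_prop

theorem continuous_wR : Continuous (wR : Pt q → ℝ) := by unfold wR; fun_prop

theorem continuous_wS : Continuous (wS : Pt q → ℝ) := by
  have := continuous_pn (q := q)
  unfold wS; fun_prop

end weights

/-! ### The integral of the weights -/

theorem integrable_abs_rpow_mul {a : ℝ} (ha : -1 < a) (ha0 : a ≤ 0) :
    Integrable (fun t : ℝ => |t| ^ a * ((1 + |t|) ^ 2)⁻¹) := by
  have h1 : IntegrableOn (fun t : ℝ => t ^ a * ((1 + t) ^ 2)⁻¹) (Set.Ioi 0) := by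
    have e : Set.Ioi (0 : ℝ) = Set.Ioc 0 1 ∪ Set.Ioi 1 := by
      rw [Set.Ioc_union_Ioi_eq_Ioi zero_le_one]
    have hm : Measurable (fun t : ℝ => t ^ a * ((1 + t) ^ 2)⁻¹) := by fun_prop
    rw [e]
    refine IntegrableOn.union ?_ ?_
    · have hi : IntegrableOn (fun t : ℝ => t ^ a) (Set.Ioc 0 1) := by
        have := intervalIntegral.intervalIntegrable_rpow' (a := 0) (b := 1) ha
        rwa [intervalIntegrable_iff_integrableOn_Ioc_of_le zero_le_one] at this
      refine Integrable.mono' hi hm.aestronglyMeasurable ?_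
      filter_upwards [ae_restrict_mem measurableSet_Ioc] with t ht
      have h0 : 0 ≤ t ^ a := Real.rpow_nonneg ht.1.le a
      rw [Real.norm_of_nonneg (by have := ht.1; positivity)]
      refine mul_le_of_le_one_right h0 (inv_le_one_of_one_le₀ ?_)
      nlinarith [ht.1]
    · have hi : IntegrableOn (fun t : ℝ => t ^ (-2 : ℝ)) (Set.Ioi 1) :=
        integrableOn_Ioi_rpow_of_lt (by norm_num) zero_lt_one
      refine Integrable.mono' hi hm.aestronglyMeasurable ?_
      filter_upwards [ae_restrict_mem measurableSet_Ioi] with t ht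
      have ht1 : 1 < t := ht
      have ht0 : 0 < t := by linarith
      rw [Real.norm_of_nonneg (by positivity), Real.rpow_neg ht0.le]
      have h2 : t ^ a ≤ 1 := Real.rpow_le_one_of_one_le_of_nonpos ht1.le ha0
      calc t ^ a * ((1 + t) ^ 2)⁻¹ ≤ 1 * ((1 + t) ^ 2)⁻¹ := by gcongr
        _ = ((1 + t) ^ 2)⁻¹ := one_mul _
        _ ≤ _ := by
          rw [show (2 : ℝ) = ((2 : ℕ) : ℝ) by norm_num, Real.rpow_natCast]
          gcongr
          linarith
  have h2 : IntegrableOn (fun t : ℝ => |t| ^ a * ((1 + |t|) ^ 2)⁻¹) (Set.Ioi 0) :=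
    h1.congr_fun (fun t ht => by simp [abs_of_pos (Set.mem_Ioi.mp ht)]) measurableSet_Ioi
  have h3 : IntegrableOn (fun t : ℝ => |t| ^ a * ((1 + |t|) ^ 2)⁻¹) (Set.Iic 0) := by
    rw [← Measure.map_neg_eq_self (volume : Measure ℝ)]
    let m : MeasurableEmbedding fun x : ℝ => -x := (Homeomorph.neg ℝ).measurableEmbedding
    rw [m.integrableOn_map_iff]
    simp only [Function.comp_def, abs_neg, Set.neg_preimage, Set.neg_Iic, neg_zero]
    exact Iff.mpr integrableOn_Ici_iff_integrableOn_Ioi h2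
  rw [← integrableOn_univ, ← Set.Iic_union_Ioi (a := (0 : ℝ))]
  exact h3.union h2

theorem integral_one_dim_le {a : ℝ} (ha : -1 < a) (ha0 : a ≤ 0) :
    ∃ C : ℝ, ∀ r : ℝ, 0 < r →
      Integrable (fun t : ℝ => (1 + |t|) ^ a * ((1 + r * |t|) ^ 2)⁻¹) ∧
      ∫ t : ℝ, (1 + |t|) ^ a * ((1 + r * |t|) ^ 2)⁻¹ ≤ C * r ^ (-1 - a) := by
  refine ⟨∫ t : ℝ, |t| ^ a * ((1 + |t|) ^ 2)⁻¹, fun r hr => ?_⟩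
  have hφ := integrable_abs_rpow_mul ha ha0
  have hφr : Integrable (fun t : ℝ => r ^ (-a) * (|r * t| ^ a * ((1 + |r * t|) ^ 2)⁻¹)) :=
    (hφ.comp_mul_left' hr.ne').const_mul _
  have hle : ∀ᵐ t : ℝ, (1 + |t|) ^ a * ((1 + r * |t|) ^ 2)⁻¹ ≤
      r ^ (-a) * (|r * t| ^ a * ((1 + |r * t|) ^ 2)⁻¹) := by
    filter_upwards [compl_mem_ae_iff.mpr (measure_singleton (0 : ℝ))] with t ht
    have ht0 : 0 < |t| := abs_pos.mpr ht
    rw [abs_mul, abs_of_pos hr, Real.mul_rpow hr.le ht0.le, Real.rpow_neg hr.le, ← mul_assoc,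
      ← mul_assoc, inv_mul_cancel₀ (Real.rpow_pos_of_pos hr a).ne', one_mul]
    refine mul_le_mul_of_nonneg_right ?_ (by positivity)
    exact Real.rpow_le_rpow_of_nonpos ht0 (by linarith) ha0
  have hint : Integrable (fun t : ℝ => (1 + |t|) ^ a * ((1 + r * |t|) ^ 2)⁻¹) := by
    refine hφr.mono' (by fun_prop) ?_
    filter_upwards [hle] with t ht
    rwa [Real.norm_of_nonneg (by positivity)]
  refine ⟨hint, (integral_mono_ae hint hφr hle).trans (le_of_eq ?_)⟩
  rw [integral_const_mul, Measure.integral_comp_mul_left (fun t => |t| ^ a * ((1 + |t|) ^ 2)⁻¹) r,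
    abs_of_pos (inv_pos.mpr hr), smul_eq_mul, sub_eq_add_neg, Real.rpow_add hr, Real.rpow_neg_one]
  ring

theorem integral_prod_coord {q : ℕ} {f : Fin (q + 1) → ℝ → ℝ} (hf : ∀ k, Integrable (f k)) :
    Integrable (fun ζ : Pt q => ∏ k, f k (ζ k)) ∧
      ∫ ζ : Pt q, ∏ k, f k (ζ k) = ∏ k, ∫ t, f k t := by
  have hp := EuclideanSpace.volume_preserving_symm_measurableEquiv_toLp (Fin (q + 1))
  have e : (fun ζ : Pt q => ∏ k, f k (ζ k)) =
      (fun z : Fin (q + 1) → ℝ => ∏ k, f k (z k)) ∘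
        (MeasurableEquiv.toLp 2 (Fin (q + 1) → ℝ)).symm := rfl
  refine ⟨?_, ?_⟩
  · rw [e]
    exact (hp.integrable_comp_emb (MeasurableEquiv.measurableEmbedding _)).mpr
      (Integrable.fintype_prod hf)
  · rw [← integral_fintype_prod_volume_eq_prod f]
    exact hp.integral_comp (MeasurableEquiv.measurableEmbedding _)
      (fun z : Fin (q + 1) → ℝ => ∏ k, f k (z k))

/-- The integrand controlling an oscillatory integral with frequencies `δ` and `τ`. -/
def oscWeight {q : ℕ} (m n : ℝ) (K : ℕ) (δ τ : ℝ) (ζ : Pt q) : ℝ :=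
  wR ζ ^ m * wS ζ ^ n * ((1 + δ * wS ζ) ^ K)⁻¹ * ((1 + τ * |ζ (Fin.last q)|) ^ K)⁻¹

set_option maxHeartbeats 1000000 in
theorem oscWeight_le {q : ℕ} {m n : ℝ} (hn : -(q : ℝ) < n) {M : ℝ} (hM : 0 ≤ M) {K : ℕ}
    (hK : (n - min n 0) + 2 * q + 2 * (m - min m 0) + 4 + M ≤ K) {δ τ : ℝ} (hδ : 0 < δ)
    (hτ : 0 ≤ τ) (hτδ : τ ≤ δ) (ζ : Pt q) :
    oscWeight m n K δ τ ζ ≤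
      (2 ^ (m - min m 0) * δ ^ (-(n - min n 0) - M) * (max τ (δ ^ 2)) ^ (-(m - min m 0))) *
      ((∏ i : Fin q, (1 + |ζ i.castSucc|) ^ (min n 0 / q) * ((1 + δ * |ζ i.castSucc|) ^ 2)⁻¹) *
        ((1 + |ζ (Fin.last q)|) ^ (min m 0) *
          ((1 + max τ (δ ^ 2) * |ζ (Fin.last q)|) ^ 2)⁻¹)) := by
  set n' := min n 0
  set m' := min m 0
  set σ := max τ (δ ^ 2)
  set z := |ζ (Fin.last q)| with hz
  have hn' : n' ≤ 0 := min_le_right _ _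
  have hm' : m' ≤ 0 := min_le_right _ _
  have hk1 : 0 ≤ n - n' := by have := min_le_left n 0; linarith
  have hc : 0 ≤ m - m' := by have := min_le_left m 0; linarith
  have hσ : 0 < σ := lt_max_of_lt_right (by positivity)
  have hz0 : 0 ≤ z := abs_nonneg _
  have hS := one_le_wS ζ
  have hS0 := wS_pos ζ
  have hR0 := wR_pos ζ
  set X := 1 + δ * wS ζ with hX
  set Y := 1 + τ * z with hY
  have hX1 : 1 ≤ X := by have : 0 < δ * wS ζ := by positivity
                         linarith
  have hY1 : 1 ≤ Y := by have : 0 ≤ τ * z := by positivity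
                         linarith
  have hX0 : 0 < X := by linarith
  have hY0 : 0 < Y := by linarith
  have hzS : 1 + z ≤ wS ζ ^ 2 := by
    have := wR_le_sq ζ
    have := abs_coord_le_norm ζ (Fin.last q)
    unfold wR at *
    linarith
  have hδX : δ * wS ζ ≤ X := by rw [hX]; linarith
  have hX2 : 1 + δ ^ 2 * wS ζ ^ 2 ≤ X ^ 2 := by
    rw [hX]
    have : 0 < δ * wS ζ := by positivity
    nlinarith
  have hσz : 1 + σ * z ≤ X ^ 2 * Y := by
    rcases max_cases τ (δ ^ 2) with h | h
    · rw [show σ = τ from h.1]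
      have : 1 ≤ X ^ 2 := one_le_pow₀ hX1
      nlinarith
    · rw [show σ = δ ^ 2 from h.1]
      have h1 : δ ^ 2 * z ≤ δ ^ 2 * wS ζ ^ 2 := by gcongr; linarith
      nlinarith [sq_nonneg X]
  have hσR : σ * wR ζ ≤ 2 * (X ^ 2 * Y) := by
    rcases max_cases τ (δ ^ 2) with h | h
    · rw [show σ = τ from h.1]
      have h1 : wR ζ ≤ wS ζ + z := by
        have := norm_le_pn_add ζ
        have := pn_le_wS ζ
        unfold wR; linarith
      have h2 : τ * wR ζ ≤ δ * wS ζ + τ * z := by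
        calc τ * wR ζ ≤ τ * (wS ζ + z) := by gcongr
          _ = τ * wS ζ + τ * z := by ring
          _ ≤ _ := by gcongr
      have h3 : X + Y ≤ 2 * (X * Y) := by nlinarith
      have h4 : X * Y ≤ X ^ 2 * Y := by
        have : X ≤ X ^ 2 := by nlinarith
        gcongr
      rw [hX, hY] at *
      linarith
    · rw [show σ = δ ^ 2 from h.1]
      have h1 : δ ^ 2 * wR ζ ≤ δ ^ 2 * wS ζ ^ 2 := by gcongr; exact wR_le_sq ζ
      have : 0 ≤ X ^ 2 := sq_nonneg X
      nlinarith
  have hXK : (X ^ K)⁻¹ ≤ X ^ (-(n - n')) * (∏ _i : Fin q, (X ^ 2)⁻¹) * X ^ (-(2 * (m - m'))) *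
      (X ^ 4)⁻¹ * X ^ (-M) := by
    have e2 : (∏ _i : Fin q, (X ^ 2)⁻¹) = X ^ (-(2 * q : ℝ)) := by
      rw [Finset.prod_const, Finset.card_univ, Fintype.card_fin, inv_pow, ← pow_mul,
        Real.rpow_neg hX0.le, ← Real.rpow_natCast]
      push_cast
      rfl
    have e4 : (X ^ 4)⁻¹ = X ^ (-4 : ℝ) := by
      rw [Real.rpow_neg hX0.le, ← Real.rpow_natCast]
      norm_num
    rw [e2, e4, ← Real.rpow_add hX0, ← Real.rpow_add hX0, ← Real.rpow_add hX0, ← Real.rpow_add hX0,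
      ← Real.rpow_natCast, ← Real.rpow_neg hX0.le]
    refine Real.rpow_le_rpow_of_exponent_le hX1 ?_
    linarith
  have hYK : (Y ^ K)⁻¹ ≤ Y ^ (-(m - m')) * (Y ^ 2)⁻¹ := by
    have e2 : (Y ^ 2)⁻¹ = Y ^ (-2 : ℝ) := by
      rw [Real.rpow_neg hY0.le, ← Real.rpow_natCast]
      norm_num
    rw [e2, ← Real.rpow_add hY0, ← Real.rpow_natCast, ← Real.rpow_neg hY0.le]
    refine Real.rpow_le_rpow_of_exponent_le hY1 ?_
    have : (0 : ℝ) ≤ q := Nat.cast_nonneg q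
    linarith
  have hi1 : wS ζ ^ (n - n') * X ^ (-(n - n')) ≤ δ ^ (-(n - n')) := by
    have : wS ζ ^ (n - n') ≤ (δ⁻¹ * X) ^ (n - n') := by
      refine Real.rpow_le_rpow hS0.le ?_ hk1
      rw [inv_mul_eq_div, le_div_iff₀ hδ]
      linarith
    calc wS ζ ^ (n - n') * X ^ (-(n - n')) ≤ (δ⁻¹ * X) ^ (n - n') * X ^ (-(n - n')) := by gcongr
      _ = δ ^ (-(n - n')) := by
        rw [Real.mul_rpow (by positivity) hX0.le, mul_assoc, ← Real.rpow_add hX0]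
        rw [Real.inv_rpow hδ.le, ← Real.rpow_neg hδ.le, add_neg_cancel, Real.rpow_zero, mul_one]
  have hi2 : wS ζ ^ n' ≤ ∏ i : Fin q, (1 + |ζ i.castSucc|) ^ (n' / q) := by
    have e : wS ζ ^ n' = ∏ _i : Fin q, wS ζ ^ (n' / q) := by
      rw [Finset.prod_const, Finset.card_univ, Fintype.card_fin, ← Real.rpow_natCast,
        ← Real.rpow_mul hS0.le]
      rcases Nat.eq_zero_or_pos q with h | h
      · have : n' = 0 := by
          rw [h] at hn
          simp only [CharP.cast_eq_zero, neg_zero] at hn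
          exact min_eq_right hn.le
        simp [this]
      · have : (q : ℝ) ≠ 0 := by positivity
        field_simp
    rw [e]
    refine Finset.prod_le_prod (fun _ _ => by positivity) fun i _ => ?_
    refine Real.rpow_le_rpow_of_nonpos (by positivity) ?_
      (div_nonpos_of_nonpos_of_nonneg hn' (Nat.cast_nonneg q))
    linarith [pn_le_wS ζ, abs_coord_le_pn ζ i]
  have hii : (∏ _i : Fin q, (X ^ 2)⁻¹) ≤ ∏ i : Fin q, ((1 + δ * |ζ i.castSucc|) ^ 2)⁻¹ := by
    refine Finset.prod_le_prod (fun _ _ => by positivity) fun i _ => ?_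
    rw [hX]
    gcongr
    linarith [pn_le_wS ζ, abs_coord_le_pn ζ i]
  have hiii : wR ζ ^ (m - m') * X ^ (-(2 * (m - m'))) * Y ^ (-(m - m')) ≤
      2 ^ (m - m') * σ ^ (-(m - m')) := by
    have h1 : wR ζ ^ (m - m') ≤ (2 * σ⁻¹ * (X ^ 2 * Y)) ^ (m - m') := by
      refine Real.rpow_le_rpow hR0.le ?_ hc
      rw [mul_assoc, mul_left_comm, inv_mul_eq_div, le_div_iff₀ hσ]
      linarith
    have e : (2 * σ⁻¹ * (X ^ 2 * Y)) ^ (m - m') =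
        2 ^ (m - m') * σ ^ (-(m - m')) * (X ^ (2 * (m - m')) * Y ^ (m - m')) := by
      rw [Real.mul_rpow (by positivity) (by positivity), Real.mul_rpow (by positivity)
        (by positivity), Real.mul_rpow (by positivity) (by positivity), Real.inv_rpow hσ.le,
        Real.rpow_neg hσ.le, Real.rpow_mul hX0.le]
      norm_num
    rw [e] at h1
    calc wR ζ ^ (m - m') * X ^ (-(2 * (m - m'))) * Y ^ (-(m - m'))
        ≤ (2 ^ (m - m') * σ ^ (-(m - m')) * (X ^ (2 * (m - m')) * Y ^ (m - m'))) *
          X ^ (-(2 * (m - m'))) * Y ^ (-(m - m')) := by gcongr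
      _ = 2 ^ (m - m') * σ ^ (-(m - m')) * (X ^ (2 * (m - m')) * X ^ (-(2 * (m - m')))) *
          (Y ^ (m - m') * Y ^ (-(m - m'))) := by ring
      _ = _ := by rw [← Real.rpow_add hX0, ← Real.rpow_add hY0]; simp
  have hiii' : wR ζ ^ m' ≤ (1 + z) ^ m' := by
    refine Real.rpow_le_rpow_of_nonpos (by positivity) ?_ hm'
    have := abs_coord_le_norm ζ (Fin.last q)
    unfold wR; linarith
  have hiv : (X ^ 4)⁻¹ * (Y ^ 2)⁻¹ ≤ ((1 + σ * z) ^ 2)⁻¹ := by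
    rw [← mul_inv, show X ^ 4 * Y ^ 2 = (X ^ 2 * Y) ^ 2 by ring]
    gcongr
  have hv : X ^ (-M) ≤ δ ^ (-M) := by
    refine Real.rpow_le_rpow_of_nonpos hδ ?_ (by linarith)
    exact (le_mul_of_one_le_right hδ.le hS).trans hδX
  have eS : wS ζ ^ n = wS ζ ^ (n - n') * wS ζ ^ n' := by rw [← Real.rpow_add hS0]; simp
  have eR : wR ζ ^ m = wR ζ ^ (m - m') * wR ζ ^ m' := by rw [← Real.rpow_add hR0]; simp
  rw [oscWeight, ← hX, ← hz, ← hY, Finset.prod_mul_distrib]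
  calc wR ζ ^ m * wS ζ ^ n * (X ^ K)⁻¹ * (Y ^ K)⁻¹
      ≤ wR ζ ^ m * wS ζ ^ n * (X ^ (-(n - n')) * (∏ _i : Fin q, (X ^ 2)⁻¹) *
        X ^ (-(2 * (m - m'))) * (X ^ 4)⁻¹ * X ^ (-M)) * (Y ^ (-(m - m')) * (Y ^ 2)⁻¹) := by
        gcongr
    _ = (wR ζ ^ (m - m') * X ^ (-(2 * (m - m'))) * Y ^ (-(m - m'))) * (X ^ (-M)) *
        (wS ζ ^ (n - n') * X ^ (-(n - n'))) * (wS ζ ^ n' * (∏ _i : Fin q, (X ^ 2)⁻¹)) *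
        (wR ζ ^ m' * ((X ^ 4)⁻¹ * (Y ^ 2)⁻¹)) := by
        rw [eS, eR]; ring
    _ ≤ (2 ^ (m - m') * σ ^ (-(m - m'))) * δ ^ (-M) * δ ^ (-(n - n')) *
        ((∏ i : Fin q, (1 + |ζ i.castSucc|) ^ (n' / q)) *
          ∏ i : Fin q, ((1 + δ * |ζ i.castSucc|) ^ 2)⁻¹) *
        ((1 + z) ^ m' * ((1 + σ * z) ^ 2)⁻¹) := by
        gcongr
    _ = _ := by
        rw [sub_eq_add_neg (-(n - n')) M, Real.rpow_add hδ]
        ring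

theorem integral_oscWeight_le (q : ℕ) {m n : ℝ} (hm : -1 < m) (hn : -(q : ℝ) < n) {M : ℝ}
    (hM : 0 ≤ M) :
    ∃ (K : ℕ) (C : ℝ), ∀ δ τ : ℝ, 0 < δ → 0 ≤ τ → τ ≤ δ →
      Integrable (oscWeight (q := q) m n K δ τ) ∧
      ∫ ζ : Pt q, oscWeight m n K δ τ ζ ≤
        C * (δ ^ (-(q + n + M)) * (max τ (δ ^ 2)) ^ (-(1 + m))) := by
  obtain ⟨K, hK⟩ := exists_nat_ge ((n - min n 0) + 2 * q + 2 * (m - min m 0) + 4 + M)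
  have ha : -1 < min n 0 / (q : ℝ) := by
    rcases Nat.eq_zero_or_pos q with h | h
    · simp [h]
    · have hq : (0 : ℝ) < q := by exact_mod_cast h
      rw [lt_div_iff₀ hq]
      rcases min_cases n 0 with h | h <;> rw [h.1] <;> linarith
  have ha0 : min n 0 / (q : ℝ) ≤ 0 :=
    div_nonpos_of_nonpos_of_nonneg (min_le_right _ _) (Nat.cast_nonneg q)
  have hb : -1 < min m 0 := by rcases min_cases m 0 with h | h <;> rw [h.1] <;> linarith
  obtain ⟨C₁, hC₁⟩ := integral_one_dim_le ha ha0
  obtain ⟨C₂, hC₂⟩ := integral_one_dim_le hb (min_le_right m 0)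
  refine ⟨K, 2 ^ (m - min m 0) * (C₁ ^ q * C₂), fun δ τ hδ hτ hτδ => ?_⟩
  set σ := max τ (δ ^ 2) with hσd
  have hσ : 0 < σ := lt_max_of_lt_right (by positivity)
  let f : Fin (q + 1) → ℝ → ℝ := Fin.snoc
    (fun _ : Fin q => fun t : ℝ => (1 + |t|) ^ (min n 0 / q) * ((1 + δ * |t|) ^ 2)⁻¹)
    (fun t : ℝ => (1 + |t|) ^ (min m 0) * ((1 + σ * |t|) ^ 2)⁻¹)
  have hf : ∀ k, Integrable (f k) := by
    intro k
    refine Fin.lastCases ?_ (fun i => ?_) k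
    · simpa [f] using (hC₂ σ hσ).1
    · simpa [f] using (hC₁ δ hδ).1
  obtain ⟨hint, heq⟩ := integral_prod_coord hf
  set c := 2 ^ (m - min m 0) * δ ^ (-(n - min n 0) - M) * σ ^ (-(m - min m 0)) with hc
  have hc0 : 0 ≤ c := by positivity
  have hle : ∀ ζ : Pt q, oscWeight m n K δ τ ζ ≤ c * ∏ k, f k (ζ k) := by
    intro ζ
    have := oscWeight_le hn hM hK hδ hτ hτδ ζ
    rw [Fin.prod_univ_castSucc]
    simpa only [f, Fin.snoc_castSucc, Fin.snoc_last] using this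
  have hnn : ∀ ζ : Pt q, 0 ≤ oscWeight m n K δ τ ζ := by
    intro ζ
    have := wS_pos ζ
    have := wR_pos ζ
    unfold oscWeight
    positivity
  have hmeas : AEStronglyMeasurable (oscWeight (q := q) m n K δ τ) := by
    have h1 : Continuous (wR : Pt q → ℝ) := continuous_wR
    have h2 : Continuous (wS : Pt q → ℝ) := continuous_wS
    have h3 : Measurable (fun ζ : Pt q => ζ (Fin.last q)) :=
      (EuclideanSpace.proj (𝕜 := ℝ) (Fin.last q)).continuous.measurable
    have h1' := h1.measurable
    have h2' := h2.measurable
    unfold oscWeight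
    refine Measurable.aestronglyMeasurable ?_
    have h3' := h3.abs
    fun_prop
  have hI : Integrable (oscWeight (q := q) m n K δ τ) :=
    (hint.const_mul c).mono' hmeas (ae_of_all _ fun ζ => by
      rw [Real.norm_of_nonneg (hnn ζ)]; exact hle ζ)
  refine ⟨hI, (integral_mono hI (hint.const_mul c) hle).trans ?_⟩
  rw [integral_const_mul, heq, Fin.prod_univ_castSucc]
  simp only [f, Fin.snoc_castSucc, Fin.snoc_last, Finset.prod_const, Finset.card_univ,
    Fintype.card_fin]
  set I₁ := ∫ t : ℝ, (1 + |t|) ^ (min n 0 / q) * ((1 + δ * |t|) ^ 2)⁻¹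
  set I₂ := ∫ t : ℝ, (1 + |t|) ^ (min m 0) * ((1 + σ * |t|) ^ 2)⁻¹
  have hI1 : 0 ≤ I₁ := integral_nonneg fun t => by positivity
  have hI2 : 0 ≤ I₂ := integral_nonneg fun t => by positivity
  have b1 := (hC₁ δ hδ).2
  have b2 := (hC₂ σ hσ).2
  calc c * (I₁ ^ q * I₂)
      ≤ c * ((C₁ * δ ^ (-1 - min n 0 / q)) ^ q * (C₂ * σ ^ (-1 - min m 0))) := by
        have h0 : 0 ≤ (C₁ * δ ^ (-1 - min n 0 / q)) ^ q := pow_nonneg (hI1.trans b1) q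
        gcongr
    _ = 2 ^ (m - min m 0) * (C₁ ^ q * C₂) *
        ((δ ^ (-(n - min n 0) - M) * (δ ^ (-1 - min n 0 / q)) ^ q) *
          (σ ^ (-(m - min m 0)) * σ ^ (-1 - min m 0))) := by rw [hc, mul_pow]; ring
    _ = _ := by
        rw [← Real.rpow_natCast (δ ^ _), ← Real.rpow_mul hδ.le, ← Real.rpow_add hδ,
          ← Real.rpow_add hσ]
        congr 4
        · rcases Nat.eq_zero_or_pos q with h | h
          · have : min n 0 = 0 := by
              rw [h] at hn
              simp only [CharP.cast_eq_zero, neg_zero] at hn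
              exact min_eq_right hn.le
            simp [this, h]; ring
          · have : (q : ℝ) ≠ 0 := by positivity
            field_simp
            ring
        · ring

/-! ### Cutoff functions -/

/-- A smooth function equal to `1` on the unit ball and to `0` outside the ball of radius `2`. -/
def cut {q : ℕ} (z : Pt q) : ℂ :=
  (((⟨1, 2, one_pos, one_lt_two⟩ : ContDiffBump (0 : Pt q)) z : ℝ) : ℂ)

section cutoff

variable {q : ℕ} {ι κ : Type} {g : κ → Fin (q + 1)} {wt : κ → ι → Pt q → ℝ}

theorem contDiff_cut : ContDiff ℝ ∞ (cut : Pt q → ℂ) :=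
  Complex.ofRealCLM.contDiff.comp (ContDiffBump.contDiff _)

theorem cut_eq_one {z : Pt q} (hz : ‖z‖ ≤ 1) : cut z = 1 := by
  rw [cut, ContDiffBump.one_of_mem_closedBall _ (by simpa using hz), Complex.ofReal_one]

theorem cut_eq_zero {z : Pt q} (hz : 2 ≤ ‖z‖) : cut z = 0 := by
  rw [cut, ContDiffBump.zero_of_le_dist _ (by simpa using hz), Complex.ofReal_zero]

theorem norm_cut_le (z : Pt q) : ‖cut z‖ ≤ 1 := by
  rw [cut, Complex.norm_real, Real.norm_of_nonneg (ContDiffBump.nonneg _)]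
  exact ContDiffBump.le_one _

theorem hasCompactSupport_cut : HasCompactSupport (cut : Pt q → ℂ) :=
  HasCompactSupport.of_support_subset_isCompact (isCompact_closedBall (0 : Pt q) 2) fun z hz => by
    by_contra h
    exact hz (cut_eq_zero (by simpa using (not_le.mp (by simpa using h)).le))

theorem WB_cut {r : ι → Fin (q + 1) → ℝ} {c₀ : ℝ} (hwt0 : ∀ k t ζ, 0 ≤ wt k t ζ)
    (hr : ∀ k t ζ, ‖dil (r t) ζ‖ ≤ 2 → |r t (g k)| ≤ c₀ * wt k t ζ) (n : ℕ) {c : ι → ℂ}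
    {p : ι → Pt q → ℝ} (hp : ∀ t ζ, 0 ≤ p t ζ) {c₁ : ℝ}
    (hc : ∀ t ζ, ‖dil (r t) ζ‖ ≤ 2 → ‖c t‖ ≤ c₁ * p t ζ) :
    WB g wt n p (fun t ζ => c t * cut (dil (r t) ζ)) := by
  refine WB_dil (Z := Metric.closedBall 0 2) Metric.isClosed_closedBall hwt0
    (fun k t ζ h => hr k t ζ (by simpa using h)) n contDiff_cut hasCompactSupport_cut ?_ hp
    (fun t ζ h => hc t ζ (by simpa using h))
  intro z hz
  refine cut_eq_zero ?_
  have := not_le.mp (by simpa using hz : ¬ ‖z‖ ≤ 2)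
  exact this.le

theorem WB_one_sub_cut {r : ι → Fin (q + 1) → ℝ} {c₀ : ℝ} (hwt0 : ∀ k t ζ, 0 ≤ wt k t ζ)
    (hr : ∀ k t ζ, ‖dil (r t) ζ‖ ≤ 2 → |r t (g k)| ≤ c₀ * wt k t ζ) (n : ℕ) {c : ι → ℂ}
    (hc01 : ∀ t, c t = 0 ∨ c t = 1)
    {p : ι → Pt q → ℝ} (hp : ∀ t ζ, 0 ≤ p t ζ) {c₁ : ℝ}
    (hc : ∀ t ζ, (c t = 1 → 1 ≤ ‖dil (r t) ζ‖) → 1 ≤ c₁ * p t ζ) :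
    WB g wt n p (fun t ζ => 1 - c t * cut (dil (r t) ζ)) := by
  have h0 : ∃ C : ℝ, ∀ t ζ, ‖1 - c t * cut (dil (r t) ζ)‖ ≤ C * p t ζ := by
    refine ⟨2 * |c₁|, fun t ζ => ?_⟩
    by_cases h : c t = 1 → 1 ≤ ‖dil (r t) ζ‖
    · have h1 := hc t ζ h
      have h2 : ‖1 - c t * cut (dil (r t) ζ)‖ ≤ 2 := by
        refine (norm_sub_le _ _).trans ?_
        rw [norm_mul, norm_one]
        have h3 := norm_cut_le (dil (r t) ζ)
        rcases hc01 t with h | h <;> rw [h] <;> simp <;> linarith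
      have h3 : c₁ * p t ζ ≤ |c₁| * p t ζ := mul_le_mul_of_nonneg_right (le_abs_self _) (hp t ζ)
      linarith
    · rw [Classical.not_imp, not_le] at h
      rw [h.1, cut_eq_one h.2.le, mul_one, sub_self, norm_zero]
      have := hp t ζ
      positivity
  cases n with
  | zero => exact h0
  | succ n =>
    refine ⟨h0, fun k => ?_⟩
    have hZ : IsClosed {z : Pt q | 1 ≤ ‖z‖ ∧ ‖z‖ ≤ 2} :=
      (isClosed_le continuous_const continuous_norm).inter
        (isClosed_le continuous_norm continuous_const)
    have hz : ∀ z ∉ {z : Pt q | 1 ≤ ‖z‖ ∧ ‖z‖ ≤ 2}, fderiv ℝ (cut : Pt q → ℂ) z (basisVec (g k)) = 0 := by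
      intro z hz
      have hloc : ∃ w : ℂ, (cut : Pt q → ℂ) =ᶠ[nhds z] fun _ => w := by
        rcases lt_or_ge ‖z‖ 1 with h | h
        · refine ⟨1, ?_⟩
          filter_upwards [(isOpen_lt continuous_norm continuous_const).mem_nhds h] with y hy
          exact cut_eq_one (le_of_lt hy)
        · refine ⟨0, ?_⟩
          have h2 : 2 < ‖z‖ := by
            by_contra h'
            exact hz ⟨h, not_lt.mp h'⟩
          filter_upwards [(isOpen_lt continuous_const continuous_norm).mem_nhds h2] with y hy
          exact cut_eq_zero (le_of_lt hy)
      obtain ⟨w, hw⟩ := hloc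
      rw [hw.fderiv_eq]
      simp
    have := WB_dil (g := g) (wt := wt) hZ hwt0 (fun k t ζ h => hr k t ζ h.2) n
      (contDiff_fderiv_apply contDiff_cut (basisVec (g k)))
      (hasCompactSupport_fderiv_apply hasCompactSupport_cut _) hz
      (c := fun t => -(c t * (r t (g k) : ℂ))) (p := fun t ζ => p t ζ * wt k t ζ)
      (fun t ζ => mul_nonneg (hp t ζ) (hwt0 k t ζ)) (c₁ := c₁ * c₀) (fun t ζ h => by
        rw [norm_neg, norm_mul, mul_mul_mul_comm]
        have h1 := hc t ζ (fun _ => h.1)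
        refine mul_le_mul (le_trans ?_ h1) (by simpa using hr k t ζ h.2) (norm_nonneg _)
          (zero_le_one.trans h1)
        rcases hc01 t with h | h <;> rw [h] <;> simp)
    convert this using 3 with t ζ
    have hd : HasFDerivAt (fun ζ => 1 - c t * cut (dil (r t) ζ))
        (-(c t • (fderiv ℝ cut (dil (r t) ζ)).comp (dil (r t)))) ζ :=
      (((contDiff_cut.differentiable (by simp) _).hasFDerivAt.comp ζ
        (dil (r t)).hasFDerivAt).const_mul (c t)).const_sub 1
    rw [hd.fderiv]
    simp [dil_basisVec, mul_assoc]

theorem contDiff_cut_dil (r : Fin (q + 1) → ℝ) : ContDiff ℝ ∞ (fun ζ : Pt q => cut (dil r ζ)) :=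
  contDiff_cut.comp (dil r).contDiff

theorem exists_split {θ : ι → Pt q} (k : κ) (hθ : ∀ t, θ t (g k) ≠ 0)
    (hwt0 : ∀ k t ζ, 0 ≤ wt k t ζ) {n K : ℕ} {p p₁ p₂ p' : ι → Pt q → ℝ} {u F : ι → Pt q → ℂ}
    (hus : ∀ t, ContDiff ℝ ∞ (u t)) (huc : ∀ t, HasCompactSupport (u t))
    (hFs : ∀ t, ContDiff ℝ ∞ (F t))
    (hp : ∀ t ζ, 0 ≤ p t ζ) (hp₁ : ∀ t ζ, 0 ≤ p₁ t ζ) (hp₂ : ∀ t ζ, 0 ≤ p₂ t ζ)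
    (hu : WB g wt (n + K) p u) (hF : WB g wt n p₁ F)
    (hF' : WB g wt (n + K) p₂ (fun t ζ => 1 - F t ζ)) {c : ℝ}
    (h1 : ∀ t ζ, p t ζ * p₁ t ζ ≤ c * p' t ζ)
    (h2 : ∀ t ζ, (|θ t (g k)| ^ K)⁻¹ * (p t ζ * p₂ t ζ * wt k t ζ ^ K) ≤ c * p' t ζ) :
    ∃ V : ι → Pt q → ℂ, (∀ t, ContDiff ℝ ∞ (V t)) ∧ (∀ t, HasCompactSupport (V t)) ∧
      (∀ t, ∫ ζ, V t ζ * chr (θ t) ζ = ∫ ζ, u t ζ * chr (θ t) ζ) ∧ WB g wt n p' V := by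
  have hu' : WB g wt n p u := by
    clear h2 hF'
    induction K with
    | zero => exact hu
    | succ K ih => exact ih (WB.mono_order hu)
  set b : ι → ℂ := fun t => ((-(2 * Real.pi * Complex.I * θ t (g k))) ^ K)⁻¹ with hb
  have hb0 : ∀ t, (-(2 * Real.pi * Complex.I * θ t (g k)) : ℂ) ^ K ≠ 0 := by
    intro t
    refine pow_ne_zero _ (neg_ne_zero.mpr ?_)
    simp [hθ t, Real.pi_ne_zero]
  set G : ι → Pt q → ℂ := fun t ζ => u t ζ * (1 - F t ζ) with hG
  have hGs : ∀ t, ContDiff ℝ ∞ (G t) := fun t => (hus t).mul (contDiff_const.sub (hFs t))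
  have hGc : ∀ t, HasCompactSupport (G t) := fun t => (huc t).mul_right
  have hG0 : WB g wt n (fun t ζ => p t ζ * p₂ t ζ * wt k t ζ ^ K)
      (fun t => iterD (basisVec (g k)) K (G t)) :=
    WB.iterD k (WB.mul hus (fun t => contDiff_const.sub (hFs t)) hu hF')
  have hIs := fun t => contDiff_iterD (basisVec (g k)) K (hGs t)
  have hIc := fun t => hasCompactSupport_iterD (basisVec (g k)) K (hGc t)
  have hG1 := WB.const_mul hIs (c := b) (w := fun t => (|θ t (g k)| ^ K)⁻¹) (fun t => by
    rw [hb, norm_inv, norm_pow, norm_neg, norm_two_pi_I_mul]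
    have : 0 < |θ t (g k)| := abs_pos.mpr (hθ t)
    refine inv_anti₀ (by positivity) (pow_le_pow_left₀ this.le ?_ K)
    nlinarith [Real.pi_gt_three]) hG0
  refine ⟨fun t ζ => u t ζ * F t ζ + b t * iterD (basisVec (g k)) K (G t) ζ, fun t =>
    ((hus t).mul (hFs t)).add (contDiff_const.mul (hIs t)), fun t => (huc t).mul_right.add
      (hIc t).mul_left, fun t => ?_, WB.add (fun t => (hus t).mul (hFs t))
      (fun t => contDiff_const.mul (hIs t)) ?_ ?_⟩
  · have cint : ∀ {h : Pt q → ℂ}, ContDiff ℝ ∞ h → HasCompactSupport h →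
        Integrable (fun ζ => h ζ * chr (θ t) ζ) := fun hh hhc =>
      (hh.continuous.mul (contDiff_chr (n := 0) (θ t)).continuous).integrable_of_hasCompactSupport
        hhc.mul_right
    have e1 : (fun ζ => (u t ζ * F t ζ + b t * iterD (basisVec (g k)) K (G t) ζ) * chr (θ t) ζ) =
        fun ζ => u t ζ * F t ζ * chr (θ t) ζ +
          b t * (iterD (basisVec (g k)) K (G t) ζ * chr (θ t) ζ) := by funext ζ; ring
    rw [e1, integral_add (cint ((hus t).mul (hFs t)) (huc t).mul_right)
      ((cint (hIs t) (hIc t)).const_mul _), integral_const_mul,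
      integral_iterD_mul_chr (hGs t) (hGc t), ← mul_assoc, hb, inv_mul_cancel₀ (hb0 t), one_mul,
      ← integral_add (cint ((hus t).mul (hFs t)) (huc t).mul_right) (cint (hGs t) (hGc t))]
    congr 1
    funext ζ
    rw [hG]
    ring
  · exact WB.mono hwt0 c (fun t ζ => mul_nonneg (hp t ζ) (hp₁ t ζ)) h1 (WB.mul hus hFs hu' hF)
  · refine WB.mono hwt0 c (fun t ζ => ?_) h2 hG1
    have := hp t ζ
    have := hp₂ t ζ
    have := hwt0 k t ζ
    positivity

end cutoff

/-! ### The basic oscillatory estimate -/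

/-- The gain of one coordinate derivative: `|ζ|⁻¹` in the last coordinate, and
`(|ζ'| + |ζ|^{1/2})⁻¹` in the other ones. -/
def wt0 {q : ℕ} {ι : Type} (k : Fin (q + 1)) (_t : ι) (ζ : Pt q) : ℝ :=
  if k = Fin.last q then (wR ζ)⁻¹ else (wS ζ)⁻¹

section base

variable {q : ℕ} {ι : Type}

theorem wt0_nonneg (k : Fin (q + 1)) (t : ι) (ζ : Pt q) : 0 ≤ wt0 k t ζ := by
  have := wR_pos ζ
  have := wS_pos ζ
  unfold wt0
  split_ifs <;> positivity

theorem wt0_le (k : Fin (q + 1)) (t : ι) (ζ : Pt q) : wt0 k t ζ ≤ 2 * (wS ζ)⁻¹ := by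
  have h1 := wR_pos ζ
  have h2 := wS_pos ζ
  unfold wt0
  split_ifs
  · rw [← div_eq_mul_inv, inv_eq_one_div, div_le_div_iff₀ h1 h2, one_mul]
    exact wS_le_two_wR ζ
  · have : 0 < (wS ζ)⁻¹ := by positivity
    linarith

theorem norm_dil_sq (δ ε : ℝ) (ζ : Pt q) :
    ‖dil (fun j => if j = Fin.last q then ε else δ) ζ‖ ^ 2 =
      (δ * pn ζ) ^ 2 + (ε * |ζ (Fin.last q)|) ^ 2 := by
  rw [norm_sq_eq_pn, pn, pn, mul_pow, mul_pow, sq_abs, Real.sq_sqrt (by positivity),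
    Real.sq_sqrt (by positivity)]
  simp [mul_pow, Finset.mul_sum, (Fin.castSucc_lt_last _).ne]

theorem exists_parabolic_decay (k : Fin (q + 1)) {θ : ι → Pt q} (hθ : ∀ t, θ t k ≠ 0) (K n : ℕ)
    {p : ι → Pt q → ℝ} (hp : ∀ t ζ, 0 ≤ p t ζ) {u : ι → Pt q → ℂ}
    (hus : ∀ t, ContDiff ℝ ∞ (u t)) (huc : ∀ t, HasCompactSupport (u t))
    (hu : ∀ n, WB id wt0 n p u) :
    ∃ V : ι → Pt q → ℂ, (∀ t, ContDiff ℝ ∞ (V t)) ∧ (∀ t, HasCompactSupport (V t)) ∧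
      (∀ t, ∫ ζ, V t ζ * chr (θ t) ζ = ∫ ζ, u t ζ * chr (θ t) ζ) ∧
      WB id wt0 n (fun t ζ => p t ζ * ((1 + |θ t k| * wS ζ) ^ K)⁻¹) V := by
  classical
  set δ : ι → ℝ := fun t => |θ t k| with hδd
  have hδ : ∀ t, 0 < δ t := fun t => abs_pos.mpr (hθ t)
  set r : ι → Fin (q + 1) → ℝ := fun t j =>
    if j = Fin.last q then (if δ t < 1 then δ t ^ 2 else 0) else (if δ t < 1 then δ t else 0)
  set c : ι → ℂ := fun t => if δ t < 1 then 1 else 0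
  have hsq : ∀ t, δ t < 1 → ∀ ζ, ‖dil (r t) ζ‖ ^ 2 =
      (δ t * pn ζ) ^ 2 + (δ t ^ 2 * |ζ (Fin.last q)|) ^ 2 := by
    intro t ht ζ
    simp only [r, ht, if_true]
    exact norm_dil_sq _ _ ζ
  have hup : ∀ t, δ t < 1 → ∀ ζ, ‖dil (r t) ζ‖ ≤ 2 →
      δ t * wS ζ ≤ 5 ∧ δ t ^ 2 * wR ζ ≤ 5 := by
    intro t ht ζ h
    have h0 := hδ t
    have hpn := pn_nonneg ζ
    have hz := abs_nonneg (ζ (Fin.last q))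
    have h1 := hsq t ht ζ
    have h2 : ‖dil (r t) ζ‖ ^ 2 ≤ 2 ^ 2 := pow_le_pow_left₀ (norm_nonneg _) h 2
    have h3 : δ t * pn ζ ≤ 2 := by
      refine abs_le_of_sq_le_sq' (a := δ t * pn ζ) ?_ (by norm_num) |>.2
      nlinarith [sq_nonneg (δ t ^ 2 * |ζ (Fin.last q)|)]
    have h4 : δ t ^ 2 * |ζ (Fin.last q)| ≤ 2 := by
      refine abs_le_of_sq_le_sq' (a := δ t ^ 2 * |ζ (Fin.last q)|) ?_ (by norm_num) |>.2
      nlinarith [sq_nonneg (δ t * pn ζ)]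
    have h5 : δ t ^ 2 * ‖ζ‖ ≤ 4 := by
      have := norm_le_pn_add ζ
      calc δ t ^ 2 * ‖ζ‖ ≤ δ t ^ 2 * (pn ζ + |ζ (Fin.last q)|) := by gcongr
        _ = δ t * (δ t * pn ζ) + δ t ^ 2 * |ζ (Fin.last q)| := by ring
        _ ≤ 1 * 2 + 2 := by gcongr
        _ = 4 := by norm_num
    have h6 : δ t * √‖ζ‖ ≤ 2 := by
      refine abs_le_of_sq_le_sq' (a := δ t * √‖ζ‖) ?_ (by norm_num) |>.2
      rw [mul_pow, Real.sq_sqrt (norm_nonneg _)]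
      linarith
    unfold wS wR
    constructor <;> nlinarith
  have hlow : ∀ t ζ, (c t = 1 → 1 ≤ ‖dil (r t) ζ‖) → 1 ≤ 2 * (δ t * wS ζ) := by
    intro t ζ h
    have h0 := hδ t
    have hS := one_le_wS ζ
    by_cases ht : δ t < 1
    · have h1 : 1 ≤ ‖dil (r t) ζ‖ ^ 2 := one_le_pow₀ (h (by simp [c, ht]))
      rw [hsq t ht ζ] at h1
      have h2 : δ t * pn ζ ≤ δ t * wS ζ := by
        have := pn_le_wS ζ
        gcongr; linarith
      have h3 : δ t ^ 2 * |ζ (Fin.last q)| ≤ (δ t * wS ζ) ^ 2 := by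
        rw [mul_pow]
        have := wR_le_sq ζ
        have := abs_coord_le_norm ζ (Fin.last q)
        unfold wR at *
        gcongr; linarith
      have h4 := pn_nonneg ζ
      have h5 := abs_nonneg (ζ (Fin.last q))
      have h6 : 0 < δ t * wS ζ := by positivity
      by_contra hcon
      have h7 : δ t * wS ζ < 1 / 2 := by linarith
      have h8 : (δ t * pn ζ) ^ 2 ≤ (1 / 2) ^ 2 := pow_le_pow_left₀ (by positivity) (by linarith) 2
      have h9 : (δ t * wS ζ) ^ 2 ≤ (1 / 2) ^ 2 := pow_le_pow_left₀ (by positivity) (by linarith) 2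
      have h10 : (δ t ^ 2 * |ζ (Fin.last q)|) ^ 2 ≤ ((1 / 2) ^ 2) ^ 2 :=
        pow_le_pow_left₀ (by positivity) (by linarith) 2
      norm_num at h8 h10
      linarith
    · nlinarith
  have hr : ∀ (j : Fin (q + 1)) (t : ι) (ζ : Pt q), ‖dil (r t) ζ‖ ≤ 2 →
      |r t (id j)| ≤ 5 * wt0 j t ζ := by
    intro j t ζ h
    have hR := wR_pos ζ
    have hS := wS_pos ζ
    have h0 := hδ t
    by_cases ht : δ t < 1
    · obtain ⟨h1, h2⟩ := hup t ht ζ h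
      simp only [r, ht, if_true, wt0, id]
      split_ifs
      · rw [abs_of_pos (by positivity), ← div_eq_mul_inv, le_div_iff₀ hR]
        exact h2
      · rw [abs_of_pos (by positivity), ← div_eq_mul_inv, le_div_iff₀ hS]
        exact h1
    · have := wt0_nonneg j t ζ
      simp only [r, ht, if_false, ite_self, abs_zero]
      positivity
  have hFs : ∀ t, ContDiff ℝ ∞ (fun ζ => c t * cut (dil (r t) ζ)) := fun t =>
    contDiff_const.mul (contDiff_cut_dil _)
  have hX : ∀ (t : ι) (ζ : Pt q), 0 < 1 + δ t * wS ζ := fun t ζ => by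
    have := hδ t
    have := wS_pos ζ
    positivity
  have hF : WB id wt0 n (fun t ζ => ((1 + δ t * wS ζ) ^ K)⁻¹)
      (fun t ζ => c t * cut (dil (r t) ζ)) := by
    refine WB_cut wt0_nonneg hr n (fun t ζ => by have := hX t ζ; positivity) (c₁ := 6 ^ K) ?_
    intro t ζ h
    by_cases ht : δ t < 1
    · have h1 := (hup t ht ζ h).1
      simp only [c, ht, if_true, norm_one]
      rw [← div_eq_mul_inv, one_le_div (by have := hX t ζ; positivity)]
      exact pow_le_pow_left₀ (hX t ζ).le (by linarith) K
    · have := hX t ζ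
      simp only [c, ht, if_false, norm_zero]
      positivity
  have hF' : WB id wt0 (n + K) (fun t ζ => (δ t * wS ζ) ^ K * ((1 + δ t * wS ζ) ^ K)⁻¹)
      (fun t ζ => 1 - c t * cut (dil (r t) ζ)) := by
    refine WB_one_sub_cut wt0_nonneg hr (n + K) (fun t => ?_) (fun t ζ => ?_) (c₁ := 3 ^ K) ?_
    · by_cases ht : δ t < 1 <;> simp [c, ht]
    · have := hX t ζ
      have := hδ t
      have := wS_pos ζ
      positivity
    · intro t ζ h
      have h1 := hlow t ζ h
      have h2 := hX t ζ
      rw [← mul_assoc, ← mul_pow, ← div_eq_mul_inv, one_le_div (by positivity)]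
      exact pow_le_pow_left₀ h2.le (by linarith) K
  refine exists_split (g := id) k hθ wt0_nonneg hus huc hFs hp (fun t ζ => ?_) (fun t ζ => ?_)
    (hu (n + K)) hF hF' (c := 2 ^ K) (fun t ζ => ?_) (fun t ζ => ?_)
  · have := hX t ζ; positivity
  · have := hX t ζ
    have := hδ t
    have := wS_pos ζ
    positivity
  · have h1 := hX t ζ
    have h2 := hp t ζ
    exact le_mul_of_one_le_left (by positivity) (one_le_pow₀ one_le_two)
  · have h1 := hX t ζ
    have h2 := hp t ζ
    have h3 := hδ t
    have h4 := wS_pos ζ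
    have h5 := wt0_nonneg k t ζ
    have h6 : wt0 k t ζ ^ K ≤ (2 * (wS ζ)⁻¹) ^ K := pow_le_pow_left₀ h5 (wt0_le k t ζ) K
    change (δ t ^ K)⁻¹ * _ ≤ _
    calc (δ t ^ K)⁻¹ * (p t ζ * ((δ t * wS ζ) ^ K * ((1 + δ t * wS ζ) ^ K)⁻¹) * wt0 k t ζ ^ K)
        ≤ (δ t ^ K)⁻¹ * (p t ζ * ((δ t * wS ζ) ^ K * ((1 + δ t * wS ζ) ^ K)⁻¹) *
          (2 * (wS ζ)⁻¹) ^ K) := by gcongr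
      _ = 2 ^ K * (p t ζ * ((1 + δ t * wS ζ) ^ K)⁻¹) * ((δ t ^ K)⁻¹ * δ t ^ K) *
          ((wS ζ ^ K)⁻¹ * wS ζ ^ K) := by rw [mul_pow, mul_pow, inv_pow]; ring
      _ = _ := by rw [inv_mul_cancel₀ (by positivity), inv_mul_cancel₀ (by positivity)]; ring

theorem exists_last_decay {θ : ι → Pt q} (hθ : ∀ t, θ t (Fin.last q) ≠ 0) (K : ℕ)
    {p : ι → Pt q → ℝ} (hp : ∀ t ζ, 0 ≤ p t ζ) {u : ι → Pt q → ℂ}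
    (hus : ∀ t, ContDiff ℝ ∞ (u t)) (huc : ∀ t, HasCompactSupport (u t))
    (hu : WB id wt0 K p u) :
    ∃ V : ι → Pt q → ℂ,
      (∀ t, ∫ ζ, V t ζ * chr (θ t) ζ = ∫ ζ, u t ζ * chr (θ t) ζ) ∧
      ∃ C : ℝ, ∀ t ζ, ‖V t ζ‖ ≤
        C * (p t ζ * ((1 + |θ t (Fin.last q)| * |ζ (Fin.last q)|) ^ K)⁻¹) := by
  set τ : ι → ℝ := fun t => |θ t (Fin.last q)| with hτd
  have hτ : ∀ t, 0 < τ t := fun t => abs_pos.mpr (hθ t)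
  have hY : ∀ (t : ι) (ζ : Pt q), 0 < 1 + τ t * |ζ (Fin.last q)| := fun t ζ => by
    have := hτ t
    positivity
  set wt : Unit → ι → Pt q → ℝ := fun _ t ζ =>
    max (wR ζ)⁻¹ (τ t * (1 + τ t * |ζ (Fin.last q)|)⁻¹) with hwt
  have hwt0 : ∀ k t ζ, 0 ≤ wt k t ζ := fun k t ζ =>
    le_max_of_le_left (inv_nonneg.mpr (wR_pos ζ).le)
  have hu1 : WB (id ∘ fun _ : Unit => Fin.last q) wt (0 + K) p u := by
    rw [zero_add]
    refine WB.reindex (e := fun _ : Unit => Fin.last q) (c := 1) wt0_nonneg ?_ hp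
      (fun t ζ => (one_mul _).ge) hu
    intro k t ζ
    simp only [wt0, if_true]
    exact le_max_left _ _
  set r : ι → Fin (q + 1) → ℝ := fun t j => if j = Fin.last q then τ t else 0
  have hnorm : ∀ (t : ι) (ζ : Pt q), ‖dil (r t) ζ‖ = τ t * |ζ (Fin.last q)| := by
    intro t ζ
    have h := norm_dil_sq 0 (τ t) ζ
    rw [zero_mul, zero_pow two_ne_zero, zero_add] at h
    have := hτ t
    exact (pow_left_inj₀ (norm_nonneg _) (by positivity) two_ne_zero).mp h
  have hr : ∀ (k : Unit) (t : ι) (ζ : Pt q), ‖dil (r t) ζ‖ ≤ 2 →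
      |r t ((id ∘ fun _ : Unit => Fin.last q) k)| ≤ 3 * wt k t ζ := by
    intro k t ζ h
    rw [hnorm] at h
    have h1 := hτ t
    have h2 := hY t ζ
    simp only [r, Function.comp, id, if_true, abs_of_pos h1, hwt]
    have h3 : τ t ≤ 3 * (τ t * (1 + τ t * |ζ (Fin.last q)|)⁻¹) := by
      rw [← mul_assoc, ← div_eq_mul_inv, le_div_iff₀ h2]
      nlinarith
    refine h3.trans ?_
    gcongr
    exact le_max_right _ _
  have hF : WB (id ∘ fun _ : Unit => Fin.last q) wt 0
      (fun t ζ => ((1 + τ t * |ζ (Fin.last q)|) ^ K)⁻¹)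
      (fun t ζ => (1 : ℂ) * cut (dil (r t) ζ)) := by
    refine WB_cut (c := fun _ => 1) hwt0 hr 0 (fun t ζ => by have := hY t ζ; positivity)
      (c₁ := 3 ^ K) ?_
    intro t ζ h
    rw [hnorm] at h
    rw [norm_one, ← div_eq_mul_inv, one_le_div (by have := hY t ζ; positivity)]
    exact pow_le_pow_left₀ (hY t ζ).le (by linarith) K
  have hF' : WB (id ∘ fun _ : Unit => Fin.last q) wt (0 + K)
      (fun t ζ => (τ t * |ζ (Fin.last q)|) ^ K * ((1 + τ t * |ζ (Fin.last q)|) ^ K)⁻¹)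
      (fun t ζ => 1 - (1 : ℂ) * cut (dil (r t) ζ)) := by
    refine WB_one_sub_cut (c := fun _ => 1) hwt0 hr (0 + K) (fun t => Or.inr rfl)
      (fun t ζ => ?_) (c₁ := 2 ^ K) ?_
    · have := hY t ζ
      have := hτ t
      positivity
    · intro t ζ h
      have h1 := h rfl
      have h2 := hY t ζ
      rw [hnorm] at h1
      rw [← mul_assoc, ← mul_pow, ← div_eq_mul_inv, one_le_div (by positivity)]
      exact pow_le_pow_left₀ h2.le (by linarith) K
  obtain ⟨V, -, -, hV, hW⟩ := exists_split (g := id ∘ fun _ : Unit => Fin.last q) () hθ hwt0 hus huc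
    (fun t => contDiff_const.mul (contDiff_cut_dil (r t))) hp
    (fun t ζ => by have := hY t ζ; positivity)
    (fun t ζ => by have := hY t ζ; have := hτ t; positivity) hu1 hF hF' (c := 1)
    (p' := fun t ζ => p t ζ * ((1 + τ t * |ζ (Fin.last q)|) ^ K)⁻¹)
    (fun t ζ => (one_mul _).ge) (fun t ζ => by
      have h1 := hY t ζ
      have h2 := hτ t
      have h3 := hp t ζ
      have h4 := wR_pos ζ
      have h5 := abs_nonneg (ζ (Fin.last q))
      have h6 : |ζ (Fin.last q)| * wt () t ζ ≤ 1 := by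
        rw [hwt]
        dsimp only
        rw [mul_max_of_nonneg _ _ h5]
        refine max_le ?_ ?_
        · rw [← div_eq_mul_inv, div_le_one h4]
          have := abs_coord_le_norm ζ (Fin.last q)
          unfold wR; linarith
        · rw [← mul_assoc, ← div_eq_mul_inv, div_le_one h1]
          linarith
      have h7 : (|ζ (Fin.last q)| * wt () t ζ) ^ K ≤ 1 :=
        pow_le_one₀ (mul_nonneg h5 (hwt0 () t ζ)) h6
      change (τ t ^ K)⁻¹ * _ ≤ _
      calc (τ t ^ K)⁻¹ * (p t ζ * ((τ t * |ζ (Fin.last q)|) ^ K *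
            ((1 + τ t * |ζ (Fin.last q)|) ^ K)⁻¹) * wt () t ζ ^ K)
          = ((τ t ^ K)⁻¹ * τ t ^ K) * ((p t ζ * ((1 + τ t * |ζ (Fin.last q)|) ^ K)⁻¹) *
            (|ζ (Fin.last q)| * wt () t ζ) ^ K) := by rw [mul_pow, mul_pow]; ring
        _ ≤ _ := by
          rw [inv_mul_cancel₀ (by positivity), one_mul, one_mul]
          exact mul_le_of_le_one_right (by positivity) h7)
  exact ⟨V, hV, hW⟩

/-- The quasi-norm `|θ| + |θ_N|^{1/2}`. -/
def fd {q : ℕ} (θ : Pt q) : ℝ := ‖θ‖ + √|θ (Fin.last q)|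

theorem norm_le_fd (θ : Pt q) : ‖θ‖ ≤ fd θ := le_add_of_nonneg_right (Real.sqrt_nonneg _)

theorem norm_oscillatory_le_of_max (k : Fin (q + 1)) {θ : ι → Pt q} (hθ : ∀ t, θ t k ≠ 0)
    (hmax : ∀ t j, |θ t j| ≤ |θ t k|) {m n : ℝ} (hm : -1 < m) (hn : -(q : ℝ) < n) {M : ℝ}
    (hM : 0 ≤ M) {u : ι → Pt q → ℂ}
    (hus : ∀ t, ContDiff ℝ ∞ (u t)) (huc : ∀ t, HasCompactSupport (u t))
    (hu : ∀ j, WB id wt0 j (fun _ ζ => wR ζ ^ m * wS ζ ^ n) u) :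
    ∃ C : ℝ, ∀ t, ‖∫ ζ, u t ζ * chr (θ t) ζ‖ ≤
      C * (|θ t k| ^ (-(q + n + M)) *
        (max |θ t (Fin.last q)| (|θ t k| ^ 2)) ^ (-(1 + m))) := by
  obtain ⟨K, C₀, hK⟩ := integral_oscWeight_le q hm hn hM
  have hw : ∀ (t : ι) (ζ : Pt q), 0 ≤ wR ζ ^ m * wS ζ ^ n := fun _ ζ => by
    have := wR_pos ζ
    have := wS_pos ζ
    positivity
  obtain ⟨V, hVs, hVc, hVi, hV⟩ := exists_parabolic_decay k hθ K K hw hus huc hu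
  set p : ι → Pt q → ℝ := fun t ζ => wR ζ ^ m * wS ζ ^ n * ((1 + |θ t k| * wS ζ) ^ K)⁻¹
  have hp : ∀ t ζ, 0 ≤ p t ζ := fun t ζ => by
    have := hw t ζ
    have := wS_pos ζ
    positivity
  have key : ∀ (t : ι) (W : Pt q → ℂ) (C : ℝ),
      (∀ ζ, ‖W ζ‖ ≤ C * oscWeight m n K |θ t k| |θ t (Fin.last q)| ζ) →
      ∫ ζ, W ζ * chr (θ t) ζ = ∫ ζ, u t ζ * chr (θ t) ζ →
      ‖∫ ζ, u t ζ * chr (θ t) ζ‖ ≤ |C| * C₀ * (|θ t k| ^ (-(q + n + M)) *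
        (max |θ t (Fin.last q)| (|θ t k| ^ 2)) ^ (-(1 + m))) := by
    intro t W C hW hint
    obtain ⟨h1, h2⟩ := hK |θ t k| |θ t (Fin.last q)| (abs_pos.mpr (hθ t)) (abs_nonneg _) (hmax t _)
    have hos : ∀ ζ, 0 ≤ oscWeight m n K |θ t k| |θ t (Fin.last q)| ζ := fun ζ => by
      have := hp t ζ
      unfold oscWeight
      positivity
    rw [← hint, mul_assoc]
    refine (norm_integral_le_of_norm_le (h1.const_mul |C|) (ae_of_all _ fun ζ => ?_)).trans ?_
    · rw [norm_mul, norm_chr, mul_one]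
      exact (hW ζ).trans (mul_le_mul_of_nonneg_right (le_abs_self C) (hos ζ))
    · rw [integral_const_mul]
      exact mul_le_mul_of_nonneg_left h2 (abs_nonneg C)
  obtain ⟨C₁, hC₁⟩ := hV.bound
  obtain ⟨V₂, hV₂i, C₂, hC₂⟩ := exists_last_decay
    (ι := {t : ι // θ t (Fin.last q) ≠ 0}) (θ := fun t => θ t.1) (fun t => t.2) K
    (p := fun t => p t.1) (fun t => hp t.1) (fun t => hVs t.1) (fun t => hVc t.1)
    (WB.comp_index (fun t : {t : ι // θ t (Fin.last q) ≠ 0} => t.1) hV)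
  refine ⟨max (|C₁| * C₀) (|C₂| * C₀), fun t => ?_⟩
  have hnn : 0 ≤ (|θ t k| ^ (-(q + n + M)) *
        (max |θ t (Fin.last q)| (|θ t k| ^ 2)) ^ (-(1 + m))) :=
    mul_nonneg (Real.rpow_nonneg (abs_nonneg _) _)
      (Real.rpow_nonneg (le_max_of_le_left (abs_nonneg _)) _)
  by_cases ht : θ t (Fin.last q) = 0
  · refine (key t (V t) C₁ (fun ζ => ?_) (hVi t)).trans
      (mul_le_mul_of_nonneg_right (le_max_left _ _) hnn)
    simpa [oscWeight, ht] using hC₁ t ζ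
  · refine (key t (V₂ ⟨t, ht⟩) C₂ (fun ζ => ?_) ((hV₂i ⟨t, ht⟩).trans (hVi t))).trans
      (mul_le_mul_of_nonneg_right (le_max_right _ _) hnn)
    exact hC₂ ⟨t, ht⟩ ζ

/-- The basic estimate for oscillatory integrals of mixed homogeneity. -/
theorem norm_oscillatory_le {m n : ℝ} (hm : -1 < m) (hn : -(q : ℝ) < n) {M : ℝ}
    (hM : 0 ≤ M) {u : ι → Pt q → ℂ}
    (hus : ∀ t, ContDiff ℝ ∞ (u t)) (huc : ∀ t, HasCompactSupport (u t))
    (hu : ∀ j, WB id wt0 j (fun _ ζ => wR ζ ^ m * wS ζ ^ n) u) :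
    ∃ C : ℝ, ∀ t θ, θ ≠ 0 → ‖∫ ζ, u t ζ * chr θ ζ‖ ≤
      C * (‖θ‖ ^ (-(q + n + M)) * fd θ ^ (-(2 * (1 + m)))) := by
  have hk : ∀ k : Fin (q + 1), ∃ C : ℝ, ∀ t (θ : Pt q), θ k ≠ 0 → (∀ j, |θ j| ≤ |θ k|) →
      ‖∫ ζ, u t ζ * chr θ ζ‖ ≤ C * (‖θ‖ ^ (-(q + n + M)) * fd θ ^ (-(2 * (1 + m)))) := by
    intro k
    obtain ⟨C, hC⟩ := norm_oscillatory_le_of_max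
      (ι := {z : ι × Pt q // z.2 k ≠ 0 ∧ ∀ j, |z.2 j| ≤ |z.2 k|}) k (θ := fun t => t.1.2)
      (fun t => t.2.1) (fun t => t.2.2) hm hn hM (u := fun t => u t.1.1)
      (fun t => hus _) (fun t => huc _)
      (fun j => WB.comp_index (fun t : {z : ι × Pt q // z.2 k ≠ 0 ∧ ∀ j, |z.2 j| ≤ |z.2 k|} =>
        t.1.1) (hu j))
    set c : ℝ := q + 1 with hc
    have hc1 : 1 ≤ c := by rw [hc]; have : (0 : ℝ) ≤ q := Nat.cast_nonneg q
                           linarith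
    refine ⟨|C| * (c ^ (q + n + M) * ((c + 1) ^ 2) ^ (1 + m)), fun t θ hθ hmax => ?_⟩
    refine (hC ⟨(t, θ), hθ, hmax⟩).trans ?_
    dsimp only
    set δ := |θ k| with hδd
    have hδ : 0 < δ := abs_pos.mpr hθ
    set σ := max |θ (Fin.last q)| (δ ^ 2) with hσd
    have hσ : 0 < σ := lt_max_of_lt_right (by positivity)
    have hθ0 : 0 < ‖θ‖ := hδ.trans_le (abs_coord_le_norm θ k)
    have hn1 : ‖θ‖ ≤ c * δ := by
      refine abs_le_of_sq_le_sq' (a := ‖θ‖) ?_ (by positivity) |>.2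
      rw [EuclideanSpace.norm_sq_eq]
      calc ∑ i, ‖θ i‖ ^ 2 ≤ ∑ _i : Fin (q + 1), δ ^ 2 :=
            Finset.sum_le_sum fun i _ => pow_le_pow_left₀ (norm_nonneg _) (hmax i) 2
        _ = c * δ ^ 2 := by simp [hc]
        _ ≤ (c * δ) ^ 2 := by rw [mul_pow]; gcongr; nlinarith
    have hfd0 : 0 < fd θ := hθ0.trans_le (norm_le_fd θ)
    have hn2 : fd θ ≤ (c + 1) * √σ := by
      have h1 : δ ≤ √σ := Real.le_sqrt_of_sq_le (le_max_right _ _)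
      have h2 : √|θ (Fin.last q)| ≤ √σ := Real.sqrt_le_sqrt (le_max_left _ _)
      have h3 : c * δ ≤ c * √σ := by gcongr
      unfold fd
      linarith
    have hn3 : fd θ ^ 2 ≤ (c + 1) ^ 2 * σ := by
      calc fd θ ^ 2 ≤ ((c + 1) * √σ) ^ 2 := pow_le_pow_left₀ hfd0.le hn2 2
        _ = _ := by rw [mul_pow, Real.sq_sqrt hσ.le]
    have ha : 0 ≤ q + n + M := by linarith
    have b1 : δ ^ (-(q + n + M)) ≤ c ^ (q + n + M) * ‖θ‖ ^ (-(q + n + M)) := by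
      have h1 : ‖θ‖ ^ (q + n + M) ≤ c ^ (q + n + M) * δ ^ (q + n + M) := by
        rw [← Real.mul_rpow (by linarith) hδ.le]
        exact Real.rpow_le_rpow hθ0.le hn1 ha
      rw [Real.rpow_neg hδ.le, Real.rpow_neg hθ0.le, ← div_eq_mul_inv, inv_eq_one_div,
        div_le_div_iff₀ (by positivity) (by positivity), one_mul]
      exact h1
    have b2 : σ ^ (-(1 + m)) ≤ ((c + 1) ^ 2) ^ (1 + m) * fd θ ^ (-(2 * (1 + m))) := by
      have h1 : fd θ ^ (2 * (1 + m)) ≤ ((c + 1) ^ 2) ^ (1 + m) * σ ^ (1 + m) := by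
        rw [← Real.mul_rpow (by positivity) hσ.le, Real.rpow_mul hfd0.le]
        refine Real.rpow_le_rpow (by positivity) ?_ (by linarith)
        exact_mod_cast hn3
      rw [Real.rpow_neg hσ.le, Real.rpow_neg hfd0.le, ← div_eq_mul_inv, inv_eq_one_div,
        div_le_div_iff₀ (by positivity) (by positivity), one_mul]
      exact h1
    calc C * (δ ^ (-(q + n + M)) * σ ^ (-(1 + m)))
        ≤ |C| * (δ ^ (-(q + n + M)) * σ ^ (-(1 + m))) := by gcongr; exact le_abs_self C
      _ ≤ |C| * ((c ^ (q + n + M) * ‖θ‖ ^ (-(q + n + M))) *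
          (((c + 1) ^ 2) ^ (1 + m) * fd θ ^ (-(2 * (1 + m))))) := by gcongr
      _ = _ := by ring
  choose C hC using hk
  refine ⟨∑ k, |C k|, fun t θ hθ => ?_⟩
  obtain ⟨k, -, hkmax⟩ := Finset.exists_max_image Finset.univ (fun j => |θ j|)
    ⟨Fin.last q, Finset.mem_univ _⟩
  have hk0 : θ k ≠ 0 := by
    intro h
    refine hθ ?_
    ext j
    have := hkmax j (Finset.mem_univ _)
    rw [h, abs_zero] at this
    simpa using le_antisymm this (abs_nonneg _)
  refine (hC k t θ hk0 fun j => hkmax j (Finset.mem_univ _)).trans ?_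
  refine mul_le_mul_of_nonneg_right ((le_abs_self _).trans
    (Finset.single_le_sum (f := fun k => |C k|) (fun _ _ => abs_nonneg _) (Finset.mem_univ k))) ?_
  have : 0 ≤ fd θ := (norm_nonneg θ).trans (norm_le_fd θ)
  positivity

end base

/-! ### Coordinate derivatives on `ℝ^N × ℝ^N` -/

section coords

variable {q : ℕ}

/-- The coordinate vectors of `ℝ^N × ℝ^N`. -/
def bvec {q : ℕ} : Fin (q + 1) ⊕ Fin (q + 1) → Pt q × Pt q
  | Sum.inl j => (basisVec j, 0)
  | Sum.inr j => (0, basisVec j)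

/-- The coordinates on `ℝ^N × ℝ^N`. -/
def coordForm {q : ℕ} : Fin (q + 1) ⊕ Fin (q + 1) → Pt q × Pt q →L[ℝ] ℝ
  | Sum.inl j => (EuclideanSpace.proj j).comp (ContinuousLinearMap.fst ℝ _ _)
  | Sum.inr j => (EuclideanSpace.proj j).comp (ContinuousLinearMap.snd ℝ _ _)

/-- The complex valued form `c dz_v`. -/
def dcoord {q : ℕ} (v : Fin (q + 1) ⊕ Fin (q + 1)) : ℂ →L[ℝ] Pt q × Pt q →L[ℝ] ℂ :=
  ContinuousLinearMap.smulRightL ℝ _ _ (coordForm v)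

@[simp] theorem dcoord_apply (v : Fin (q + 1) ⊕ Fin (q + 1)) (c : ℂ) (z : Pt q × Pt q) :
    dcoord v c z = coordForm v z * c := by
  simp [dcoord]

theorem pdker_eq (v : Fin (q + 1) ⊕ Fin (q + 1)) (F : Pt q × Pt q → ℂ) (z : Pt q × Pt q) :
    pdker v F z = fderiv ℝ F z (bvec v) := by
  cases v <;> rfl

theorem sum_basisVec (x : Pt q) : ∑ i, x i • basisVec i = x := by
  ext j
  simp [basisVec, Finset.sum_apply, Pi.single_apply]

theorem clm_apply_pair (L : Pt q × Pt q →L[ℝ] ℂ) (z : Pt q × Pt q) :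
    L z = ∑ i, (z.1 i : ℂ) * L (basisVec i, 0) + ∑ i, (z.2 i : ℂ) * L (0, basisVec i) := by
  have h1 : ∀ x : Pt q, L (x, 0) = ∑ i, (x i : ℂ) * L (basisVec i, 0) := by
    intro x
    have := map_sum (L.comp (ContinuousLinearMap.inl ℝ _ _)) (fun i => x i • basisVec i) Finset.univ
    rw [sum_basisVec] at this
    simpa using this
  have h2 : ∀ x : Pt q, L (0, x) = ∑ i, (x i : ℂ) * L (0, basisVec i) := by
    intro x
    have := map_sum (L.comp (ContinuousLinearMap.inr ℝ _ _)) (fun i => x i • basisVec i) Finset.univ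
    rw [sum_basisVec] at this
    simpa using this
  rw [← h1, ← h2, ← map_add]
  simp

theorem clm_eq_sum (L : Pt q × Pt q →L[ℝ] ℂ) : L = ∑ v, dcoord v (L (bvec v)) := by
  refine ContinuousLinearMap.ext fun z => ?_
  rw [clm_apply_pair, Fintype.sum_sum_type]
  simp [bvec, coordForm]

theorem fderiv_apply_pair (F : Pt q × Pt q → ℂ) (z v : Pt q × Pt q) :
    fderiv ℝ F z v = ∑ i, (v.1 i : ℂ) * pdFst i F z + ∑ i, (v.2 i : ℂ) * pdSnd i F z :=
  clm_apply_pair _ v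

theorem contDiff_pdker {F : Pt q × Pt q → ℂ} (hF : ContDiff ℝ ∞ F) (v) :
    ContDiff ℝ ∞ (pdker v F) := by
  have : pdker v F = fun z => fderiv ℝ F z (bvec v) := funext (pdker_eq v F)
  rw [this]
  exact contDiff_fderiv_apply hF _

theorem contDiff_pdFst {F : Pt q × Pt q → ℂ} (hF : ContDiff ℝ ∞ F) (i) :
    ContDiff ℝ ∞ (pdFst i F) := contDiff_pdker hF (Sum.inl i)

theorem contDiff_pdSnd {F : Pt q × Pt q → ℂ} (hF : ContDiff ℝ ∞ F) (i) :
    ContDiff ℝ ∞ (pdSnd i F) := contDiff_pdker hF (Sum.inr i)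

theorem contDiff_foldr_pdFst {F : Pt q × Pt q → ℂ} (hF : ContDiff ℝ ∞ F)
    (I : List (Fin (q + 1))) : ContDiff ℝ ∞ (I.foldr pdFst F) := by
  induction I with
  | nil => exact hF
  | cons i I ih => exact contDiff_pdFst ih i

theorem contDiff_slice {F : Pt q × Pt q → ℂ} (hF : ContDiff ℝ ∞ F) (x : Pt q) :
    ContDiff ℝ ∞ (fun ζ => F (x, ζ)) := hF.comp (contDiff_const.prodMk contDiff_id)

end coords

/-! ### Flat symbols -/

section flat

variable {q : ℕ}

/-- Symbols `p(x, ζ)` with constant coefficient estimates: no loss in the derivatives in `x`,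
and the gains `wt0` for the derivatives in `ζ`. -/
structure IsFlat (m n : ℝ) (p : Pt q × Pt q → ℂ) : Prop where
  smooth : ContDiff ℝ ∞ p
  bound : ∀ (I : List (Fin (q + 1))) (j : ℕ),
    WB id wt0 j (fun (_ : Pt q) ζ => wR ζ ^ m * wS ζ ^ n) (fun x ζ => I.foldr pdFst p (x, ζ))

theorem WB_const {ι κ : Type} {g : κ → Fin (q + 1)} {wt : κ → ι → Pt q → ℝ}
    (hwt0 : ∀ k t ζ, 0 ≤ wt k t ζ) (n : ℕ) {p : ι → Pt q → ℝ} (hp : ∀ t ζ, 0 ≤ p t ζ) (a : ℂ)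
    {c : ℝ} (h : ∀ t ζ, ‖a‖ ≤ c * p t ζ) : WB g wt n p (fun _ _ => a) := by
  induction n generalizing p a c with
  | zero => exact ⟨c, h⟩
  | succ n ih =>
    refine ⟨⟨c, h⟩, fun k => ?_⟩
    have := ih (p := fun t ζ => p t ζ * wt k t ζ) (fun t ζ => mul_nonneg (hp t ζ) (hwt0 k t ζ))
      0 (c := 0) (by simp)
    convert this using 3 with t ζ
    simp

theorem two_mul_wR_inv_le (ι : Type) (k : Fin (q + 1)) (t : ι) (ζ : Pt q) :
    (2 * wR ζ)⁻¹ ≤ wt0 k t ζ := by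
  have h1 := wR_pos ζ
  have h2 := wS_pos ζ
  unfold wt0
  split_ifs
  · exact inv_anti₀ h1 (by linarith)
  · exact inv_anti₀ h2 (wS_le_two_wR ζ)

theorem WB_coord_of_weight {ι : Type} (k : Fin (q + 1)) (n : ℕ) {p : ι → Pt q → ℝ}
    (hp : ∀ t ζ, 0 ≤ p t ζ) (h : ∀ t ζ, |ζ k| ≤ p t ζ)
    (h' : ∀ t ζ, 1 ≤ 2 * (p t ζ * wt0 k t ζ)) :
    WB id wt0 n p (fun _ ζ => 2 * Real.pi * Complex.I * ζ k) := by
  have h0 : ∃ C : ℝ, ∀ (t : ι) (ζ : Pt q), ‖(2 * Real.pi * Complex.I * ζ k : ℂ)‖ ≤ C * p t ζ := by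
    refine ⟨2 * Real.pi, fun t ζ => ?_⟩
    rw [norm_two_pi_I_mul]
    have := Real.pi_pos
    gcongr
    exact h t ζ
  cases n with
  | zero => exact h0
  | succ n =>
    refine ⟨h0, fun j => ?_⟩
    have e : ∀ ζ : Pt q, fderiv ℝ (fun ζ : Pt q => (2 * Real.pi * Complex.I * ζ k : ℂ)) ζ
        (basisVec j) = if j = k then 2 * Real.pi * Complex.I else 0 := by
      intro ζ
      have : HasFDerivAt (fun ζ : Pt q => (2 * Real.pi * Complex.I * ζ k : ℂ))
          ((2 * Real.pi * Complex.I : ℂ) • Complex.ofRealCLM.comp (EuclideanSpace.proj k)) ζ :=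
        (Complex.ofRealCLM.comp (EuclideanSpace.proj k)).hasFDerivAt.const_mul _
      rw [this.fderiv]
      by_cases hjk : j = k
      · simp [hjk, basisVec]
      · simp [hjk, basisVec, Ne.symm hjk]
    have hnn : ∀ (t : ι) (ζ : Pt q), 0 ≤ p t ζ * wt0 j t ζ := fun t ζ =>
      mul_nonneg (hp t ζ) (wt0_nonneg j t ζ)
    have := WB_const (g := id) (wt := wt0) wt0_nonneg n hnn
      (if j = k then 2 * Real.pi * Complex.I else 0) (c := 4 * Real.pi) (fun t ζ => by
        have h1 := Real.pi_pos
        have h2 := hnn t ζ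
        split_ifs with hjk
        · have h3 := h' t ζ
          rw [← hjk] at h3
          have h4 : ‖(2 * Real.pi * Complex.I : ℂ)‖ = 2 * Real.pi := by
            simpa using norm_two_pi_I_mul 1
          rw [h4]
          nlinarith
        · rw [norm_zero]
          positivity)
    convert this using 3 with t ζ
    exact e ζ

theorem WB_coord {ι : Type} (k : Fin (q + 1)) (n : ℕ) :
    WB id wt0 n (fun (_ : ι) ζ => wR ζ) (fun _ ζ => 2 * Real.pi * Complex.I * ζ k) := by
  refine WB_coord_of_weight k n (fun _ ζ => (wR_pos ζ).le) (fun _ ζ => ?_) (fun t ζ => ?_)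
  · have := abs_coord_le_norm ζ k
    unfold wR; linarith
  · have h1 := two_mul_wR_inv_le ι k t ζ
    have h2 := wR_pos ζ
    calc (1 : ℝ) = 2 * (wR ζ * (2 * wR ζ)⁻¹) := by field_simp
      _ ≤ _ := by gcongr

theorem WB_coord_castSucc {ι : Type} (i : Fin q) (n : ℕ) :
    WB id wt0 n (fun (_ : ι) ζ => wS ζ) (fun _ ζ => 2 * Real.pi * Complex.I * ζ i.castSucc) := by
  refine WB_coord_of_weight i.castSucc n (fun _ ζ => (wS_pos ζ).le) (fun _ ζ => ?_) (fun t ζ => ?_)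
  · have := abs_coord_le_pn ζ i
    have := pn_le_wS ζ
    linarith
  · have h2 := wS_pos ζ
    rw [wt0, if_neg (Fin.castSucc_lt_last i).ne, mul_inv_cancel₀ h2.ne']
    norm_num

/-- The number of good `θ`-derivatives in a coordinate derivative. -/
def gS {q : ℕ} : Fin (q + 1) ⊕ Fin (q + 1) → ℝ
  | Sum.inl _ => 0
  | Sum.inr k => if k = Fin.last q then 0 else 1

/-- The number of bad `θ`-derivatives in a coordinate derivative. -/
def bS {q : ℕ} : Fin (q + 1) ⊕ Fin (q + 1) → ℝ
  | Sum.inl _ => 0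
  | Sum.inr k => if k = Fin.last q then 1 else 0

theorem gS_nonneg (v : Fin (q + 1) ⊕ Fin (q + 1)) : 0 ≤ gS v := by
  cases v <;> simp only [gS] <;> (try split_ifs) <;> norm_num

theorem bS_nonneg (v : Fin (q + 1) ⊕ Fin (q + 1)) : 0 ≤ bS v := by
  cases v <;> simp only [bS] <;> (try split_ifs) <;> norm_num

/-- The operation on symbols corresponding to a coordinate derivative of the oscillatory
integral. -/
def symD {q : ℕ} : Fin (q + 1) ⊕ Fin (q + 1) → (Pt q × Pt q → ℂ) → Pt q × Pt q → ℂ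
  | Sum.inl i, p => pdFst i p
  | Sum.inr k, p => fun z => (2 * Real.pi * Complex.I * z.2 k) * p z

theorem pdFst_mul_snd {F : Pt q × Pt q → ℂ} (hF : ContDiff ℝ ∞ F) {h : Pt q → ℂ}
    (hh : ContDiff ℝ ∞ h) (i : Fin (q + 1)) :
    pdFst i (fun z => h z.2 * F z) = fun z => h z.2 * pdFst i F z := by
  funext z
  have h1 : HasFDerivAt (fun z : Pt q × Pt q => h z.2)
      ((fderiv ℝ h z.2).comp (ContinuousLinearMap.snd ℝ _ _)) z :=
    HasFDerivAt.comp z ((hh.differentiable (by simp) z.2).hasFDerivAt) hasFDerivAt_snd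
  have h2 := h1.mul (hF.differentiable (by simp) z).hasFDerivAt
  change fderiv ℝ ((fun z : Pt q × Pt q => h z.2) * F) z _ = _
  rw [h2.fderiv]
  simp [pdFst]

theorem foldr_pdFst_mul_snd {F : Pt q × Pt q → ℂ} (hF : ContDiff ℝ ∞ F) {h : Pt q → ℂ}
    (hh : ContDiff ℝ ∞ h) (I : List (Fin (q + 1))) :
    I.foldr pdFst (fun z => h z.2 * F z) = fun z => h z.2 * I.foldr pdFst F z := by
  induction I with
  | nil => rfl
  | cons i I ih =>
    rw [List.foldr_cons, ih, pdFst_mul_snd (contDiff_foldr_pdFst hF I) hh]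
    rfl

theorem contDiff_coord (k : Fin (q + 1)) :
    ContDiff ℝ ∞ (fun ζ : Pt q => (2 * Real.pi * Complex.I * ζ k : ℂ)) :=
  contDiff_const.mul (Complex.ofRealCLM.comp (EuclideanSpace.proj k)).contDiff

theorem IsFlat.symD {m n : ℝ} {p : Pt q × Pt q → ℂ} (hp : IsFlat m n p)
    (v : Fin (q + 1) ⊕ Fin (q + 1)) : IsFlat (m + bS v) (n + gS v) (symD v p) := by
  have hw : ∀ (t : Pt q) (ζ : Pt q), 0 ≤ wR ζ ^ m * wS ζ ^ n := fun _ ζ => by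
    have := wR_pos ζ
    have := wS_pos ζ
    positivity
  rcases v with i | k
  · refine ⟨contDiff_pdFst hp.smooth i, fun I j => ?_⟩
    have := hp.bound (I ++ [i]) j
    simp only [List.foldr_append, List.foldr_cons, List.foldr_nil] at this
    simp only [bS, gS, add_zero]
    exact this
  · refine ⟨((contDiff_coord k).comp contDiff_snd).mul hp.smooth, fun I j => ?_⟩
    have hb := hp.bound I j
    have hs : ∀ x : Pt q, ContDiff ℝ ∞ (fun ζ => I.foldr pdFst p (x, ζ)) := fun x =>
      contDiff_slice (contDiff_foldr_pdFst hp.smooth I) x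
    simp only [MixedPDO.symD]
    rw [foldr_pdFst_mul_snd hp.smooth (contDiff_coord k) I]
    refine Fin.lastCases ?_ (fun i => ?_) k
    · have := WB.mul (fun _ => contDiff_coord (Fin.last q)) hs (WB_coord (Fin.last q) j) hb
      refine WB.mono wt0_nonneg 1 (fun t ζ => mul_nonneg (wR_pos ζ).le (hw t ζ)) (fun t ζ => ?_) this
      simp only [bS, gS, if_true, add_zero, one_mul]
      rw [Real.rpow_add (wR_pos ζ), Real.rpow_one]
      exact le_of_eq (by ring)
    · have := WB.mul (fun _ => contDiff_coord i.castSucc) hs (WB_coord_castSucc i j) hb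
      refine WB.mono wt0_nonneg 1 (fun t ζ => mul_nonneg (wS_pos ζ).le (hw t ζ)) (fun t ζ => ?_) this
      simp only [bS, gS, (Fin.castSucc_lt_last i).ne, if_false, add_zero, one_mul]
      rw [Real.rpow_add (wS_pos ζ), Real.rpow_one]
      exact le_of_eq (by ring)

end flat

/-! ### Truncated oscillatory integrals -/

section trunc

variable {q : ℕ}

/-- A smooth cutoff at scale `2 ^ j`. -/
def cutj {q : ℕ} (j : ℕ) (ζ : Pt q) : ℂ := cut (dil (fun _ => ((2 : ℝ) ^ j)⁻¹) ζ)

theorem norm_dil_const {r : ℝ} (hr : 0 ≤ r) (ζ : Pt q) : ‖dil (fun _ => r) ζ‖ = r * ‖ζ‖ := by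
  have : dil (fun _ => r) ζ = r • ζ := by ext k; simp
  rw [this, norm_smul, Real.norm_of_nonneg hr]

theorem contDiff_cutj (j : ℕ) : ContDiff ℝ ∞ (cutj j : Pt q → ℂ) := contDiff_cut_dil _

theorem norm_cutj_le (j : ℕ) (ζ : Pt q) : ‖cutj j ζ‖ ≤ 1 := norm_cut_le _

theorem cutj_eq_zero {j : ℕ} {ζ : Pt q} (h : 2 * 2 ^ j ≤ ‖ζ‖) : cutj j ζ = 0 := by
  refine cut_eq_zero ?_
  rw [norm_dil_const (by positivity), inv_mul_eq_div, le_div_iff₀ (by positivity)]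
  exact h

theorem tendsto_cutj (ζ : Pt q) : Filter.Tendsto (fun j => cutj j ζ) Filter.atTop (nhds 1) := by
  refine tendsto_const_nhds.congr' ?_
  obtain ⟨j₀, hj₀⟩ := pow_unbounded_of_one_lt ‖ζ‖ one_lt_two
  filter_upwards [Filter.eventually_ge_atTop j₀] with j hj
  refine (cut_eq_one ?_).symm
  rw [norm_dil_const (by positivity), inv_mul_eq_div, div_le_one (by positivity)]
  exact hj₀.le.trans (pow_le_pow_right₀ one_le_two hj)

theorem hasCompactSupport_cutj (j : ℕ) : HasCompactSupport (cutj j : Pt q → ℂ) :=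
  HasCompactSupport.of_support_subset_isCompact (isCompact_closedBall (0 : Pt q) (2 * 2 ^ j))
    fun z hz => by
      by_contra h
      exact hz (cutj_eq_zero (not_le.mp (by simpa using h)).le)

theorem cutj_scale_le {ι : Type} (k : Fin (q + 1)) (t : ι) (j : ℕ) (ζ : Pt q)
    (h : ‖dil (fun _ => ((2 : ℝ) ^ j)⁻¹) ζ‖ ≤ 2) : |((2 : ℝ) ^ j)⁻¹| ≤ 6 * wt0 k t ζ := by
  have h1 := two_mul_wR_inv_le ι k t ζ
  have h2 := wR_pos ζ
  rw [norm_dil_const (by positivity)] at h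
  rw [abs_of_nonneg (by positivity)]
  have h3 : ((2 : ℝ) ^ j)⁻¹ ≤ 1 := inv_le_one_of_one_le₀ (one_le_pow₀ one_le_two)
  have h4 : ((2 : ℝ) ^ j)⁻¹ * wR ζ ≤ 3 := by unfold wR; linarith
  calc ((2 : ℝ) ^ j)⁻¹ ≤ 6 * (2 * wR ζ)⁻¹ := by
        rw [← div_eq_mul_inv, le_div_iff₀ (by positivity)]; linarith
    _ ≤ _ := by gcongr

theorem WB_cutj (n : ℕ) :
    WB id wt0 n (fun (_ : ℕ × Pt q) _ => 1) (fun t (ζ : Pt q) => cutj t.1 ζ) := by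
  have := WB_cut (g := id) (wt := wt0 (q := q)) (r := fun (t : ℕ × Pt q) _ => ((2 : ℝ) ^ t.1)⁻¹) wt0_nonneg
    (fun k t ζ h => cutj_scale_le k t t.1 ζ h) n (c := fun _ => 1) (p := fun _ _ => 1)
    (fun _ _ => zero_le_one) (c₁ := 1) (by simp)
  simp only [one_mul] at this
  exact this

theorem WB_one_sub_cutj {ι : Type} (e : ι → ℕ) (n : ℕ) :
    WB id wt0 n (fun (t : ι) (ζ : Pt q) => ((2 : ℝ) ^ e t)⁻¹ * wR ζ) (fun t ζ => 1 - cutj (e t) ζ) := by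
  have := WB_one_sub_cut (g := id) (wt := wt0) (r := fun (t : ι) _ => ((2 : ℝ) ^ e t)⁻¹) wt0_nonneg
    (fun k t ζ h => cutj_scale_le k t (e t) ζ h) n (c := fun _ => 1) (fun _ => Or.inr rfl)
    (p := fun (t : ι) (ζ : Pt q) => ((2 : ℝ) ^ e t)⁻¹ * wR ζ)
    (fun t ζ => by have := wR_pos ζ; positivity) (c₁ := 1) (fun t ζ h => by
      have h1 := h rfl
      rw [norm_dil_const (by positivity)] at h1
      have h2 : 0 < ((2 : ℝ) ^ e t)⁻¹ := by positivity
      unfold wR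
      linarith)
  simp only [one_mul] at this
  exact this

theorem WB_cutj_sub (n : ℕ) :
    WB id wt0 n (fun (t : {t : (ℕ × ℕ) × Pt q // t.1.2 ≤ t.1.1}) (ζ : Pt q) =>
      ((2 : ℝ) ^ t.1.1.2)⁻¹ * wR ζ)
      (fun t ζ => cutj t.1.1.1 ζ - cutj t.1.1.2 ζ) := by
  have h1 := WB_one_sub_cutj (q := q) (fun t : {t : (ℕ × ℕ) × Pt q // t.1.2 ≤ t.1.1} => t.1.1.2) n
  have h2 := WB_one_sub_cutj (q := q) (fun t : {t : (ℕ × ℕ) × Pt q // t.1.2 ≤ t.1.1} => t.1.1.1) n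
  have hs : ∀ j, ContDiff ℝ ∞ (fun ζ : Pt q => 1 - cutj j ζ) := fun j =>
    contDiff_const.sub (contDiff_cutj j)
  have h3 := WB.const_mul (fun t => hs _) (c := fun _ => -1) (w := fun _ => 1) (by simp) h2
  have h4 := WB.mono (p' := fun t (ζ : Pt q) => ((2 : ℝ) ^ t.1.1.2)⁻¹ * wR ζ) wt0_nonneg 1
    (fun t ζ => by have := wR_pos ζ; positivity) (fun t ζ => by
      rw [one_mul, one_mul]
      have := wR_pos ζ
      have := t.2
      gcongr
      exact one_le_two) h3
  have := WB.add (fun t => hs _) (fun t => contDiff_const.mul (hs _)) h1 h4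
  convert this using 3 with t ζ
  ring

/-- The truncated oscillatory integral `∫ p(x,ζ) χ(2^{-j}ζ) e^{2πi θ·ζ} dζ`. -/
def Gc {q : ℕ} (j : ℕ) (p : Pt q × Pt q → ℂ) (z : Pt q × Pt q) : ℂ :=
  ∫ ζ, p (z.1, ζ) * cutj j ζ * chr z.2 ζ

theorem norm_Gc_le {m n : ℝ} (hm : -1 < m) (hn : -(q : ℝ) < n) {M : ℝ} (hM : 0 ≤ M)
    {p : Pt q × Pt q → ℂ} (hp : IsFlat m n p) :
    ∃ C : ℝ, ∀ j z, z.2 ≠ 0 →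
      ‖Gc j p z‖ ≤ C * (‖z.2‖ ^ (-(q + n + M)) * fd z.2 ^ (-(2 * (1 + m)))) := by
  have hs := fun x => contDiff_slice hp.smooth x
  obtain ⟨C, hC⟩ := norm_oscillatory_le (ι := ℕ × Pt q) hm hn hM
    (u := fun t ζ => p (t.2, ζ) * cutj t.1 ζ) (fun t => (hs t.2).mul (contDiff_cutj t.1))
    (fun t => (hasCompactSupport_cutj t.1).mul_left) (fun j => by
      have := WB.mul (fun t => hs _) (fun t => contDiff_cutj _)
        (WB.comp_index (fun t : ℕ × Pt q => t.2) (hp.bound [] j)) (WB_cutj j)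
      simp only [mul_one] at this
      exact this)
  exact ⟨C, fun j z hz => hC (j, z.1) z.2 hz⟩

theorem integrable_trunc {p : Pt q × Pt q → ℂ} (hp : Continuous p) (j : ℕ) (z : Pt q × Pt q) :
    Integrable (fun ζ => p (z.1, ζ) * cutj j ζ * chr z.2 ζ) := by
  have h1 : Continuous (fun ζ => p (z.1, ζ)) := by fun_prop
  have h2 := (contDiff_cutj (q := q) j).continuous
  have h3 := (contDiff_chr (n := 0) z.2).continuous
  exact ((h1.mul h2).mul h3).integrable_of_hasCompactSupport
    ((hasCompactSupport_cutj j).mul_left.mul_right)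

theorem norm_Gc_sub_le {m n : ℝ} (hm : -1 < m) (hn : -(q : ℝ) < n)
    {p : Pt q × Pt q → ℂ} (hp : IsFlat m n p) :
    ∃ C : ℝ, 0 ≤ C ∧ ∀ i j z, j ≤ i → z.2 ≠ 0 →
      ‖Gc i p z - Gc j p z‖ ≤
        C * (‖z.2‖ ^ (-(q + n)) * fd z.2 ^ (-(2 * (2 + m)))) * ((2 : ℝ) ^ j)⁻¹ := by
  have hs := fun x => contDiff_slice hp.smooth x
  have hsub : ∀ i j, ContDiff ℝ ∞ (fun ζ : Pt q => cutj i ζ - cutj j ζ) := fun i j =>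
    (contDiff_cutj i).sub (contDiff_cutj j)
  have hw : ∀ (t : Pt q) (ζ : Pt q), 0 ≤ wR ζ ^ m * wS ζ ^ n := fun _ ζ => by
    have := wR_pos ζ
    have := wS_pos ζ
    positivity
  obtain ⟨C, hC⟩ := norm_oscillatory_le (ι := {t : (ℕ × ℕ) × Pt q // t.1.2 ≤ t.1.1})
    (m := m + 1) (by linarith) hn le_rfl
    (u := fun t ζ => (2 : ℂ) ^ t.1.1.2 * (p (t.1.2, ζ) * (cutj t.1.1.1 ζ - cutj t.1.1.2 ζ)))
    (fun t => contDiff_const.mul ((hs _).mul (hsub _ _)))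
    (fun t => ((((hasCompactSupport_cutj _).sub (hasCompactSupport_cutj _)).mul_left).mul_left))
    (fun j => by
      have h1 := WB.mul (fun t => hs _) (fun t => hsub _ _)
        (WB.comp_index (fun t : {t : (ℕ × ℕ) × Pt q // t.1.2 ≤ t.1.1} => t.1.2) (hp.bound [] j))
        (WB_cutj_sub j)
      have h2 := WB.const_mul (fun t => (hs _).mul (hsub _ _)) (c := fun t => (2 : ℂ) ^ t.1.1.2)
        (w := fun t => (2 : ℝ) ^ t.1.1.2) (by simp) h1
      refine WB.mono wt0_nonneg 1 (fun t ζ => ?_) (fun t ζ => le_of_eq ?_) h2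
      · have := hw t.1.2 ζ
        have := wR_pos ζ
        positivity
      · have e : (2 : ℝ) ^ t.1.1.2 * ((2 : ℝ) ^ t.1.1.2)⁻¹ = 1 := mul_inv_cancel₀ (by positivity)
        rw [Real.rpow_add (wR_pos ζ), Real.rpow_one]
        linear_combination (wR ζ ^ m * wS ζ ^ n * wR ζ) * e)
  refine ⟨|C|, abs_nonneg C, fun i j z hij hz => ?_⟩
  have h := hC ⟨((i, j), z.1), hij⟩ z.2 hz
  have e : ∫ ζ, (2 : ℂ) ^ j * (p (z.1, ζ) * (cutj i ζ - cutj j ζ)) * chr z.2 ζ =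
      (2 : ℂ) ^ j * (Gc i p z - Gc j p z) := by
    rw [Gc, Gc, ← integral_sub (integrable_trunc hp.smooth.continuous i z)
      (integrable_trunc hp.smooth.continuous j z), ← integral_const_mul]
    congr 1
    funext ζ
    ring
  dsimp only at h
  rw [e, norm_mul, norm_pow, Complex.norm_ofNat] at h
  rw [← div_eq_mul_inv, le_div_iff₀ (by positivity), mul_comm]
  refine h.trans ?_
  have hfd : 0 ≤ fd z.2 := (norm_nonneg _).trans (norm_le_fd _)
  rw [add_zero, show 1 + (m + 1) = 2 + m by ring]
  gcongr
  exact le_abs_self C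

theorem contDiff_symD {p : Pt q × Pt q → ℂ} (hp : ContDiff ℝ ∞ p) (v) :
    ContDiff ℝ ∞ (symD v p) := by
  cases v with
  | inl i => exact contDiff_pdFst hp i
  | inr k => exact ((contDiff_coord k).comp contDiff_snd).mul hp

theorem hasFDerivAt_chr_left (θ ζ : Pt q) :
    HasFDerivAt (fun θ => chr θ ζ) ((2 * Real.pi * Complex.I * chr θ ζ) •
      Complex.ofRealCLM.comp (innerSL ℝ ζ)) θ := by
  have := hasFDerivAt_chr ζ θ
  have e : ∀ θ, chr ζ θ = chr θ ζ := fun θ => by rw [chr, chr, real_inner_comm]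
  simpa only [funext e, e] using this

theorem hasFDerivAt_integrand {p : Pt q × Pt q → ℂ} (hp : ContDiff ℝ ∞ p) (j : ℕ)
    (z : Pt q × Pt q) (ζ : Pt q) :
    HasFDerivAt (fun z : Pt q × Pt q => p (z.1, ζ) * cutj j ζ * chr z.2 ζ)
      (∑ v, dcoord v (symD v p (z.1, ζ) * cutj j ζ * chr z.2 ζ)) z := by
  have h1 : HasFDerivAt (fun z : Pt q × Pt q => (z.1, ζ))
      ((ContinuousLinearMap.fst ℝ (Pt q) (Pt q)).prod 0) z :=
    hasFDerivAt_fst.prodMk (hasFDerivAt_const ζ z)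
  have h2 := HasFDerivAt.comp z (hp.differentiable (by simp) (z.1, ζ)).hasFDerivAt h1
  have h3 : HasFDerivAt (fun z : Pt q × Pt q => chr z.2 ζ) _ z :=
    HasFDerivAt.comp (g := fun θ => chr θ ζ) z (hasFDerivAt_chr_left z.2 ζ) hasFDerivAt_snd
  have h4 := (h2.mul_const (cutj j ζ)).mul h3
  refine h4.congr_fderiv ((clm_eq_sum _).trans ?_)
  refine Finset.sum_congr rfl fun v _ => ?_
  congr 1
  rcases v with i | k
  · simp [bvec, symD, pdFst]
    ring
  · have h0 : fderiv ℝ p (z.1, ζ) ((0 : Pt q), (0 : Pt q)) = 0 := map_zero _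
    simp [bvec, symD, inner_basisVec, h0]
    ring

/-- The derivative of the truncated integrand in `(x, θ)`. -/
def dintegrand {q : ℕ} (j : ℕ) (p : Pt q × Pt q → ℂ) (z : Pt q × Pt q) (ζ : Pt q) :
    Pt q × Pt q →L[ℝ] ℂ :=
  ∑ v, dcoord v (symD v p (z.1, ζ) * cutj j ζ * chr z.2 ζ)

theorem continuous_dintegrand {p : Pt q × Pt q → ℂ} (hp : ContDiff ℝ ∞ p) (j : ℕ) :
    Continuous (fun y : (Pt q × Pt q) × Pt q => dintegrand j p y.1 y.2) := by
  refine continuous_finsetSum _ fun v _ => ?_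
  have h1 : Continuous (symD v p) := (contDiff_symD hp v).continuous
  have h2 : Continuous (fun y : (Pt q × Pt q) × Pt q => cutj j y.2) :=
    (contDiff_cutj (q := q) j).continuous.comp continuous_snd
  have h3 : Continuous (fun y : (Pt q × Pt q) × Pt q => chr y.1.2 y.2) :=
    (contDiff_chr_uncurry (q := q) (n := 0)).continuous.comp
      ((continuous_snd.comp continuous_fst).prodMk continuous_snd)
  have h4 : Continuous (fun y : (Pt q × Pt q) × Pt q => symD v p (y.1.1, y.2)) :=
    h1.comp ((continuous_fst.comp continuous_fst).prodMk continuous_snd)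
  exact (dcoord v).continuous.comp ((h4.mul h2).mul h3)

theorem dintegrand_eq_zero {p : Pt q × Pt q → ℂ} {j : ℕ} (z : Pt q × Pt q) {ζ : Pt q}
    (hζ : ζ ∉ Metric.closedBall (0 : Pt q) (2 * 2 ^ j)) : dintegrand j p z ζ = 0 := by
  have : cutj j ζ = 0 := cutj_eq_zero (not_le.mp (by simpa using hζ)).le
  refine Finset.sum_eq_zero fun v _ => ?_
  rw [this, mul_zero, zero_mul, map_zero]

theorem exists_norm_dintegrand_le {p : Pt q × Pt q → ℂ} (hp : ContDiff ℝ ∞ p) (j : ℕ)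
    (z : Pt q × Pt q) : ∃ C, ∀ ζ, ∀ y ∈ Metric.closedBall z 1, ‖dintegrand j p y ζ‖ ≤
      (Metric.closedBall (0 : Pt q) (2 * 2 ^ j)).indicator (fun _ => C) ζ := by
  obtain ⟨C, hC⟩ := ((isCompact_closedBall z 1).prod
    (isCompact_closedBall (0 : Pt q) (2 * 2 ^ j))).exists_bound_of_continuousOn
      (continuous_dintegrand hp j).continuousOn
  refine ⟨C, fun ζ y hy => ?_⟩
  by_cases hζ : ζ ∈ Metric.closedBall (0 : Pt q) (2 * 2 ^ j)
  · rw [Set.indicator_of_mem hζ]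
    exact hC (y, ζ) ⟨hy, hζ⟩
  · rw [Set.indicator_of_notMem hζ, dintegrand_eq_zero y hζ, norm_zero]

theorem integrable_dcoord_trunc {p : Pt q × Pt q → ℂ} (hp : ContDiff ℝ ∞ p) (j : ℕ)
    (z : Pt q × Pt q) (v) :
    Integrable (fun ζ => dcoord v (symD v p (z.1, ζ) * cutj j ζ * chr z.2 ζ)) :=
  (dcoord v).integrable_comp (integrable_trunc (contDiff_symD hp v).continuous j z)

theorem integral_dintegrand {p : Pt q × Pt q → ℂ} (hp : ContDiff ℝ ∞ p) (j : ℕ)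
    (z : Pt q × Pt q) : ∫ ζ, dintegrand j p z ζ = ∑ v, dcoord v (Gc j (symD v p) z) := by
  unfold dintegrand
  rw [integral_finsetSum _ fun v _ => integrable_dcoord_trunc hp j z v]
  refine Finset.sum_congr rfl fun v _ => ?_
  exact (dcoord v).integral_comp_comm (integrable_trunc (contDiff_symD hp v).continuous j z)

theorem hasFDerivAt_Gc {p : Pt q × Pt q → ℂ} (hp : ContDiff ℝ ∞ p) (j : ℕ) (z : Pt q × Pt q) :
    HasFDerivAt (Gc j p) (∑ v, dcoord v (Gc j (symD v p) z)) z := by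
  obtain ⟨C, hC⟩ := exists_norm_dintegrand_le hp j z
  have hm : AEStronglyMeasurable (dintegrand j p z) volume :=
    ((continuous_dintegrand hp j).comp (Continuous.prodMk_right z)).aestronglyMeasurable
  have hb : Integrable ((Metric.closedBall (0 : Pt q) (2 * 2 ^ j)).indicator fun _ => C) :=
    (integrable_indicator_iff measurableSet_closedBall).mpr
      (integrableOn_const (isCompact_closedBall _ _).measure_lt_top.ne)
  have key := hasFDerivAt_integral_of_dominated_of_fderiv_le (μ := volume) (𝕜 := ℝ)
    (F := fun (z : Pt q × Pt q) ζ => p (z.1, ζ) * cutj j ζ * chr z.2 ζ) (F' := dintegrand j p)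
    (x₀ := z) (Metric.closedBall_mem_nhds z one_pos)
    (Filter.Eventually.of_forall fun y => (integrable_trunc hp.continuous j y).1)
    (integrable_trunc hp.continuous j z) hm (ae_of_all _ hC) hb
    (ae_of_all _ fun ζ y _ => hasFDerivAt_integrand hp j y ζ)
  exact key.congr_fderiv (integral_dintegrand hp j z)

theorem continuous_Gc {p : Pt q × Pt q → ℂ} (hp : ContDiff ℝ ∞ p) (j : ℕ) : Continuous (Gc j p) :=
  continuous_iff_continuousAt.mpr fun z => (hasFDerivAt_Gc hp j z).continuousAt

/-! ### Oscillatory integrals -/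

/-- The oscillatory integral `∫ p(x,ζ) e^{2πi θ·ζ} dζ`, for `θ ≠ 0`. -/
def Glim {q : ℕ} (p : Pt q × Pt q → ℂ) (z : Pt q × Pt q) : ℂ :=
  Filter.limUnder Filter.atTop fun j => Gc j p z

/-- The set `θ ≠ 0` in the space of `(x, θ)`. -/
def punct (q : ℕ) : Set (Pt q × Pt q) := {z | z.2 ≠ 0}

theorem isOpen_punct : IsOpen (punct q) := isOpen_ne_fun continuous_snd continuous_const

theorem fd_pos {θ : Pt q} (hθ : θ ≠ 0) : 0 < fd θ :=
  (norm_pos_iff.mpr hθ).trans_le (norm_le_fd θ)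

theorem continuous_fd : Continuous (fd : Pt q → ℝ) := by unfold fd; fun_prop

theorem tendsto_Gc_and_rate {m n : ℝ} (hm : -1 < m) (hn : -(q : ℝ) < n)
    {p : Pt q × Pt q → ℂ} (hp : IsFlat m n p) :
    ∃ C : ℝ, 0 ≤ C ∧ ∀ z ∈ punct q,
      Filter.Tendsto (fun j => Gc j p z) Filter.atTop (nhds (Glim p z)) ∧
      ∀ j, ‖Glim p z - Gc j p z‖ ≤
        C * (‖z.2‖ ^ (-(q + n)) * fd z.2 ^ (-(2 * (2 + m)))) * ((2 : ℝ) ^ j)⁻¹ := by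
  obtain ⟨C, hC0, hC⟩ := norm_Gc_sub_le hm hn hp
  refine ⟨C, hC0, fun z hz => ?_⟩
  set W := C * (‖z.2‖ ^ (-(q + n)) * fd z.2 ^ (-(2 * (2 + m))))
  have h0 : Filter.Tendsto (fun j : ℕ => 2 * (W * ((2 : ℝ) ^ j)⁻¹)) Filter.atTop (nhds 0) := by
    have : Filter.Tendsto (fun j : ℕ => ((2 : ℝ) ^ j)⁻¹) Filter.atTop (nhds 0) :=
      tendsto_inv_atTop_zero.comp (tendsto_pow_atTop_atTop_of_one_lt one_lt_two)
    simpa using (this.const_mul W).const_mul 2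
  have hcau : CauchySeq (fun j => Gc j p z) := by
    refine cauchySeq_of_le_tendsto_0 _ (fun i j N hi hj => ?_) h0
    rw [dist_eq_norm]
    have e : Gc i p z - Gc j p z = (Gc i p z - Gc N p z) - (Gc j p z - Gc N p z) := by ring
    rw [e]
    refine (norm_sub_le _ _).trans ?_
    rw [two_mul]
    exact add_le_add (hC i N z hi hz) (hC j N z hj hz)
  have ht : Filter.Tendsto (fun j => Gc j p z) Filter.atTop (nhds (Glim p z)) :=
    hcau.tendsto_limUnder
  refine ⟨ht, fun j => ?_⟩
  refine le_of_tendsto (ht.sub_const _).norm ?_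
  filter_upwards [Filter.eventually_ge_atTop j] with i hi using hC i j z hi hz

theorem norm_Glim_le {m n : ℝ} (hm : -1 < m) (hn : -(q : ℝ) < n) {M : ℝ} (hM : 0 ≤ M)
    {p : Pt q × Pt q → ℂ} (hp : IsFlat m n p) :
    ∃ C : ℝ, ∀ x θ : Pt q, θ ≠ 0 →
      ‖Glim p (x, θ)‖ ≤ C * (‖θ‖ ^ (-(q + n + M)) * fd θ ^ (-(2 * (1 + m)))) := by
  obtain ⟨C, hC⟩ := norm_Gc_le hm hn hM hp
  obtain ⟨C', -, hC'⟩ := tendsto_Gc_and_rate hm hn hp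
  exact ⟨C, fun x θ hθ => le_of_tendsto (hC' (x, θ) hθ).1.norm
    (Filter.Eventually.of_forall fun j => hC j (x, θ) hθ)⟩

theorem lt_add_bS {m : ℝ} (hm : -1 < m) (v : Fin (q + 1) ⊕ Fin (q + 1)) : -1 < m + bS v := by
  linarith [bS_nonneg v]

theorem lt_add_gS {n : ℝ} (hn : -(q : ℝ) < n) (v : Fin (q + 1) ⊕ Fin (q + 1)) :
    -(q : ℝ) < n + gS v := by
  linarith [gS_nonneg v]

theorem hasFDerivAt_Glim {m n : ℝ} (hm : -1 < m) (hn : -(q : ℝ) < n)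
    {p : Pt q × Pt q → ℂ} (hp : IsFlat m n p) {z : Pt q × Pt q} (hz : z ∈ punct q) :
    HasFDerivAt (Glim p) (∑ v, dcoord v (Glim (symD v p) z)) z := by
  have hr := fun v => tendsto_Gc_and_rate (lt_add_bS hm v) (lt_add_gS hn v) (hp.symD v)
  choose C hC0 hC using hr
  obtain ⟨_, -, hC'⟩ := tendsto_Gc_and_rate hm hn hp
  refine hasFDerivAt_of_tendstoLocallyUniformlyOn (l := Filter.atTop) (f := fun j => Gc j p)
    (f' := fun j z => ∑ v, dcoord v (Gc j (symD v p) z))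
    (g' := fun z => ∑ v, dcoord v (Glim (symD v p) z)) isOpen_punct ?_
    (fun j y _ => hasFDerivAt_Gc hp.smooth j y) (fun y hy => (hC' y hy).1) hz
  set H : Pt q × Pt q → ℝ := fun y => ∑ v, C v * (‖y.2‖ ^ (-(q + (n + gS v))) *
    fd y.2 ^ (-(2 * (2 + (m + bS v))))) * ‖(dcoord v : ℂ →L[ℝ] Pt q × Pt q →L[ℝ] ℂ)‖
  have hbound : ∀ j, ∀ y ∈ punct q, ‖∑ v, dcoord v (Glim (symD v p) y) -
      ∑ v, dcoord v (Gc j (symD v p) y)‖ ≤ H y * ((2 : ℝ) ^ j)⁻¹ := by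
    intro j y hy
    rw [← Finset.sum_sub_distrib, Finset.sum_mul]
    refine (norm_sum_le _ _).trans (Finset.sum_le_sum fun v _ => ?_)
    have e : dcoord v (Glim (symD v p) y) - dcoord v (Gc j (symD v p) y) =
        dcoord v (Glim (symD v p) y - Gc j (symD v p) y) := (map_sub _ _ _).symm
    rw [e, mul_right_comm]
    refine ((dcoord v).le_opNorm _).trans ?_
    rw [mul_comm]
    exact mul_le_mul_of_nonneg_right ((hC v y hy).2 j) (norm_nonneg _)
  have hHc : ∀ y ∈ punct q, ContinuousAt H y := by
    intro y hy
    refine tendsto_finsetSum _ fun v _ => ?_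
    have h1 : ContinuousAt (fun y : Pt q × Pt q => ‖y.2‖) y := by fun_prop
    have h2 : ContinuousAt (fun y : Pt q × Pt q => fd y.2) y :=
      (continuous_fd.comp continuous_snd).continuousAt
    have h3 := h1.rpow_const (p := -(q + (n + gS v))) (Or.inl (norm_pos_iff.mpr hy).ne')
    have h4 := h2.rpow_const (p := -(2 * (2 + (m + bS v)))) (Or.inl (fd_pos hy).ne')
    exact ((h3.mul h4).const_mul (C v)).mul_const _
  rw [Metric.tendstoLocallyUniformlyOn_iff]
  intro ε hε y hy
  refine ⟨{w | H w < H y + 1} ∩ punct q, ?_, ?_⟩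
  · exact Filter.inter_mem (mem_nhdsWithin_of_mem_nhds
      ((hHc y hy).eventually (gt_mem_nhds (lt_add_one _)))) self_mem_nhdsWithin
  · have h0 : Filter.Tendsto (fun j : ℕ => (|H y| + 1) * ((2 : ℝ) ^ j)⁻¹) Filter.atTop (nhds 0) := by
      have : Filter.Tendsto (fun j : ℕ => ((2 : ℝ) ^ j)⁻¹) Filter.atTop (nhds 0) :=
        tendsto_inv_atTop_zero.comp (tendsto_pow_atTop_atTop_of_one_lt one_lt_two)
      simpa using this.const_mul (|H y| + 1)
    filter_upwards [h0.eventually (gt_mem_nhds hε)] with j hj w hw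
    rw [dist_eq_norm]
    refine (hbound j w hw.2).trans_lt (lt_of_le_of_lt ?_ hj)
    gcongr
    have := hw.1
    simp only [Set.mem_ofPred_eq] at this
    linarith [le_abs_self (H y)]

theorem pdker_Glim {m n : ℝ} (hm : -1 < m) (hn : -(q : ℝ) < n)
    {p : Pt q × Pt q → ℂ} (hp : IsFlat m n p) (v : Fin (q + 1) ⊕ Fin (q + 1)) :
    Set.EqOn (pdker v (Glim p)) (Glim (symD v p)) (punct q) := by
  intro z hz
  rw [pdker_eq, (hasFDerivAt_Glim hm hn hp hz).fderiv]
  rcases v with i | k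
  · simp [bvec, coordForm, basisVec, apply_ite Complex.ofReal]
  · simp [bvec, coordForm, basisVec, apply_ite Complex.ofReal]

theorem contDiffOn_Glim {m n : ℝ} (hm : -1 < m) (hn : -(q : ℝ) < n)
    {p : Pt q × Pt q → ℂ} (hp : IsFlat m n p) : ContDiffOn ℝ ∞ (Glim p) (punct q) := by
  rw [contDiffOn_infty]
  intro k
  induction k generalizing m n p with
  | zero =>
    rw [Nat.cast_zero, contDiffOn_zero]
    exact fun z hz => (hasFDerivAt_Glim hm hn hp hz).continuousAt.continuousWithinAt
  | succ k ih =>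
    rw [Nat.cast_succ, contDiffOn_succ_iff_fderiv_of_isOpen isOpen_punct]
    refine ⟨fun z hz => (hasFDerivAt_Glim hm hn hp hz).differentiableAt.differentiableWithinAt,
      fun h => absurd h (by simp), ?_⟩
    refine ContDiffOn.congr (f := fun z => ∑ v, dcoord v (Glim (symD v p) z)) ?_
      fun z hz => (hasFDerivAt_Glim hm hn hp hz).fderiv
    exact ContDiffOn.sum fun v _ =>
      (dcoord v).contDiff.comp_contDiffOn (ih (lt_add_bS hm v) (lt_add_gS hn v) (hp.symD v))

end trunc

/-! ### Calculus of coordinate derivatives -/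

section calculus

variable {q : ℕ}

theorem eqOn_pdker {S : Set (Pt q × Pt q)} (hS : IsOpen S) {F G : Pt q × Pt q → ℂ}
    (h : Set.EqOn F G S) (v) : Set.EqOn (pdker v F) (pdker v G) S := by
  intro z hz
  rw [pdker_eq, pdker_eq, Filter.EventuallyEq.fderiv_eq (h.eventuallyEq_of_mem (hS.mem_nhds hz))]

theorem pdker_add {F G : Pt q × Pt q → ℂ} {z : Pt q × Pt q} (hF : DifferentiableAt ℝ F z)
    (hG : DifferentiableAt ℝ G z) (v) :
    pdker v (fun z => F z + G z) z = pdker v F z + pdker v G z := by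
  rw [pdker_eq, pdker_eq, pdker_eq, fderiv_fun_add hF hG]
  rfl

theorem pdker_sum {ι : Type*} {s : Finset ι} {F : ι → Pt q × Pt q → ℂ} {z : Pt q × Pt q}
    (hF : ∀ i ∈ s, DifferentiableAt ℝ (F i) z) (v) :
    pdker v (fun z => ∑ i ∈ s, F i z) z = ∑ i ∈ s, pdker v (F i) z := by
  simp only [pdker_eq]
  rw [fderiv_fun_sum hF, sum_apply]

theorem pdker_mul {F G : Pt q × Pt q → ℂ} {z : Pt q × Pt q} (hF : DifferentiableAt ℝ F z)
    (hG : DifferentiableAt ℝ G z) (v) :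
    pdker v (fun z => F z * G z) z = pdker v F z * G z + F z * pdker v G z := by
  rw [pdker_eq, pdker_eq, pdker_eq, fderiv_fun_mul hF hG]
  simp only [add_apply, smul_apply, smul_eq_mul]
  ring

theorem contDiffOn_pdker {S : Set (Pt q × Pt q)} (hS : IsOpen S) {F : Pt q × Pt q → ℂ}
    (hF : ContDiffOn ℝ ∞ F S) (v) : ContDiffOn ℝ ∞ (pdker v F) S := by
  have : pdker v F = fun z => fderiv ℝ F z (bvec v) := funext (pdker_eq v F)
  rw [this]
  exact (hF.fderiv_of_isOpen hS (m := ∞) (by simp)).clm_apply contDiffOn_const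

theorem differentiableAt_of_contDiffOn {S : Set (Pt q × Pt q)} (hS : IsOpen S)
    {F : Pt q × Pt q → ℂ} (hF : ContDiffOn ℝ ∞ F S) {z} (hz : z ∈ S) : DifferentiableAt ℝ F z :=
  (hF.contDiffAt (hS.mem_nhds hz)).differentiableAt (by simp)

end calculus

/-! ### Kernels of type `(a, b)` -/

section kernels

variable {q : ℕ}

/-- `F(x, θ)` is dominated by `‖θ‖^{-a} fd(θ)^{-2b}` for `‖θ‖ ≤ 1` and decays rapidly in `θ`. -/
structure Dom (a b : ℝ) (F : Pt q × Pt q → ℂ) : Prop where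
  near : ∃ C : ℝ, ∀ x θ : Pt q, θ ≠ 0 → ‖θ‖ ≤ 1 →
    ‖F (x, θ)‖ ≤ C * (‖θ‖ ^ (-a) * fd θ ^ (-(2 * b)))
  far : ∀ L : ℕ, ∃ C : ℝ, ∀ x θ : Pt q, 1 ≤ ‖θ‖ → ‖F (x, θ)‖ ≤ C * (‖θ‖ ^ L)⁻¹

/-- `(a, b)` may be replaced by `(a + s, b + t)` near `θ = 0`. -/
def Move (q : ℕ) (s t : ℝ) : Prop :=
  ∃ C : ℝ, ∀ θ : Pt q, θ ≠ 0 → ‖θ‖ ≤ 1 → ‖θ‖ ^ s * fd θ ^ (2 * t) ≤ C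

theorem fd_le_two_sqrt {θ : Pt q} (h : ‖θ‖ ≤ 1) : fd θ ≤ 2 * √‖θ‖ := by
  have h1 : ‖θ‖ ≤ √‖θ‖ := Real.le_sqrt_of_sq_le (by nlinarith [norm_nonneg θ])
  have h2 : √|θ (Fin.last q)| ≤ √‖θ‖ := Real.sqrt_le_sqrt (abs_coord_le_norm θ _)
  unfold fd
  linarith

theorem fd_le_two {θ : Pt q} (h : ‖θ‖ ≤ 1) : fd θ ≤ 2 :=
  (fd_le_two_sqrt h).trans (by
    have : √‖θ‖ ≤ 1 := Real.sqrt_le_one.mpr h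
    linarith)

theorem move_zero : Move q 0 0 := ⟨1, fun θ _ _ => by simp⟩

theorem move_one_zero : Move q 1 0 := ⟨1, fun θ _ h => by simpa using h⟩

theorem move_zero_one : Move q 0 1 := ⟨4, fun θ h0 h => by
  have h1 := fd_le_two h
  have h2 := fd_pos h0
  rw [Real.rpow_zero, one_mul, mul_one, Real.rpow_two]
  nlinarith⟩

theorem move_two_neg_one : Move q 2 (-1) := ⟨1, fun θ h0 _ => by
  have h1 := norm_le_fd θ
  have h2 := fd_pos h0
  rw [mul_neg_one, Real.rpow_neg h2.le, Real.rpow_two, Real.rpow_two, ← div_eq_mul_inv,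
    div_le_one (by positivity)]
  gcongr⟩

theorem move_neg_one_one : Move q (-1) 1 := ⟨4, fun θ h0 h => by
  have h1 := fd_le_two_sqrt h
  have h2 := fd_pos h0
  have h3 := norm_pos_iff.mpr h0
  rw [mul_one, Real.rpow_two, Real.rpow_neg_one, inv_mul_le_iff₀ h3]
  have h4 := Real.sq_sqrt h3.le
  nlinarith [Real.sqrt_nonneg ‖θ‖]⟩

theorem move_gS_bS (v : Fin (q + 1) ⊕ Fin (q + 1)) : Move q (gS v) (bS v) := by
  rcases v with i | k
  · exact move_zero
  · simp only [gS, bS]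
    split_ifs
    · exact move_zero_one
    · exact move_one_zero

theorem Dom.move {a b s t : ℝ} {F : Pt q × Pt q → ℂ} (hm : Move q s t) (h : Dom a b F) :
    Dom (a + s) (b + t) F := by
  refine ⟨?_, h.far⟩
  obtain ⟨C, hC⟩ := h.near
  obtain ⟨c, hc⟩ := hm
  refine ⟨|C| * c, fun x θ h0 h1 => (hC x θ h0 h1).trans ?_⟩
  have p1 := norm_pos_iff.mpr h0
  have p2 := fd_pos h0
  have e : ‖θ‖ ^ (-a) * fd θ ^ (-(2 * b)) =
      ‖θ‖ ^ s * fd θ ^ (2 * t) * (‖θ‖ ^ (-(a + s)) * fd θ ^ (-(2 * (b + t)))) := by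
    rw [mul_mul_mul_comm, ← Real.rpow_add p1, ← Real.rpow_add p2]
    congr 2 <;> ring
  rw [e, mul_assoc |C|]
  have := hc θ h0 h1
  have p3 : 0 ≤ c := le_trans (by positivity) this
  gcongr
  exact le_abs_self C

theorem Dom.congr {a b : ℝ} {F G : Pt q × Pt q → ℂ} (hFG : Set.EqOn F G (punct q))
    (h : Dom a b F) : Dom a b G := by
  refine ⟨?_, fun L => ?_⟩
  · obtain ⟨C, hC⟩ := h.near
    exact ⟨C, fun x θ h0 h1 => by rw [← hFG (show (x, θ) ∈ punct q from h0)]; exact hC x θ h0 h1⟩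
  · obtain ⟨C, hC⟩ := h.far L
    refine ⟨C, fun x θ h1 => ?_⟩
    have h0 : (x, θ) ∈ punct q := norm_pos_iff.mp (one_pos.trans_le h1)
    rw [← hFG h0]
    exact hC x θ h1

theorem Dom.add {a b : ℝ} {F G : Pt q × Pt q → ℂ} (hF : Dom a b F) (hG : Dom a b G) :
    Dom a b (fun z => F z + G z) := by
  refine ⟨?_, fun L => ?_⟩
  · obtain ⟨C, hC⟩ := hF.near
    obtain ⟨D, hD⟩ := hG.near
    refine ⟨C + D, fun x θ h0 h1 => (norm_add_le _ _).trans ?_⟩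
    rw [add_mul]
    exact add_le_add (hC x θ h0 h1) (hD x θ h0 h1)
  · obtain ⟨C, hC⟩ := hF.far L
    obtain ⟨D, hD⟩ := hG.far L
    refine ⟨C + D, fun x θ h1 => (norm_add_le _ _).trans ?_⟩
    rw [add_mul]
    exact add_le_add (hC x θ h1) (hD x θ h1)

/-- Multiplication by a function that is `O(‖θ‖^s)` near `θ = 0`, of polynomial growth. -/
theorem Dom.mul {a b s : ℝ} {h F : Pt q × Pt q → ℂ} {C : ℝ} {L : ℕ}
    (hh : ∀ x θ : Pt q, θ ≠ 0 → ‖h (x, θ)‖ ≤ C * (‖θ‖ ^ s * (1 + ‖θ‖) ^ L)) (hs : s ≤ 1)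
    (hF : Dom a b F) : Dom (a - s) b (fun z => h z * F z) := by
  refine ⟨?_, fun K => ?_⟩
  · obtain ⟨D, hD⟩ := hF.near
    refine ⟨|C| * 2 ^ L * |D|, fun x θ h0 h1 => ?_⟩
    have p1 := norm_pos_iff.mpr h0
    have p2 := fd_pos h0
    rw [norm_mul]
    refine (mul_le_mul (hh x θ h0) (hD x θ h0 h1) (norm_nonneg _)
      (le_trans (norm_nonneg _) (hh x θ h0))).trans ?_
    have e : ‖θ‖ ^ (-(a - s)) = ‖θ‖ ^ s * ‖θ‖ ^ (-a) := by
      rw [← Real.rpow_add p1]; congr 1; ring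
    rw [e]
    calc C * (‖θ‖ ^ s * (1 + ‖θ‖) ^ L) * (D * (‖θ‖ ^ (-a) * fd θ ^ (-(2 * b))))
        ≤ |C * (‖θ‖ ^ s * (1 + ‖θ‖) ^ L) * (D * (‖θ‖ ^ (-a) * fd θ ^ (-(2 * b))))| := le_abs_self _
      _ = |C| * (1 + ‖θ‖) ^ L * |D| * (‖θ‖ ^ s * ‖θ‖ ^ (-a) * fd θ ^ (-(2 * b))) := by
          have q1 : 0 < ‖θ‖ ^ s * (1 + ‖θ‖) ^ L := by positivity
          have q2 : 0 < ‖θ‖ ^ (-a) * fd θ ^ (-(2 * b)) := by positivity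
          rw [abs_mul, abs_mul C, abs_mul D, abs_of_pos q1, abs_of_pos q2]
          ring
      _ ≤ _ := by
          gcongr
          linarith
  · obtain ⟨D, hD⟩ := hF.far (K + 1 + L)
    refine ⟨|C| * 2 ^ L * |D|, fun x θ h1 => ?_⟩
    have p1 : 0 < ‖θ‖ := one_pos.trans_le h1
    have h0 := norm_pos_iff.mp p1
    rw [norm_mul]
    refine (mul_le_mul (hh x θ h0) (hD x θ h1) (norm_nonneg _)
      (le_trans (norm_nonneg _) (hh x θ h0))).trans ?_
    have e1 : ‖θ‖ ^ s ≤ ‖θ‖ := (Real.rpow_le_rpow_of_exponent_le h1 hs).trans_eq (Real.rpow_one _)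
    calc C * (‖θ‖ ^ s * (1 + ‖θ‖) ^ L) * (D * (‖θ‖ ^ (K + 1 + L))⁻¹)
        ≤ |C * (‖θ‖ ^ s * (1 + ‖θ‖) ^ L) * (D * (‖θ‖ ^ (K + 1 + L))⁻¹)| := le_abs_self _
      _ = |C| * (‖θ‖ ^ s * (1 + ‖θ‖) ^ L) * (|D| * (‖θ‖ ^ (K + 1 + L))⁻¹) := by
          have q1 : 0 < ‖θ‖ ^ s * (1 + ‖θ‖) ^ L := by positivity
          have q2 : 0 < (‖θ‖ ^ (K + 1 + L))⁻¹ := by positivity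
          rw [abs_mul, abs_mul C, abs_mul D, abs_of_pos q1, abs_of_pos q2]
      _ ≤ |C| * (‖θ‖ * (2 * ‖θ‖) ^ L) * (|D| * (‖θ‖ ^ (K + 1 + L))⁻¹) := by
          gcongr
          linarith
      _ = _ := by
          field_simp
          ring

/-- `F` is smooth for `θ ≠ 0`, of type `(a, b)`, and its derivatives of order at most `n` in `θ` are
of type `(a + 1, b)` (good directions) and `(a, b + 1)` (last direction). -/
def KB : ℕ → ℝ → ℝ → (Pt q × Pt q → ℂ) → Prop
  | 0, a, b, F => Dom a b F
  | n + 1, a, b, F => Dom a b F ∧ ∀ v, KB n (a + gS v) (b + bS v) (pdker v F)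

theorem KB.dom {n : ℕ} {a b : ℝ} {F : Pt q × Pt q → ℂ} (h : KB n a b F) : Dom a b F := by
  cases n with
  | zero => exact h
  | succ n => exact h.1

theorem KB.of_succ {n : ℕ} {a b : ℝ} {F : Pt q × Pt q → ℂ} (h : KB (n + 1) a b F) : KB n a b F := by
  induction n generalizing a b F with
  | zero => exact h.1
  | succ n ih => exact ⟨h.1, fun v => ih (h.2 v)⟩

theorem KB.move {n : ℕ} {a b s t : ℝ} {F : Pt q × Pt q → ℂ} (hm : Move q s t) (h : KB n a b F) :
    KB n (a + s) (b + t) F := by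
  induction n generalizing a b F with
  | zero => exact Dom.move hm h
  | succ n ih =>
    refine ⟨h.1.move hm, fun v => ?_⟩
    rw [add_right_comm a, add_right_comm b]
    exact ih (h.2 v)

theorem KB.congr {n : ℕ} {a b : ℝ} {F G : Pt q × Pt q → ℂ} (hFG : Set.EqOn F G (punct q))
    (h : KB n a b F) : KB n a b G := by
  induction n generalizing a b F G with
  | zero => exact Dom.congr hFG h
  | succ n ih => exact ⟨h.1.congr hFG, fun v => ih (eqOn_pdker isOpen_punct hFG v) (h.2 v)⟩

theorem KB.add {n : ℕ} {a b : ℝ} {F G : Pt q × Pt q → ℂ} (sF : ContDiffOn ℝ ∞ F (punct q))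
    (sG : ContDiffOn ℝ ∞ G (punct q)) (hF : KB n a b F) (hG : KB n a b G) :
    KB n a b (fun z => F z + G z) := by
  induction n generalizing a b F G with
  | zero => exact Dom.add hF hG
  | succ n ih =>
    refine ⟨hF.1.add hG.1, fun v => ?_⟩
    refine KB.congr (fun z hz => ?_) (ih (contDiffOn_pdker isOpen_punct sF v)
      (contDiffOn_pdker isOpen_punct sG v) (hF.2 v) (hG.2 v))
    exact (pdker_add (differentiableAt_of_contDiffOn isOpen_punct sF hz)
      (differentiableAt_of_contDiffOn isOpen_punct sG hz) v).symm

/-- Bounds of polynomial growth in `θ` for the derivatives of order at most `n`. -/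
def PB : ℕ → (Pt q × Pt q → ℂ) → Prop
  | 0, h => ∃ (C : ℝ) (L : ℕ), ∀ x θ : Pt q, ‖h (x, θ)‖ ≤ C * (1 + ‖θ‖) ^ L
  | n + 1, h => (∃ (C : ℝ) (L : ℕ), ∀ x θ : Pt q, ‖h (x, θ)‖ ≤ C * (1 + ‖θ‖) ^ L) ∧
      ∀ v, PB n (pdker v h)

/-- Bounds of polynomial growth for the derivatives of order at most `n`, with the factor `‖θ‖` for
the derivatives in `x`. -/
def PBV : ℕ → (Pt q × Pt q → ℂ) → Prop
  | 0, h => ∃ (C : ℝ) (L : ℕ), ∀ x θ : Pt q, ‖h (x, θ)‖ ≤ C * (‖θ‖ * (1 + ‖θ‖) ^ L)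
  | n + 1, h => (∃ (C : ℝ) (L : ℕ), ∀ x θ : Pt q, ‖h (x, θ)‖ ≤ C * (‖θ‖ * (1 + ‖θ‖) ^ L)) ∧
      (∀ i, PBV n (pdFst i h)) ∧ ∀ k, PB n (pdSnd k h)

theorem PB.bound {n : ℕ} {h : Pt q × Pt q → ℂ} (H : PB n h) :
    ∃ (C : ℝ) (L : ℕ), ∀ x θ : Pt q, ‖h (x, θ)‖ ≤ C * (1 + ‖θ‖) ^ L := by
  cases n with
  | zero => exact H
  | succ n => exact H.1

theorem PB.of_succ {n : ℕ} {h : Pt q × Pt q → ℂ} (H : PB (n + 1) h) : PB n h := by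
  induction n generalizing h with
  | zero => exact H.1
  | succ n ih => exact ⟨H.1, fun v => ih (H.2 v)⟩

theorem PB.dom_mul {n k : ℕ} {a b : ℝ} {h F : Pt q × Pt q → ℂ} (H : PB n h) (hF : KB k a b F) :
    Dom a b (fun z => h z * F z) := by
  obtain ⟨C, L, hC⟩ := H.bound
  have := Dom.mul (s := 0) (fun x θ _ => by simpa using hC x θ) zero_le_one hF.dom
  simpa using this

theorem PB.mul_KB {n : ℕ} {a b : ℝ} {h F : Pt q × Pt q → ℂ} (sh : ContDiff ℝ ∞ h)
    (sF : ContDiffOn ℝ ∞ F (punct q)) (H : PB n h) (hF : KB n a b F) :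
    KB n a b (fun z => h z * F z) := by
  induction n generalizing a b h F with
  | zero => exact H.dom_mul hF
  | succ n ih =>
    refine ⟨H.dom_mul hF, fun v => ?_⟩
    have sF' := contDiffOn_pdker isOpen_punct sF v
    have sh' := contDiff_pdker sh v
    refine KB.congr (fun z hz => ?_) (KB.add (sh'.contDiffOn.mul sF) (sh.contDiffOn.mul sF')
      (ih sh' sF (H.2 v) (hF.of_succ.move (move_gS_bS v))) (ih sh sF' H.of_succ (hF.2 v)))
    exact (pdker_mul (sh.differentiable (by simp) z)
      (differentiableAt_of_contDiffOn isOpen_punct sF hz) v).symm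

theorem PBV.dom_mul {n k : ℕ} {a b : ℝ} {h F : Pt q × Pt q → ℂ} (H : PBV n h) (hF : KB k a b F) :
    Dom (a - 1) b (fun z => h z * F z) := by
  obtain ⟨C, L, hC⟩ : ∃ (C : ℝ) (L : ℕ), ∀ x θ : Pt q, ‖h (x, θ)‖ ≤ C * (‖θ‖ * (1 + ‖θ‖) ^ L) := by
    cases n with
    | zero => exact H
    | succ n => exact H.1
  exact Dom.mul (s := 1) (fun x θ _ => by simpa using hC x θ) le_rfl hF.dom

theorem PBV.of_succ {n : ℕ} {h : Pt q × Pt q → ℂ} (H : PBV (n + 1) h) : PBV n h := by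
  induction n generalizing h with
  | zero => exact H.1
  | succ n ih => exact ⟨H.1, fun i => ih (H.2.1 i), fun k => (H.2.2 k).of_succ⟩

theorem PBV.mul_KB {n : ℕ} {a b : ℝ} {h F : Pt q × Pt q → ℂ} (sh : ContDiff ℝ ∞ h)
    (sF : ContDiffOn ℝ ∞ F (punct q)) (H : PBV n h) (hF : KB n a b F) :
    KB n (a - 1) b (fun z => h z * F z) := by
  induction n generalizing a b h F with
  | zero => exact H.dom_mul hF
  | succ n ih =>
    refine ⟨H.dom_mul hF, fun v => ?_⟩
    have sF' := contDiffOn_pdker isOpen_punct sF v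
    have sh' := contDiff_pdker sh v
    have h2 : KB n (a - 1 + gS v) (b + bS v) (fun z => h z * pdker v F z) := by
      have := ih sh sF' H.of_succ (hF.2 v)
      rwa [add_sub_right_comm] at this
    have h1 : KB n (a - 1 + gS v) (b + bS v) (fun z => pdker v h z * F z) := by
      rcases v with i | k
      · simpa [gS, bS] using ih sh' sF (H.2.1 i) hF.of_succ
      · have h3 : KB n a b (fun z => pdSnd k h z * F z) :=
          PB.mul_KB (contDiff_pdSnd sh k) sF (H.2.2 k) hF.of_succ
        change KB n a b (fun z => pdker (Sum.inr k) h z * F z) at h3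
        simp only [gS, bS]
        split_ifs
        · simpa [sub_eq_add_neg] using h3.move move_neg_one_one
        · simpa using h3
    refine KB.congr (fun z hz => ?_) (KB.add (sh'.contDiffOn.mul sF) (sh.contDiffOn.mul sF') h1 h2)
    exact (pdker_mul (sh.differentiable (by simp) z)
      (differentiableAt_of_contDiffOn isOpen_punct sF hz) v).symm

theorem PB.bound_add {n k : ℕ} {g h : Pt q × Pt q → ℂ} (G : PB n g) (H : PB k h) :
    ∃ (C : ℝ) (L : ℕ), ∀ x θ : Pt q, ‖g (x, θ) + h (x, θ)‖ ≤ C * (1 + ‖θ‖) ^ L := by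
  obtain ⟨C, L, hC⟩ := G.bound
  obtain ⟨D, K, hD⟩ := H.bound
  refine ⟨|C| + |D|, L + K, fun x θ => (norm_add_le _ _).trans ?_⟩
  rw [add_mul]
  have h1 : 1 ≤ 1 + ‖θ‖ := le_add_of_nonneg_right (norm_nonneg _)
  refine add_le_add ((hC x θ).trans ?_) ((hD x θ).trans ?_)
  · exact mul_le_mul (le_abs_self C) (pow_le_pow_right₀ h1 (by omega)) (by positivity)
      (abs_nonneg C)
  · exact mul_le_mul (le_abs_self D) (pow_le_pow_right₀ h1 (by omega)) (by positivity)
      (abs_nonneg D)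

theorem PB.add {n : ℕ} {g h : Pt q × Pt q → ℂ} (sg : ContDiff ℝ ∞ g) (sh : ContDiff ℝ ∞ h)
    (G : PB n g) (H : PB n h) : PB n (fun z => g z + h z) := by
  induction n generalizing g h with
  | zero => exact G.bound_add H
  | succ n ih =>
    refine ⟨G.bound_add H, fun v => ?_⟩
    rw [funext fun z => pdker_add (sg.differentiable (by simp) z) (sh.differentiable (by simp) z) v]
    exact ih (contDiff_pdker sg v) (contDiff_pdker sh v) (G.2 v) (H.2 v)

theorem PB.bound_mul {n k : ℕ} {g h : Pt q × Pt q → ℂ} (G : PB n g) (H : PB k h) :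
    ∃ (C : ℝ) (L : ℕ), ∀ x θ : Pt q, ‖g (x, θ) * h (x, θ)‖ ≤ C * (1 + ‖θ‖) ^ L := by
  obtain ⟨C, L, hC⟩ := G.bound
  obtain ⟨D, K, hD⟩ := H.bound
  refine ⟨C * D, L + K, fun x θ => ?_⟩
  rw [norm_mul, pow_add, mul_mul_mul_comm]
  exact mul_le_mul (hC x θ) (hD x θ) (norm_nonneg _) ((norm_nonneg _).trans (hC x θ))

theorem PB.mul {n : ℕ} {g h : Pt q × Pt q → ℂ} (sg : ContDiff ℝ ∞ g) (sh : ContDiff ℝ ∞ h)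
    (G : PB n g) (H : PB n h) : PB n (fun z => g z * h z) := by
  induction n generalizing g h with
  | zero => exact G.bound_mul H
  | succ n ih =>
    refine ⟨G.bound_mul H, fun v => ?_⟩
    rw [funext fun z => pdker_mul (sg.differentiable (by simp) z) (sh.differentiable (by simp) z) v]
    exact PB.add ((contDiff_pdker sg v).mul sh) (sg.mul (contDiff_pdker sh v))
      (ih (contDiff_pdker sg v) sh (G.2 v) H.of_succ)
      (ih sg (contDiff_pdker sh v) G.of_succ (H.2 v))

theorem pdker_const (c : ℂ) (v : Fin (q + 1) ⊕ Fin (q + 1)) : pdker v (fun _ => c) = fun _ => 0 := by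
  funext z
  rw [pdker_eq, fderiv_fun_const]
  rfl

theorem PB_const (n : ℕ) (c : ℂ) : PB n (fun _ : Pt q × Pt q => c) := by
  have h : ∃ (C : ℝ) (L : ℕ), ∀ x θ : Pt q, ‖c‖ ≤ C * (1 + ‖θ‖) ^ L := ⟨‖c‖, 0, by simp⟩
  induction n generalizing c with
  | zero => exact h
  | succ n ih =>
    refine ⟨h, fun v => ?_⟩
    rw [pdker_const]
    exact ih 0 ⟨0, 0, by simp⟩

theorem PB.norm_le_of_vanish {n : ℕ} {h : Pt q × Pt q → ℂ} (sh : ContDiff ℝ ∞ h)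
    (H : PB (n + 1) h) (h0 : ∀ x, h (x, 0) = 0) :
    ∃ (C : ℝ) (L : ℕ), ∀ x θ : Pt q, ‖h (x, θ)‖ ≤ C * (‖θ‖ * (1 + ‖θ‖) ^ L) := by
  choose C L hC using fun k : Fin (q + 1) => (H.2 (Sum.inr k)).bound
  refine ⟨∑ k, |C k|, ∑ k, L k, fun x θ => ?_⟩
  have hd : ∀ t ∈ Set.Icc (0 : ℝ) 1, HasDerivWithinAt (fun t : ℝ => h (x, t • θ))
      (fderiv ℝ h (x, t • θ) (0, θ)) (Set.Icc 0 1) t := by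
    intro t _
    have e1 : HasDerivAt (fun t : ℝ => (x, t • θ)) ((0 : Pt q), θ) t := by
      have := (hasDerivAt_id t).smul_const θ
      rw [one_smul] at this
      exact (hasDerivAt_const t x).prodMk this
    exact ((sh.differentiable (by simp) (x, t • θ)).hasFDerivAt.comp_hasDerivAt t
      e1).hasDerivWithinAt
  have hb : ∀ t ∈ Set.Ico (0 : ℝ) 1, ‖fderiv ℝ h (x, t • θ) (0, θ)‖ ≤
      (∑ k, |C k|) * (‖θ‖ * (1 + ‖θ‖) ^ ∑ k, L k) := by
    intro t ht
    rw [fderiv_apply_pair, Finset.sum_mul]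
    simp only [PiLp.zero_apply, Complex.ofReal_zero, zero_mul, Finset.sum_const_zero, zero_add]
    refine (norm_sum_le _ _).trans (Finset.sum_le_sum fun k _ => ?_)
    rw [norm_mul, Complex.norm_real, Real.norm_eq_abs]
    have h1 : 1 ≤ 1 + ‖θ‖ := le_add_of_nonneg_right (norm_nonneg _)
    have h2 : ‖t • θ‖ ≤ ‖θ‖ := by
      rw [norm_smul, Real.norm_of_nonneg ht.1]
      exact mul_le_of_le_one_left (norm_nonneg _) ht.2.le
    have h3 : ‖pdSnd k h (x, t • θ)‖ ≤ |C k| * (1 + ‖θ‖) ^ ∑ k, L k := by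
      refine (hC k x (t • θ)).trans ?_
      refine mul_le_mul (le_abs_self _) ?_ (by positivity) (abs_nonneg _)
      refine (pow_le_pow_left₀ (by positivity) (by linarith) _).trans
        (pow_le_pow_right₀ h1 (Finset.single_le_sum (f := L) (fun _ _ => Nat.zero_le _)
          (Finset.mem_univ k)))
    calc |θ k| * ‖pdSnd k h (x, t • θ)‖ ≤ ‖θ‖ * (|C k| * (1 + ‖θ‖) ^ ∑ k, L k) :=
          mul_le_mul (abs_coord_le_norm θ k) h3 (norm_nonneg _) (norm_nonneg _)
      _ = _ := by ring
  have := norm_image_sub_le_of_norm_deriv_le_segment_01' hd hb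
  simpa [h0] using this

theorem PB.vanish {n : ℕ} {h : Pt q × Pt q → ℂ} (sh : ContDiff ℝ ∞ h) (H : PB (n + 1) h)
    (h0 : ∀ x, h (x, 0) = 0) : PBV n h := by
  induction n generalizing h with
  | zero => exact H.norm_le_of_vanish sh h0
  | succ n ih =>
    refine ⟨H.norm_le_of_vanish sh h0, fun i => ih (contDiff_pdFst sh i) (H.2 (Sum.inl i)) ?_,
      fun k => (H.2 (Sum.inr k)).of_succ⟩
    intro x
    have e1 : HasFDerivAt (fun x : Pt q => (x, (0 : Pt q)))
        ((ContinuousLinearMap.id ℝ (Pt q)).prod 0) x :=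
      (hasFDerivAt_id x).prodMk (hasFDerivAt_const 0 x)
    have e2 := HasFDerivAt.comp x (sh.differentiable (by simp) (x, 0)).hasFDerivAt e1
    have e3 : (h ∘ fun x : Pt q => (x, (0 : Pt q))) = fun _ => 0 := funext h0
    rw [e3] at e2
    have := DFunLike.congr_fun (e2.unique (hasFDerivAt_const 0 x)) (basisVec i)
    simpa [pdFst] using this

/-- Smooth multipliers, all derivatives of polynomial growth in `θ`. -/
structure Mult (h : Pt q × Pt q → ℂ) : Prop where
  smooth : ContDiff ℝ ∞ h
  bound : ∀ n, PB n h

/-- Smooth kernels of type `(a, b)`. -/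
structure Ker (a b : ℝ) (F : Pt q × Pt q → ℂ) : Prop where
  smooth : ContDiffOn ℝ ∞ F (punct q)
  bound : ∀ n, KB n a b F

theorem Mult.add {g h : Pt q × Pt q → ℂ} (G : Mult g) (H : Mult h) : Mult (fun z => g z + h z) :=
  ⟨G.1.add H.1, fun n => (G.2 n).add G.1 H.1 (H.2 n)⟩

theorem Mult.mul {g h : Pt q × Pt q → ℂ} (G : Mult g) (H : Mult h) : Mult (fun z => g z * h z) :=
  ⟨G.1.mul H.1, fun n => (G.2 n).mul G.1 H.1 (H.2 n)⟩

theorem Mult_const (c : ℂ) : Mult (fun _ : Pt q × Pt q => c) := ⟨contDiff_const, fun n => PB_const n c⟩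

theorem Mult_sum {ι : Type*} {s : Finset ι} {h : ι → Pt q × Pt q → ℂ} (H : ∀ i ∈ s, Mult (h i)) :
    Mult (fun z => ∑ i ∈ s, h i z) := by
  classical
  induction s using Finset.induction_on with
  | empty => simpa using Mult_const 0
  | insert i s hi ih =>
    simp only [Finset.sum_insert hi]
    exact (H i (Finset.mem_insert_self i s)).add
      (ih fun j hj => H j (Finset.mem_insert_of_mem hj))

theorem Mult_coord_snd (k : Fin (q + 1)) : Mult (fun z : Pt q × Pt q => ((z.2 k : ℝ) : ℂ)) := by
  have e : ∀ z, HasFDerivAt (fun z : Pt q × Pt q => ((z.2 k : ℝ) : ℂ))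
      (Complex.ofRealCLM.comp (coordForm (Sum.inr k))) z := fun z =>
    (Complex.ofRealCLM.comp (coordForm (Sum.inr k))).hasFDerivAt
  have h : ∃ (C : ℝ) (L : ℕ), ∀ x θ : Pt q, ‖((θ k : ℝ) : ℂ)‖ ≤ C * (1 + ‖θ‖) ^ L := by
    refine ⟨1, 1, fun x θ => ?_⟩
    rw [Complex.norm_real, Real.norm_eq_abs, one_mul, pow_one]
    exact (abs_coord_le_norm θ k).trans (by linarith)
  refine ⟨(Complex.ofRealCLM.comp (coordForm (Sum.inr k))).contDiff, fun n => ?_⟩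
  cases n with
  | zero => exact h
  | succ n =>
    refine ⟨h, fun v => ?_⟩
    have : pdker v (fun z : Pt q × Pt q => ((z.2 k : ℝ) : ℂ)) =
        fun _ => ((coordForm (Sum.inr k) (bvec v) : ℝ) : ℂ) := by
      funext z
      rw [pdker_eq, (e z).fderiv]
      rfl
    rw [this]
    exact PB_const n _

theorem Ker.add {a b : ℝ} {F G : Pt q × Pt q → ℂ} (hF : Ker a b F) (hG : Ker a b G) :
    Ker a b (fun z => F z + G z) :=
  ⟨hF.1.add hG.1, fun n => (hF.2 n).add hF.1 hG.1 (hG.2 n)⟩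

theorem Ker_zero (a b : ℝ) : Ker a b (fun _ : Pt q × Pt q => 0) := by
  refine ⟨contDiffOn_const, fun n => ?_⟩
  have h : ∀ a b, Dom a b (fun _ : Pt q × Pt q => 0) := fun a b =>
    ⟨⟨0, by simp⟩, fun L => ⟨0, by simp⟩⟩
  induction n generalizing a b with
  | zero => exact h a b
  | succ n ih =>
    refine ⟨h a b, fun v => ?_⟩
    rw [pdker_const]
    exact ih _ _

theorem Ker_sum {ι : Type*} {s : Finset ι} {a b : ℝ} {F : ι → Pt q × Pt q → ℂ}
    (H : ∀ i ∈ s, Ker a b (F i)) : Ker a b (fun z => ∑ i ∈ s, F i z) := by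
  classical
  induction s using Finset.induction_on with
  | empty => simpa using Ker_zero a b
  | insert i s hi ih =>
    simp only [Finset.sum_insert hi]
    exact (H i (Finset.mem_insert_self i s)).add
      (ih fun j hj => H j (Finset.mem_insert_of_mem hj))

theorem Ker.pdker {a b : ℝ} {F : Pt q × Pt q → ℂ} (h : Ker a b F) (v) :
    Ker (a + gS v) (b + bS v) (pdker v F) :=
  ⟨contDiffOn_pdker isOpen_punct h.1 v, fun n => (h.2 (n + 1)).2 v⟩

theorem Ker.move {a b s t : ℝ} {F : Pt q × Pt q → ℂ} (h : Ker a b F) (hm : Move q s t) :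
    Ker (a + s) (b + t) F := ⟨h.1, fun n => (h.2 n).move hm⟩

theorem Mult.mul_Ker {a b : ℝ} {h F : Pt q × Pt q → ℂ} (H : Mult h) (hF : Ker a b F) :
    Ker a b (fun z => h z * F z) :=
  ⟨H.1.contDiffOn.mul hF.1, fun n => (H.2 n).mul_KB H.1 hF.1 (hF.2 n)⟩

theorem Mult.vanish_mul_Ker {a b : ℝ} {h F : Pt q × Pt q → ℂ} (H : Mult h)
    (h0 : ∀ x, h (x, 0) = 0) (hF : Ker a b F) : Ker (a - 1) b (fun z => h z * F z) :=
  ⟨H.1.contDiffOn.mul hF.1, fun n =>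
    ((H.2 (n + 1)).vanish H.1 h0).mul_KB H.1 hF.1 (hF.2 n)⟩

theorem Ker_Glim {m n : ℝ} (hm : -1 < m) (hn : -(q : ℝ) < n) {p : Pt q × Pt q → ℂ}
    (hp : IsFlat m n p) : Ker (q + n) (1 + m) (Glim p) := by
  refine ⟨contDiffOn_Glim hm hn hp, fun k => ?_⟩
  have hdom : ∀ {m n : ℝ}, -1 < m → -(q : ℝ) < n → ∀ {p : Pt q × Pt q → ℂ}, IsFlat m n p →
      Dom (q + n) (1 + m) (Glim p) := by
    intro m n hm hn p hp
    refine ⟨?_, fun L => ?_⟩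
    · obtain ⟨C, hC⟩ := norm_Glim_le hm hn le_rfl hp
      exact ⟨C, fun x θ h0 _ => by simpa using hC x θ h0⟩
    · obtain ⟨C, hC⟩ := norm_Glim_le hm hn (Nat.cast_nonneg L) hp
      refine ⟨|C|, fun x θ h1 => ?_⟩
      have p1 : 0 < ‖θ‖ := one_pos.trans_le h1
      refine (hC x θ (norm_pos_iff.mp p1)).trans ?_
      have e1 : fd θ ^ (-(2 * (1 + m))) ≤ 1 :=
        Real.rpow_le_one_of_one_le_of_nonpos (h1.trans (norm_le_fd θ)) (by linarith)
      have e2 : ‖θ‖ ^ (-(q + n + L)) ≤ (‖θ‖ ^ L)⁻¹ := by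
        rw [← Real.rpow_natCast, ← Real.rpow_neg p1.le]
        exact Real.rpow_le_rpow_of_exponent_le h1 (by linarith)
      have p2 : 0 ≤ fd θ := p1.le.trans (norm_le_fd θ)
      calc _ ≤ |C| * ((‖θ‖ ^ L)⁻¹ * 1) := by
            gcongr
            exact le_abs_self C
        _ = _ := by rw [mul_one]
  induction k generalizing m n p with
  | zero => exact hdom hm hn hp
  | succ k ih =>
    refine ⟨hdom hm hn hp, fun v => ?_⟩
    have := ih (lt_add_bS hm v) (lt_add_gS hn v) (hp.symD v)
    rw [← add_assoc, ← add_assoc] at this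
    exact this.congr (pdker_Glim hm hn hp v).symm

end kernels

/-! ### Functions with bounded derivatives -/

section bounded

variable {q : ℕ}

/-- The coordinate derivatives of order at most `n` are bounded. -/
def BDn : ℕ → (Pt q → ℝ) → Prop
  | 0, f => ∃ C, ∀ x, |f x| ≤ C
  | n + 1, f => (∃ C, ∀ x, |f x| ≤ C) ∧ ∀ i, BDn n (pd i f)

/-- Smooth functions with bounded derivatives. -/
structure BD (f : Pt q → ℝ) : Prop where
  smooth : ContDiff ℝ ∞ f
  bound : ∀ n, BDn n f

theorem BDn.bounded {n : ℕ} {f : Pt q → ℝ} (h : BDn n f) : ∃ C, ∀ x, |f x| ≤ C := by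
  cases n with
  | zero => exact h
  | succ n => exact h.1

theorem BDn.of_succ {n : ℕ} {f : Pt q → ℝ} (h : BDn (n + 1) f) : BDn n f := by
  induction n generalizing f with
  | zero => exact h.1
  | succ n ih => exact ⟨h.1, fun i => ih (h.2 i)⟩

theorem contDiff_pd {f : Pt q → ℝ} (hf : ContDiff ℝ ∞ f) (i) : ContDiff ℝ ∞ (pd i f) :=
  (hf.fderiv_right (m := ∞) (by simp)).clm_apply contDiff_const

theorem pd_mul {f g : Pt q → ℝ} {x : Pt q} (hf : DifferentiableAt ℝ f x)
    (hg : DifferentiableAt ℝ g x) (i) :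
    pd i (fun x => f x * g x) x = pd i f x * g x + f x * pd i g x := by
  rw [pd, pd, pd, fderiv_fun_mul hf hg]
  simp only [add_apply, smul_apply, smul_eq_mul]
  ring

theorem pd_add {f g : Pt q → ℝ} {x : Pt q} (hf : DifferentiableAt ℝ f x)
    (hg : DifferentiableAt ℝ g x) (i) :
    pd i (fun x => f x + g x) x = pd i f x + pd i g x := by
  rw [pd, pd, pd, fderiv_fun_add hf hg]
  rfl

theorem pd_const (c : ℝ) (i : Fin (q + 1)) : pd i (fun _ : Pt q => c) = fun _ => 0 := by
  funext x
  rw [pd, fderiv_fun_const]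
  rfl

theorem pd_sum {ι : Type*} {s : Finset ι} {f : ι → Pt q → ℝ} {x : Pt q}
    (hf : ∀ k ∈ s, DifferentiableAt ℝ (f k) x) (i) :
    pd i (fun x => ∑ k ∈ s, f k x) x = ∑ k ∈ s, pd i (f k) x := by
  simp only [pd]
  rw [fderiv_fun_sum hf, sum_apply]

theorem BDn.add {n : ℕ} {f g : Pt q → ℝ} (sf : ContDiff ℝ ∞ f) (sg : ContDiff ℝ ∞ g)
    (hf : BDn n f) (hg : BDn n g) : BDn n (fun x => f x + g x) := by
  have key : ∃ C, ∀ x, |f x + g x| ≤ C := by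
    obtain ⟨C, hC⟩ := hf.bounded
    obtain ⟨D, hD⟩ := hg.bounded
    exact ⟨C + D, fun x => (abs_add_le _ _).trans (add_le_add (hC x) (hD x))⟩
  induction n generalizing f g with
  | zero => exact key
  | succ n ih =>
    refine ⟨key, fun i => ?_⟩
    rw [funext fun x => pd_add (sf.differentiable (by simp) x) (sg.differentiable (by simp) x) i]
    refine ih (contDiff_pd sf i) (contDiff_pd sg i) (hf.2 i) (hg.2 i) ?_
    obtain ⟨C, hC⟩ := (hf.2 i).bounded
    obtain ⟨D, hD⟩ := (hg.2 i).bounded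
    exact ⟨C + D, fun x => (abs_add_le _ _).trans (add_le_add (hC x) (hD x))⟩

theorem BDn.bounded_mul {n k : ℕ} {f g : Pt q → ℝ} (hf : BDn n f) (hg : BDn k g) :
    ∃ C, ∀ x, |f x * g x| ≤ C := by
  obtain ⟨C, hC⟩ := hf.bounded
  obtain ⟨D, hD⟩ := hg.bounded
  exact ⟨C * D, fun x => (abs_mul _ _).trans_le
    (mul_le_mul (hC x) (hD x) (abs_nonneg _) ((abs_nonneg _).trans (hC x)))⟩

theorem BDn.mul {n : ℕ} {f g : Pt q → ℝ} (sf : ContDiff ℝ ∞ f) (sg : ContDiff ℝ ∞ g)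
    (hf : BDn n f) (hg : BDn n g) : BDn n (fun x => f x * g x) := by
  induction n generalizing f g with
  | zero => exact hf.bounded_mul hg
  | succ n ih =>
    refine ⟨hf.bounded_mul hg, fun i => ?_⟩
    rw [funext fun x => pd_mul (sf.differentiable (by simp) x) (sg.differentiable (by simp) x) i]
    exact BDn.add ((contDiff_pd sf i).mul sg) (sf.mul (contDiff_pd sg i))
      (ih (contDiff_pd sf i) sg (hf.2 i) hg.of_succ) (ih sf (contDiff_pd sg i) hf.of_succ (hg.2 i))

theorem BDn_const (n : ℕ) (c : ℝ) : BDn n (fun _ : Pt q => c) := by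
  induction n generalizing c with
  | zero => exact ⟨|c|, fun _ => le_rfl⟩
  | succ n ih => exact ⟨⟨|c|, fun _ => le_rfl⟩, fun i => by rw [pd_const]; exact ih 0⟩

theorem BDn_sum {ι : Type*} {s : Finset ι} {n : ℕ} {f : ι → Pt q → ℝ}
    (sf : ∀ i ∈ s, ContDiff ℝ ∞ (f i)) (H : ∀ i ∈ s, BDn n (f i)) :
    BDn n (fun x => ∑ i ∈ s, f i x) := by
  classical
  induction s using Finset.induction_on with
  | empty => simpa using BDn_const n 0
  | insert i s hi ih =>
    simp only [Finset.sum_insert hi]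
    have h1 := fun j hj => sf j (Finset.mem_insert_of_mem hj)
    exact BDn.add (sf i (Finset.mem_insert_self i s)) (ContDiff.sum h1)
      (H i (Finset.mem_insert_self i s)) (ih h1 fun j hj => H j (Finset.mem_insert_of_mem hj))

theorem BD.mul {f g : Pt q → ℝ} (hf : BD f) (hg : BD g) : BD (fun x => f x * g x) :=
  ⟨hf.1.mul hg.1, fun n => (hf.2 n).mul hf.1 hg.1 (hg.2 n)⟩

theorem BD_const (c : ℝ) : BD (fun _ : Pt q => c) := ⟨contDiff_const, fun n => BDn_const n c⟩

theorem BD_sum {ι : Type*} {s : Finset ι} {f : ι → Pt q → ℝ} (H : ∀ i ∈ s, BD (f i)) :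
    BD (fun x => ∑ i ∈ s, f i x) :=
  ⟨ContDiff.sum fun i hi => (H i hi).1, fun n => BDn_sum (fun i hi => (H i hi).1)
    fun i hi => (H i hi).2 n⟩

theorem BD_prod {ι : Type*} {s : Finset ι} {f : ι → Pt q → ℝ} (H : ∀ i ∈ s, BD (f i)) :
    BD (fun x => ∏ i ∈ s, f i x) := by
  classical
  induction s using Finset.induction_on with
  | empty => simpa using BD_const 1
  | insert i s hi ih =>
    simp only [Finset.prod_insert hi]
    exact (H i (Finset.mem_insert_self i s)).mul (ih fun j hj => H j (Finset.mem_insert_of_mem hj))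

theorem BD.pd {f : Pt q → ℝ} (hf : BD f) (i) : BD (pd i f) :=
  ⟨contDiff_pd hf.1 i, fun n => (hf.2 (n + 1)).2 i⟩

theorem BD.bounded {f : Pt q → ℝ} (hf : BD f) : ∃ C, ∀ x, |f x| ≤ C := (hf.2 0).bounded

theorem norm_basisVec (i : Fin (q + 1)) : ‖(basisVec i : Pt q)‖ = 1 := by simp [basisVec]

theorem BD_of_iteratedFDeriv {f : Pt q → ℝ} (hf : ContDiff ℝ ∞ f)
    (h : ∀ k : ℕ, ∃ C : ℝ, ∀ x, ‖iteratedFDeriv ℝ k f x‖ ≤ C) : BD f := by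
  refine ⟨hf, fun n => ?_⟩
  have h0 : ∀ {f : Pt q → ℝ}, (∀ k : ℕ, ∃ C : ℝ, ∀ x, ‖iteratedFDeriv ℝ k f x‖ ≤ C) →
      ∃ C, ∀ x, |f x| ≤ C := by
    intro f h
    obtain ⟨C, hC⟩ := h 0
    exact ⟨C, fun x => by simpa using hC x⟩
  induction n generalizing f with
  | zero => exact h0 h
  | succ n ih =>
    refine ⟨h0 h, fun i => ih (contDiff_pd hf i) fun k => ?_⟩
    obtain ⟨C, hC⟩ := h (k + 1)
    refine ⟨C, fun x => ?_⟩
    have h1 : ContDiff ℝ ∞ (fderiv ℝ f) := hf.fderiv_right (by simp)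
    have h2 := norm_iteratedFDeriv_clm_apply_const (𝕜 := ℝ) (c := (basisVec i : Pt q)) (n := k)
      (h1.contDiffAt (x := x)) (by exact_mod_cast le_top)
    rw [norm_basisVec, one_mul, norm_iteratedFDeriv_fderiv] at h2
    exact h2.trans (hC x)

theorem pdker_ofReal_comp {f : Pt q → ℝ} (hf : ContDiff ℝ ∞ f) {φ : Pt q × Pt q → Pt q}
    (hφ : ContDiff ℝ ∞ φ) (v) (z : Pt q × Pt q) :
    pdker v (fun z => (f (φ z) : ℂ)) z =
      ∑ l, (pd l f (φ z) : ℂ) * pdker v (fun z => (φ z l : ℂ)) z := by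
  have h1 := (hφ.differentiable (by simp) z).hasFDerivAt
  have h2 := (hf.differentiable (by simp) (φ z)).hasFDerivAt
  have h3 : HasFDerivAt (fun z => (f (φ z) : ℂ))
      (Complex.ofRealCLM.comp ((fderiv ℝ f (φ z)).comp (fderiv ℝ φ z))) z :=
    Complex.ofRealCLM.hasFDerivAt.comp z (h2.comp z h1)
  have h4 : ∀ l, HasFDerivAt (fun z => (φ z l : ℂ)) (Complex.ofRealCLM.comp
      ((EuclideanSpace.proj l : Pt q →L[ℝ] ℝ).comp (fderiv ℝ φ z))) z := fun l =>
    Complex.ofRealCLM.hasFDerivAt.comp z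
      ((EuclideanSpace.proj l : Pt q →L[ℝ] ℝ).hasFDerivAt.comp z h1)
  simp only [pdker_eq, h3.fderiv, (h4 _).fderiv]
  set w := fderiv ℝ φ z (bvec v) with hw
  have h5 : fderiv ℝ f (φ z) w = ∑ l, w l * pd l f (φ z) := by
    conv_lhs => rw [← sum_basisVec w]
    simp [pd]
  simp only [ContinuousLinearMap.comp_apply, ← hw, h5]
  simp [mul_comm]

theorem Mult.pdker {h : Pt q × Pt q → ℂ} (H : Mult h) (v) : Mult (pdker v h) :=
  ⟨contDiff_pdker H.1 v, fun n => (H.2 (n + 1)).2 v⟩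

theorem BD.mult_comp {f : Pt q → ℝ} (hf : BD f) {φ : Pt q × Pt q → Pt q} (hφ : ContDiff ℝ ∞ φ)
    (h : ∀ v l, Mult (MixedPDO.pdker v (fun z => (φ z l : ℂ)))) :
    Mult (fun z => (f (φ z) : ℂ)) := by
  have hs : ∀ {f : Pt q → ℝ}, BD f → ContDiff ℝ ∞ (fun z => (f (φ z) : ℂ)) := fun hf =>
    Complex.ofRealCLM.contDiff.comp (hf.1.comp hφ)
  refine ⟨hs hf, fun n => ?_⟩
  have h0 : ∀ {f : Pt q → ℝ}, BD f →
      ∃ (C : ℝ) (L : ℕ), ∀ x θ : Pt q, ‖(f (φ (x, θ)) : ℂ)‖ ≤ C * (1 + ‖θ‖) ^ L := by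
    intro f hf
    obtain ⟨C, hC⟩ := hf.bounded
    exact ⟨C, 0, fun x θ => by simpa using hC (φ (x, θ))⟩
  induction n generalizing f with
  | zero => exact h0 hf
  | succ n ih =>
    refine ⟨h0 hf, fun v => ?_⟩
    rw [funext fun z => pdker_ofReal_comp hf.1 hφ v z]
    have : ∀ s : Finset (Fin (q + 1)), PB n (fun z => ∑ l ∈ s, (MixedPDO.pd l f (φ z) : ℂ) *
        MixedPDO.pdker v (fun z => (φ z l : ℂ)) z) := by
      intro s
      induction s using Finset.induction_on with
      | empty => simpa using PB_const n 0
      | insert i s hi ihs =>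
        simp only [Finset.sum_insert hi]
        refine PB.add ((hs (hf.pd i)).mul (h v i).1)
          (ContDiff.sum fun l _ => (hs (hf.pd l)).mul (h v l).1) ?_ ihs
        exact PB.mul (hs (hf.pd i)) (h v i).1 (ih (hf.pd i)) ((h v i).2 n)
    exact this Finset.univ

theorem pdker_coord (v w : Fin (q + 1) ⊕ Fin (q + 1)) :
    pdker v (fun z => (coordForm w z : ℂ)) = fun _ => ((coordForm w (bvec v) : ℝ) : ℂ) := by
  funext z
  have : HasFDerivAt (fun z : Pt q × Pt q => (coordForm w z : ℂ))
      (Complex.ofRealCLM.comp (coordForm w)) z := (Complex.ofRealCLM.comp (coordForm w)).hasFDerivAt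
  rw [pdker_eq, this.fderiv]
  rfl

theorem BD.mult {f : Pt q → ℝ} (hf : BD f) : Mult (fun z => (f z.1 : ℂ)) :=
  hf.mult_comp contDiff_fst fun v l => by
    rw [show (fun z : Pt q × Pt q => ((z.1 l : ℝ) : ℂ)) = fun z => (coordForm (Sum.inl l) z : ℂ)
      from rfl, pdker_coord]
    exact Mult_const _

end bounded

/-! ### The inverse frame -/

namespace Frame

variable {q : ℕ} (X : Frame q)

theorem det_ne_zero (x : Pt q) : (X.A x).det ≠ 0 := by
  obtain ⟨c, hc, h⟩ := X.det_bound
  exact abs_pos.mp (hc.trans_le (h x))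

theorem A_mul_B (x : Pt q) : X.A x * X.B x = 1 :=
  Matrix.mul_nonsing_inv _ (isUnit_iff_ne_zero.mpr (X.det_ne_zero x))

theorem B_mul_A (x : Pt q) : X.B x * X.A x = 1 :=
  Matrix.nonsing_inv_mul _ (isUnit_iff_ne_zero.mpr (X.det_ne_zero x))

theorem sum_A_mul_B (x : Pt q) (i k) :
    ∑ j, X.A x i j * X.B x j k = if i = k then 1 else 0 := by
  rw [← Matrix.mul_apply, X.A_mul_B, Matrix.one_apply]

theorem sum_B_mul_A (x : Pt q) (i k) :
    ∑ j, X.B x i j * X.A x j k = if i = k then 1 else 0 := by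
  rw [← Matrix.mul_apply, X.B_mul_A, Matrix.one_apply]

theorem BD_A (i j) : BD (fun x => X.A x i j) :=
  BD_of_iteratedFDeriv (X.smooth i j) fun k => (X.bounded k).imp fun _ h => h i j

theorem BD_det {N : Pt q → Matrix (Fin (q + 1)) (Fin (q + 1)) ℝ} (h : ∀ i j, BD (fun x => N x i j)) :
    BD (fun x => (N x).det) := by
  simp only [Matrix.det_apply']
  exact BD_sum fun σ _ => (BD_const _).mul (BD_prod fun i _ => h _ _)

theorem B_eq (x : Pt q) (j k) :
    X.B x j k = ((X.A x).det)⁻¹ * ((X.A x).updateRow k (Pi.single j 1)).det := by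
  rw [B, Matrix.inv_def, Matrix.smul_apply, Matrix.adjugate_apply, Ring.inverse_eq_inv', smul_eq_mul]

theorem BD_cofactor (j k) : BD (fun x => ((X.A x).updateRow k (Pi.single j 1)).det) := by
  refine BD_det fun i l => ?_
  simp only [Matrix.updateRow_apply]
  split_ifs
  · exact BD_const _
  · exact X.BD_A i l

theorem contDiff_B (j k) : ContDiff ℝ ∞ (fun x => X.B x j k) := by
  simp only [B_eq]
  exact ((BD_det X.BD_A).1.inv X.det_ne_zero).mul (X.BD_cofactor j k).1

theorem pd_B (i j k) (x : Pt q) :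
    pd i (fun x => X.B x j k) x =
      ∑ p, ∑ l, -1 * (X.B x j p * (pd i (fun x => X.A x p l) x * X.B x l k)) := by
  have dA := fun p l => (X.smooth p l).differentiable (by simp) x
  have dB := fun p l => (X.contDiff_B p l).differentiable (by simp) x
  have h1 : ∀ p, ∑ l, X.A x p l * pd i (fun x => X.B x l k) x =
      -∑ l, pd i (fun x => X.A x p l) x * X.B x l k := by
    intro p
    have h := congrArg (fun f => pd i f x) (funext fun x => X.sum_A_mul_B x p k)
    simp only [pd_const] at h
    rw [pd_sum (f := fun l x => X.A x p l * X.B x l k) (fun l _ => (dA p l).fun_mul (dB l k))] at h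
    simp only [pd_mul (dA p _) (dB _ k), Finset.sum_add_distrib] at h
    linarith
  calc pd i (fun x => X.B x j k) x
      = ∑ l, (if j = l then 1 else 0) * pd i (fun x => X.B x l k) x := by simp
    _ = ∑ p, X.B x j p * ∑ l, X.A x p l * pd i (fun x => X.B x l k) x := by
        simp only [← X.sum_B_mul_A x, Finset.sum_mul, Finset.mul_sum]
        rw [Finset.sum_comm]
        simp only [mul_assoc]
    _ = _ := by
        simp only [h1, mul_neg, Finset.mul_sum, ← Finset.sum_neg_distrib, neg_mul, one_mul]

theorem BD_B (j k) : BD (fun x => X.B x j k) := by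
  refine ⟨X.contDiff_B j k, fun n => ?_⟩
  have h0 : ∀ j k, ∃ C, ∀ x, |X.B x j k| ≤ C := by
    intro j k
    obtain ⟨c, hc, h⟩ := X.det_bound
    obtain ⟨C, hC⟩ := (X.BD_cofactor j k).bounded
    refine ⟨c⁻¹ * C, fun x => ?_⟩
    rw [X.B_eq, abs_mul, abs_inv]
    exact mul_le_mul (inv_anti₀ hc (h x)) (hC x) (abs_nonneg _) (by positivity)
  induction n generalizing j k with
  | zero => exact h0 j k
  | succ n ih =>
    refine ⟨h0 j k, fun i => ?_⟩
    rw [funext fun x => X.pd_B i j k x]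
    have sA := fun p l => ((X.BD_A p l).pd i)
    have s1 := fun p l => (sA p l).1.mul (X.contDiff_B l k)
    have s2 := fun p l => (X.contDiff_B j p).mul (s1 p l)
    have s3 := fun p l => (contDiff_const (c := (-1 : ℝ)) (n := ∞)).mul (s2 p l)
    refine BDn_sum (fun p _ => ContDiff.sum fun l _ => s3 p l) fun p _ =>
      BDn_sum (fun l _ => s3 p l) fun l _ => ?_
    exact (BDn_const n (-1)).mul contDiff_const (s2 p l) ((ih j p).mul (X.contDiff_B j p) (s1 p l)
      (((sA p l).2 n).mul (sA p l).1 (X.contDiff_B l k) (ih l k)))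

theorem det_B_ne_zero (x : Pt q) : (X.B x).det ≠ 0 := by
  intro h
  have := congrArg Matrix.det (X.A_mul_B x)
  rw [Matrix.det_mul, h, mul_zero, Matrix.det_one] at this
  exact zero_ne_one this

/-- The Jacobian `|det B(x)|` of `ζ ↦ B(x) ζ`. -/
def J (x : Pt q) : ℝ := |(X.B x).det|

theorem BD_J : BD X.J := by
  have hd := BD_det X.BD_B
  rcases isPreconnected_univ.eq_or_eq_neg_of_sq_eq (f := fun x => (X.B x).det) (g := X.J)
    hd.1.continuous.continuousOn hd.1.continuous.abs.continuousOn
    (fun x _ => by simp [J]) (fun {x} _ => abs_ne_zero.mpr (X.det_B_ne_zero x)) with h | h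
  · rwa [show (fun x => (X.B x).det) = X.J from funext fun x => h (Set.mem_univ x)] at hd
  · have := (BD_const (q := q) (-1)).mul hd
    rw [show (fun x => -1 * (X.B x).det) = X.J from funext fun x => by
      have := h (Set.mem_univ x)
      simp only [Pi.neg_apply] at this
      rw [this, neg_one_mul, neg_neg]] at this
    exact this

end Frame

/-! ### The coordinates `(x, θ)`, `θ = Θ_0(x, y)` -/

namespace Frame

variable {q : ℕ} (X : Frame q)

/-- `Θ_0(x, y)` as a point of `ℝ^N`. -/
def theta (z : Pt q × Pt q) : Pt q := WithLp.toLp 2 (X.Theta0 z.1 z.2)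

/-- The change of coordinates `(x, y) ↦ (x, Θ_0(x, y))`. -/
def T (z : Pt q × Pt q) : Pt q × Pt q := (z.1, X.theta z)

theorem theta_apply (z : Pt q × Pt q) (r) :
    X.theta z r = ∑ j, X.B z.1 j r * (z.1 j - z.2 j) := rfl

theorem sum_theta_mul_A (z : Pt q × Pt q) (k) :
    ∑ i, X.theta z i * X.A z.1 i k = z.1 k - z.2 k := by
  simp only [theta_apply, Finset.sum_mul]
  rw [Finset.sum_comm]
  calc ∑ j, ∑ i, X.B z.1 j i * (z.1 j - z.2 j) * X.A z.1 i k
      = ∑ j, (∑ i, X.B z.1 j i * X.A z.1 i k) * (z.1 j - z.2 j) := by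
        simp only [Finset.sum_mul]
        exact Finset.sum_congr rfl fun j _ => Finset.sum_congr rfl fun i _ => by ring
    _ = _ := by simp [sum_B_mul_A]

theorem T_mem_punct {z : Pt q × Pt q} (hz : z ∈ offDiag q) : X.T z ∈ punct q := by
  intro h
  refine hz (sub_eq_zero.mp ?_)
  ext k
  have h1 := X.sum_theta_mul_A z k
  rw [show X.theta z = 0 from h] at h1
  simpa using h1.symm

theorem contDiff_theta : ContDiff ℝ ∞ X.theta := by
  refine contDiff_euclidean.mpr fun r => ?_
  simp only [theta_apply]
  refine ContDiff.sum fun j _ => ((X.contDiff_B j r).comp contDiff_fst).mul ?_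
  exact (coordForm (Sum.inl j)).contDiff.sub (coordForm (Sum.inr j)).contDiff

theorem contDiff_T : ContDiff ℝ ∞ X.T := contDiff_fst.prodMk X.contDiff_theta

theorem fderiv_apply_eq_sum_pd {f : Pt q → ℝ} (x u : Pt q) :
    fderiv ℝ f x u = ∑ l, u l * pd l f x := by
  conv_lhs => rw [← sum_basisVec u]
  simp [pd]

theorem fderiv_T_snd (z w : Pt q × Pt q) (r) :
    (fderiv ℝ X.T z w).2 r = ∑ j, ((∑ l, w.1 l * pd l (fun x => X.B x j r) z.1) *
      (z.1 j - z.2 j) + X.B z.1 j r * (w.1 j - w.2 j)) := by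
  have h1 := (X.contDiff_T.differentiable (by simp) z).hasFDerivAt
  have h2 : HasFDerivAt (fun z => X.theta z r)
      (((EuclideanSpace.proj r : Pt q →L[ℝ] ℝ).comp (ContinuousLinearMap.snd ℝ _ _)).comp
        (fderiv ℝ X.T z)) z :=
    ((EuclideanSpace.proj r : Pt q →L[ℝ] ℝ).comp
      (ContinuousLinearMap.snd ℝ (Pt q) (Pt q))).hasFDerivAt.comp z h1
  have h3 : ∀ j, HasFDerivAt (fun z : Pt q × Pt q => X.B z.1 j r * (z.1 j - z.2 j))
      (X.B z.1 j r • (coordForm (Sum.inl j) - coordForm (Sum.inr j)) +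
        (z.1 j - z.2 j) • (fderiv ℝ (fun x => X.B x j r) z.1).comp
          (ContinuousLinearMap.fst ℝ _ _)) z := fun j =>
    HasFDerivAt.mul ((((X.contDiff_B j r).differentiable (by simp) z.1).hasFDerivAt).comp z
        hasFDerivAt_fst)
      ((coordForm (Sum.inl j)).hasFDerivAt.sub (coordForm (Sum.inr j)).hasFDerivAt)
  have h4 := HasFDerivAt.fun_sum fun j (_ : j ∈ Finset.univ) => h3 j
  have h5 := DFunLike.congr_fun (h2.unique h4) w
  simp only [ContinuousLinearMap.comp_apply, sum_apply] at h5
  refine (show (fderiv ℝ X.T z w).2 r = _ from h5).trans (Finset.sum_congr rfl fun j _ => ?_)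
  simp only [add_apply, smul_apply, sub_apply, smul_eq_mul, ContinuousLinearMap.comp_apply,
    ContinuousLinearMap.coe_fst', fderiv_apply_eq_sum_pd]
  simp only [coordForm, ContinuousLinearMap.comp_apply, ContinuousLinearMap.coe_fst',
    ContinuousLinearMap.coe_snd', PiLp.proj_apply]
  ring

theorem fderiv_T_fst (z w : Pt q × Pt q) : (fderiv ℝ X.T z w).1 = w.1 := by
  have h1 := (X.contDiff_T.differentiable (by simp) z).hasFDerivAt
  have h2 : HasFDerivAt (fun z : Pt q × Pt q => z.1)
      ((ContinuousLinearMap.fst ℝ (Pt q) (Pt q)).comp (fderiv ℝ X.T z)) z :=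
    HasFDerivAt.comp (f := X.T) (g := fun z : Pt q × Pt q => z.1) z
      (ContinuousLinearMap.fst ℝ (Pt q) (Pt q)).hasFDerivAt h1
  exact DFunLike.congr_fun (h2.unique hasFDerivAt_fst) w

/-- The `θ_r`-component of `∂/∂x^l` in the coordinates `(x, θ)`, up to `B_l^r`. -/
def beta (l r : Fin (q + 1)) (z : Pt q × Pt q) : ℝ :=
  ∑ j, pd l (fun x => X.B x j r) z.1 * ∑ i, z.2 i * X.A z.1 i j

theorem beta_T (l r) (z : Pt q × Pt q) :
    X.beta l r (X.T z) = ∑ j, pd l (fun x => X.B x j r) z.1 * (z.1 j - z.2 j) := by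
  simp only [beta, T, sum_theta_mul_A]

theorem pdFst_comp_T {G : Pt q × Pt q → ℂ} {z : Pt q × Pt q} (hG : DifferentiableAt ℝ G (X.T z))
    (l) : pdFst l (fun z => G (X.T z)) z = pdFst l G (X.T z) +
      ∑ r, ((X.beta l r (X.T z) + X.B z.1 l r : ℝ) : ℂ) * pdSnd r G (X.T z) := by
  have h1 : HasFDerivAt (fun z => G (X.T z)) ((fderiv ℝ G (X.T z)).comp (fderiv ℝ X.T z)) z :=
    hG.hasFDerivAt.comp z (X.contDiff_T.differentiable (by simp) z).hasFDerivAt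
  rw [pdFst, h1.fderiv, ContinuousLinearMap.comp_apply, fderiv_apply_pair]
  congr 1
  · rw [fderiv_T_fst]
    simp [basisVec, apply_ite Complex.ofReal]
  · refine Finset.sum_congr rfl fun r _ => ?_
    rw [fderiv_T_snd, beta_T]
    congr 2
    rw [Finset.sum_add_distrib]
    simp [basisVec]

theorem pdSnd_comp_T {G : Pt q × Pt q → ℂ} {z : Pt q × Pt q} (hG : DifferentiableAt ℝ G (X.T z))
    (l) : pdSnd l (fun z => G (X.T z)) z = -∑ r, (X.B z.1 l r : ℂ) * pdSnd r G (X.T z) := by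
  have h1 : HasFDerivAt (fun z => G (X.T z)) ((fderiv ℝ G (X.T z)).comp (fderiv ℝ X.T z)) z :=
    hG.hasFDerivAt.comp z (X.contDiff_T.differentiable (by simp) z).hasFDerivAt
  rw [pdSnd, h1.fderiv, ContinuousLinearMap.comp_apply, fderiv_apply_pair,
    ← Finset.sum_neg_distrib]
  have h2 : (fderiv ℝ X.T z (0, basisVec l)).1 = 0 := X.fderiv_T_fst _ _
  simp only [h2, PiLp.zero_apply, Complex.ofReal_zero, zero_mul, Finset.sum_const_zero, zero_add]
  refine Finset.sum_congr rfl fun r _ => ?_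
  rw [fderiv_T_snd, ← neg_mul]
  congr 1
  simp [basisVec]

/-- Functions on the complement of the diagonal that are kernels of type `(a, b)` in the
coordinates `(x, θ)`. -/
def KerXY (a b : ℝ) (F : Pt q × Pt q → ℂ) : Prop :=
  ∃ G, Ker a b G ∧ Set.EqOn F (fun z => G (X.T z)) (offDiag q)

theorem _root_.MixedPDO.isOpen_offDiag : IsOpen (offDiag q) :=
  isOpen_ne_fun continuous_fst continuous_snd

theorem mult_beta (l r) : Mult (fun z => (X.beta l r z : ℂ)) := by
  have : (fun z => (X.beta l r z : ℂ)) = fun z : Pt q × Pt q =>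
      ∑ j, (pd l (fun x => X.B x j r) z.1 : ℂ) * ∑ i, ((z.2 i : ℝ) : ℂ) * (X.A z.1 i j : ℂ) := by
    funext z
    simp [beta]
  rw [this]
  exact Mult_sum fun j _ => ((X.BD_B j r).pd l).mult.mul
    (Mult_sum fun i _ => (Mult_coord_snd i).mul (X.BD_A i j).mult)

theorem beta_zero (l r) (x : Pt q) : X.beta l r (x, 0) = 0 := by simp [beta]

theorem _root_.MixedPDO.Ker.smooth_at {a b : ℝ} {G : Pt q × Pt q → ℂ} (hG : Ker a b G)
    {z : Pt q × Pt q} (hz : z ∈ punct q) : DifferentiableAt ℝ G z :=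
  differentiableAt_of_contDiffOn isOpen_punct hG.1 hz

/-- A derivative in `θ` of type `(a, b + 1)`. -/
theorem _root_.MixedPDO.Ker.pdSnd_bad {a b : ℝ} {G : Pt q × Pt q → ℂ} (hG : Ker a b G) (r) :
    Ker a (b + 1) (pdSnd r G) := by
  have h : Ker _ _ (pdSnd r G) := hG.pdker (Sum.inr r)
  simp only [gS, bS] at h
  split_ifs at h
  · simpa using h
  · simpa using h.move move_neg_one_one

/-- `c ∂/∂θ_r` is of type `(a + 1, b)` if `r` is a good direction or `c` vanishes at `θ = 0`. -/
theorem _root_.MixedPDO.Mult.mul_pdSnd_good {a b : ℝ} {G c : Pt q × Pt q → ℂ} (hc : Mult c)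
    (hG : Ker a b G) {r} (h0 : r = Fin.last q → ∀ x, c (x, 0) = 0) :
    Ker (a + 1) b (fun z => c z * pdSnd r G z) := by
  have h := hG.pdker (Sum.inr r)
  simp only [gS, bS] at h
  split_ifs at h with hr
  · have h1 := (hc.vanish_mul_Ker (h0 hr) h).move move_two_neg_one
    have e1 : a + 0 - 1 + 2 = a + 1 := by ring
    have e2 : b + 1 + -1 = b := by ring
    rwa [e1, e2] at h1
  · rw [add_zero] at h
    exact hc.mul_Ker h

theorem sum_A_mul_sum_B (x : Pt q) (p) (H : Fin (q + 1) → ℂ) :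
    ∑ l, (X.A x p l : ℂ) * ∑ r, (X.B x l r : ℂ) * H r = H p := by
  simp only [Finset.mul_sum]
  rw [Finset.sum_comm]
  have : ∀ r, ∑ l, (X.A x p l : ℂ) * ((X.B x l r : ℂ) * H r) =
      ((if p = r then 1 else 0 : ℝ) : ℂ) * H r := by
    intro r
    rw [← X.sum_A_mul_B x p r]
    push_cast
    rw [Finset.sum_mul]
    exact Finset.sum_congr rfl fun l _ => by ring
  simp [this, apply_ite Complex.ofReal]

theorem KerXY.pdker {a b : ℝ} {F : Pt q × Pt q → ℂ} (h : X.KerXY a b F) (v) :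
    X.KerXY a (b + 1) (pdker v F) := by
  obtain ⟨G, hG, hFG⟩ := h
  have hd := eqOn_pdker isOpen_offDiag hFG v
  rcases v with l | l
  · refine ⟨fun z => pdFst l G z + ∑ r, ((X.beta l r z + X.B z.1 l r : ℝ) : ℂ) * pdSnd r G z, ?_,
      fun z hz => (hd hz).trans (X.pdFst_comp_T (hG.smooth_at (X.T_mem_punct hz)) l)⟩
    refine Ker.add ?_ (Ker_sum fun r _ => Mult.mul_Ker ?_ (hG.pdSnd_bad r))
    · have : Ker _ _ (pdFst l G) := (hG.pdker (Sum.inl l)).move move_zero_one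
      simpa [gS, bS] using this
    · simpa using (X.mult_beta l r).add (X.BD_B l r).mult
  · refine ⟨fun z => -∑ r, (X.B z.1 l r : ℂ) * pdSnd r G z, ?_,
      fun z hz => (hd hz).trans (X.pdSnd_comp_T (hG.smooth_at (X.T_mem_punct hz)) l)⟩
    have := Mult.mul_Ker (Mult_const (-1)) (Ker_sum (s := Finset.univ) fun r _ =>
      (X.BD_B l r).mult.mul_Ker (hG.pdSnd_bad r))
    simpa using this

theorem KerXY.Dker {a b : ℝ} {F : Pt q × Pt q → ℂ} (h : X.KerXY a b F) (i) :
    X.KerXY a b (X.Dker i F) := by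
  obtain ⟨G, hG, hFG⟩ := h
  have hi : Ker _ _ (pdFst i G) := hG.pdker (Sum.inl i)
  refine ⟨pdFst i G, by simpa [gS, bS] using hi, fun z hz => ?_⟩
  have hd := hG.smooth_at (X.T_mem_punct hz)
  have e1 : pdFst i F z = _ := (eqOn_pdker isOpen_offDiag hFG (Sum.inl i) hz).trans
    (X.pdFst_comp_T hd i)
  have e2 : ∀ l, pdSnd l F z = _ := fun l =>
    (eqOn_pdker isOpen_offDiag hFG (Sum.inr l) hz).trans (X.pdSnd_comp_T hd l)
  have e3 : ∀ k p, ∑ l, ((pd i (fun x => X.B x k p) z.1 * X.A z.1 p l * (z.1 k - z.2 k) : ℝ) : ℂ) *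
      (-∑ r, (X.B z.1 l r : ℂ) * pdSnd r G (X.T z)) =
      -(((pd i (fun x => X.B x k p) z.1 * (z.1 k - z.2 k) : ℝ) : ℂ) * pdSnd p G (X.T z)) := by
    intro k p
    rw [← X.sum_A_mul_sum_B z.1 p (fun r => pdSnd r G (X.T z)), Finset.mul_sum,
      ← Finset.sum_neg_distrib]
    refine Finset.sum_congr rfl fun l _ => ?_
    push_cast
    ring
  simp only [Frame.Dker, e1, e2, e3, Finset.sum_neg_distrib]
  rw [Finset.sum_comm]
  simp only [← Finset.sum_mul, ← Complex.ofReal_sum, ← X.beta_T]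
  push_cast
  simp only [add_mul, Finset.sum_add_distrib]
  ring

/-- `y = x - θ A(x)`. -/
def yOf (z : Pt q × Pt q) : Pt q := WithLp.toLp 2 fun l => z.1 l - ∑ i, z.2 i * X.A z.1 i l

theorem yOf_T (z : Pt q × Pt q) : X.yOf (X.T z) = z.2 := by
  ext l
  simp only [yOf, T, sum_theta_mul_A]
  ring

theorem yOf_zero (x : Pt q) : X.yOf (x, 0) = x := by
  ext l
  simp [yOf]

theorem mult_sum_A (l) : Mult (fun z : Pt q × Pt q => ∑ i, ((z.2 i : ℝ) : ℂ) * (X.A z.1 i l : ℂ)) :=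
  Mult_sum fun i _ => (Mult_coord_snd i).mul (X.BD_A i l).mult

theorem contDiff_yOf : ContDiff ℝ ∞ X.yOf := by
  refine contDiff_euclidean.mpr fun l => ?_
  refine ContDiff.sub (coordForm (Sum.inl l)).contDiff (ContDiff.sum fun i _ => ?_)
  exact (coordForm (Sum.inr i)).contDiff.mul ((X.smooth i l).comp contDiff_fst)

theorem mult_comp_yOf {f : Pt q → ℝ} (hf : BD f) : Mult (fun z => (f (X.yOf z) : ℂ)) := by
  refine hf.mult_comp X.contDiff_yOf fun v l => ?_
  have e : (fun z => ((X.yOf z l : ℝ) : ℂ)) = fun z => (coordForm (Sum.inl l) z : ℂ) +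
      -1 * ∑ i, ((z.2 i : ℝ) : ℂ) * (X.A z.1 i l : ℂ) := by
    funext z
    simp [yOf, coordForm]
    ring
  have h1 := (Mult_const (-1)).mul (X.mult_sum_A l)
  have h2 : ContDiff ℝ ∞ (fun z : Pt q × Pt q => (coordForm (Sum.inl l) z : ℂ)) :=
    Complex.ofRealCLM.contDiff.comp (coordForm (Sum.inl l)).contDiff
  rw [e, funext fun z => pdker_add (h2.differentiable (by simp) z)
    (h1.1.differentiable (by simp) z) v, pdker_coord]
  exact (Mult_const _).add (h1.pdker v)

theorem KerXY.Xker {a b : ℝ} {F : Pt q × Pt q → ℂ} (h : X.KerXY a b F) (v) :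
    X.KerXY (a + 1) b (X.Xker v F) := by
  obtain ⟨G, hG, hFG⟩ := h
  rcases v with i | i
  · set c : Fin (q + 1) → Pt q × Pt q → ℂ := fun r z =>
      ∑ l, (X.A z.1 i.castSucc l : ℂ) * ((X.beta l r z : ℂ) + (X.B z.1 l r : ℂ)) with hc
    have mc : ∀ r, Mult (c r) := fun r => Mult_sum fun l _ =>
      (X.BD_A i.castSucc l).mult.mul ((X.mult_beta l r).add (X.BD_B l r).mult)
    have c0 : ∀ r, r = Fin.last q → ∀ x, c r (x, 0) = 0 := by
      rintro r rfl x
      have := X.sum_A_mul_B x i.castSucc (Fin.last q)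
      rw [if_neg (Fin.castSucc_lt_last i).ne] at this
      simp only [hc, beta_zero, Complex.ofReal_zero, zero_add]
      exact_mod_cast this
    refine ⟨fun z => ∑ l, (X.A z.1 i.castSucc l : ℂ) * pdFst l G z + ∑ r, c r z * pdSnd r G z,
      ?_, fun z hz => ?_⟩
    · refine Ker.add (Ker_sum fun l _ => (X.BD_A i.castSucc l).mult.mul_Ker ?_)
        (Ker_sum fun r _ => (mc r).mul_pdSnd_good hG (c0 r))
      have : Ker _ _ (pdFst l G) := (hG.pdker (Sum.inl l)).move move_one_zero
      simpa [gS, bS] using this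
    · have e1 : ∀ l, pdFst l F z = _ := fun l =>
        (eqOn_pdker isOpen_offDiag hFG (Sum.inl l) hz).trans
          (X.pdFst_comp_T (hG.smooth_at (X.T_mem_punct hz)) l)
      simp only [Frame.Xker, e1, mul_add, Finset.sum_add_distrib, Finset.mul_sum]
      congr 1
      rw [Finset.sum_comm]
      refine Finset.sum_congr rfl fun r _ => ?_
      rw [hc, Finset.sum_mul]
      refine Finset.sum_congr rfl fun l _ => ?_
      push_cast
      simp only [T]
      ring
  · set c : Fin (q + 1) → Pt q × Pt q → ℂ := fun r z =>
      -1 * ∑ l, (X.A (X.yOf z) i.castSucc l : ℂ) * (X.B z.1 l r : ℂ) with hc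
    have mc : ∀ r, Mult (c r) := fun r => (Mult_const (-1)).mul (Mult_sum fun l _ =>
      (X.mult_comp_yOf (X.BD_A i.castSucc l)).mul (X.BD_B l r).mult)
    have c0 : ∀ r, r = Fin.last q → ∀ x, c r (x, 0) = 0 := by
      rintro r rfl x
      have := X.sum_A_mul_B x i.castSucc (Fin.last q)
      rw [if_neg (Fin.castSucc_lt_last i).ne] at this
      simp only [hc, yOf_zero]
      rw [mul_eq_zero]
      right
      exact_mod_cast this
    refine ⟨fun z => ∑ r, c r z * pdSnd r G z, Ker_sum fun r _ =>
      (mc r).mul_pdSnd_good hG (c0 r), fun z hz => ?_⟩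
    have e1 : ∀ l, pdSnd l F z = _ := fun l =>
      (eqOn_pdker isOpen_offDiag hFG (Sum.inr l) hz).trans
        (X.pdSnd_comp_T (hG.smooth_at (X.T_mem_punct hz)) l)
    simp only [Frame.Xker, e1, hc, yOf_T, mul_neg, Finset.mul_sum, Finset.sum_mul, neg_mul,
      one_mul, Finset.sum_neg_distrib]
    rw [Finset.sum_comm]
    congr 1
    refine Finset.sum_congr rfl fun r _ => Finset.sum_congr rfl fun l _ => ?_
    simp only [T]
    ring

theorem KerXY.words {a b : ℝ} {k : Pt q × Pt q → ℂ} (h : X.KerXY a b k)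
    (I : List (Fin (q + 1))) (γ : List (Fin q ⊕ Fin q)) (l : List (Fin (q + 1) ⊕ Fin (q + 1))) :
    X.KerXY (a + γ.length) (b + l.length)
      (I.foldr X.Dker (γ.foldr X.Xker (l.foldr MixedPDO.pdker k))) := by
  have h1 : X.KerXY a (b + l.length) (l.foldr MixedPDO.pdker k) := by
    induction l with
    | nil => simpa using h
    | cons v l ih =>
      have := KerXY.pdker X ih v
      rw [List.foldr_cons, List.length_cons, Nat.cast_succ, ← add_assoc]
      exact this
  have h2 : X.KerXY (a + γ.length) (b + l.length) (γ.foldr X.Xker (l.foldr MixedPDO.pdker k)) := by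
    induction γ with
    | nil => simpa using h1
    | cons v γ ih =>
      have := KerXY.Xker X ih v
      rw [List.foldr_cons, List.length_cons, Nat.cast_succ, ← add_assoc]
      exact this
  induction I with
  | nil => exact h2
  | cons i I ih => exact KerXY.Dker X ih i

theorem _root_.MixedPDO.norm_le_sum_abs (x : Pt q) : ‖x‖ ≤ ∑ i, |x i| := by
  conv_lhs => rw [← sum_basisVec x]
  refine (norm_sum_le _ _).trans (Finset.sum_le_sum fun i _ => ?_)
  rw [norm_smul, norm_basisVec, mul_one, Real.norm_eq_abs]

/-- Sums against bounded coefficients are bounded by the norm. -/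
theorem _root_.MixedPDO.exists_norm_le_of_BD {N : Pt q → Fin (q + 1) → Fin (q + 1) → ℝ}
    (hN : ∀ i j, BD (fun x => N x i j)) :
    ∃ C : ℝ, 0 < C ∧ ∀ x v w : Pt q, (∀ i, w i = ∑ j, N x i j * v j) → ‖w‖ ≤ C * ‖v‖ := by
  choose C hC using fun i j => (hN i j).bounded
  have hC0 : ∀ i j, 0 ≤ C i j := fun i j => (abs_nonneg _).trans (hC i j 0)
  refine ⟨∑ i, ∑ j, C i j + 1, add_pos_of_nonneg_of_pos
    (Finset.sum_nonneg fun i _ => Finset.sum_nonneg fun j _ => hC0 i j) one_pos,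
    fun x v w h => (norm_le_sum_abs w).trans ?_⟩
  have h1 : ∑ i, |w i| ≤ (∑ i, ∑ j, C i j) * ‖v‖ := by
    simp only [Finset.sum_mul, h]
    refine Finset.sum_le_sum fun i _ => (Finset.abs_sum_le_sum_abs _ _).trans
      (Finset.sum_le_sum fun j _ => ?_)
    rw [abs_mul]
    exact mul_le_mul (hC i j x) (abs_coord_le_norm v j) (abs_nonneg _) (hC0 i j)
  nlinarith [norm_nonneg v]

theorem exists_norm_sub_le : ∃ C : ℝ, 0 < C ∧ ∀ z : Pt q × Pt q, ‖z.1 - z.2‖ ≤ C * ‖X.theta z‖ := by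
  obtain ⟨C, h0, hC⟩ := exists_norm_le_of_BD (N := fun x i j => X.A x j i) fun i j => X.BD_A j i
  refine ⟨C, h0, fun z => hC z.1 _ _ fun i => ?_⟩
  rw [PiLp.sub_apply, ← X.sum_theta_mul_A]
  exact Finset.sum_congr rfl fun j _ => mul_comm _ _

/-- The kernel bound, for `a, b ≥ 0`. -/
theorem KerXY.bound {a b : ℝ} (ha : 0 ≤ a) (hb : 0 ≤ b) {F : Pt q × Pt q → ℂ}
    (h : X.KerXY a b F) {M : ℝ} (hM : 0 ≤ M) : ∃ C : ℝ, ∀ x y : Pt q, x ≠ y →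
      ‖F (x, y)‖ ≤ C / (‖x - y‖ ^ (a + M) * X.qdist x y ^ (2 * b)) := by
  obtain ⟨G, hG, hFG⟩ := h
  have hdom := (hG.2 0).dom
  obtain ⟨C1, hC1⟩ := hdom.near
  obtain ⟨L, hL⟩ := exists_nat_ge (a + M + 2 * b)
  obtain ⟨C2, hC2⟩ := hdom.far L
  obtain ⟨c, c0, hc⟩ := X.exists_norm_sub_le
  set c' := max c 1 with hc'
  have c'1 : 1 ≤ c' := le_max_right _ _
  refine ⟨(|C1| + |C2| * 2 ^ (2 * b)) * (c' ^ (a + M) * c' ^ (2 * b)), fun x y hxy => ?_⟩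
  set θ := X.theta (x, y) with hθ
  have hz : (x, y) ∈ offDiag q := hxy
  have hθ0 : θ ≠ 0 := X.T_mem_punct hz
  have n0 : 0 < ‖θ‖ := norm_pos_iff.mpr hθ0
  have f0 := fd_pos hθ0
  have d0 : 0 < ‖x - y‖ := norm_pos_iff.mpr (sub_ne_zero.mpr hxy)
  have d1 : ‖x - y‖ ≤ c' * ‖θ‖ := (hc (x, y)).trans (by gcongr; exact le_max_left _ _)
  have q0 : 0 < X.qdist x y := add_pos_of_pos_of_nonneg d0 (Real.sqrt_nonneg _)
  have q1 : X.qdist x y ≤ c' * fd θ := by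
    have : X.qdist x y = ‖x - y‖ + √|θ (Fin.last q)| := rfl
    rw [this, fd, mul_add]
    have := Real.sqrt_nonneg |θ (Fin.last q)|
    nlinarith
  have hF : F (x, y) = G (x, θ) := hFG hz
  have main : ‖G (x, θ)‖ ≤
      (|C1| + |C2| * 2 ^ (2 * b)) / (‖θ‖ ^ (a + M) * fd θ ^ (2 * b)) := by
    rw [le_div_iff₀ (by positivity)]
    rcases le_total ‖θ‖ 1 with h1 | h1
    · have e := hC1 x θ hθ0 h1
      have e2 : ‖θ‖ ^ (a + M) ≤ ‖θ‖ ^ a := Real.rpow_le_rpow_of_exponent_ge n0 h1 (by linarith)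
      rw [Real.rpow_neg n0.le, Real.rpow_neg f0.le] at e
      have p1 : 0 < ‖θ‖ ^ a := by positivity
      have p2 : 0 < fd θ ^ (2 * b) := by positivity
      calc ‖G (x, θ)‖ * (‖θ‖ ^ (a + M) * fd θ ^ (2 * b))
          ≤ C1 * ((‖θ‖ ^ a)⁻¹ * (fd θ ^ (2 * b))⁻¹) * (‖θ‖ ^ a * fd θ ^ (2 * b)) := by
            refine mul_le_mul e ?_ (by positivity) ((norm_nonneg _).trans e)
            gcongr
        _ = C1 := by field_simp
        _ ≤ _ := (le_abs_self C1).trans (le_add_of_nonneg_right (by positivity))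
    · have e := hC2 x θ h1
      have e2 : fd θ ≤ 2 * ‖θ‖ := by
        have h3 : √|θ (Fin.last q)| ≤ ‖θ‖ := by
          refine Real.sqrt_le_iff.mpr ⟨n0.le, (abs_coord_le_norm θ _).trans ?_⟩
          nlinarith
        unfold fd
        linarith
      have e3 : ‖θ‖ ^ (a + M) * fd θ ^ (2 * b) ≤ 2 ^ (2 * b) * ‖θ‖ ^ L := by
        calc ‖θ‖ ^ (a + M) * fd θ ^ (2 * b) ≤ ‖θ‖ ^ (a + M) * (2 * ‖θ‖) ^ (2 * b) := by gcongr
          _ = 2 ^ (2 * b) * ‖θ‖ ^ (a + M + 2 * b) := by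
              rw [Real.mul_rpow two_pos.le n0.le, Real.rpow_add n0 (a + M)]
              ring
          _ ≤ 2 ^ (2 * b) * ‖θ‖ ^ (L : ℝ) := by
              gcongr
          _ = _ := by rw [Real.rpow_natCast]
      calc ‖G (x, θ)‖ * (‖θ‖ ^ (a + M) * fd θ ^ (2 * b))
          ≤ C2 * (‖θ‖ ^ L)⁻¹ * (2 ^ (2 * b) * ‖θ‖ ^ L) :=
            mul_le_mul e e3 (by positivity) ((norm_nonneg _).trans e)
        _ = C2 * 2 ^ (2 * b) := by field_simp
        _ ≤ |C2| * 2 ^ (2 * b) := by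
            gcongr
            exact le_abs_self C2
        _ ≤ _ := le_add_of_nonneg_left (abs_nonneg _)
  rw [hF]
  refine main.trans ?_
  rw [div_le_div_iff₀ (by positivity) (by positivity), mul_assoc]
  refine mul_le_mul_of_nonneg_left ?_ (by positivity)
  calc ‖x - y‖ ^ (a + M) * X.qdist x y ^ (2 * b)
      ≤ (c' * ‖θ‖) ^ (a + M) * (c' * fd θ) ^ (2 * b) := by gcongr
    _ = _ := by
        rw [Real.mul_rpow (by positivity) n0.le, Real.mul_rpow (by positivity) f0.le]
        ring

end Frame

/-! ### Flattening of symbols -/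

section commute

variable {q : ℕ}

theorem pdker_comm {F : Pt q × Pt q → ℂ} (hF : ContDiff ℝ ∞ F) (v w) :
    pdker v (pdker w F) = pdker w (pdker v F) := by
  have e : ∀ v, pdker v F = fun z => fderiv ℝ F z (bvec v) := fun v => funext (pdker_eq v F)
  have hd : Differentiable ℝ (fderiv ℝ F) :=
    (hF.fderiv_right (m := ∞) (by simp)).differentiable (by simp)
  have h : ∀ v w z, pdker v (pdker w F) z = fderiv ℝ (fderiv ℝ F) z (bvec v) (bvec w) := by
    intro v w z
    rw [pdker_eq, e w, fderiv_clm_apply (hd z) (differentiableAt_const _)]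
    simp
  funext z
  rw [h, h]
  refine (hF.contDiffAt.isSymmSndFDerivAt ?_) _ _
  simpa using WithTop.coe_le_coe.mpr (le_top : (2 : ℕ∞) ≤ ⊤)

theorem pdSnd_coeff_mul {c : Pt q → ℝ} (hc : ContDiff ℝ ∞ c) {F : Pt q × Pt q → ℂ}
    (hF : ContDiff ℝ ∞ F) (i) :
    pdSnd i (fun z => (c z.1 : ℂ) * F z) = fun z => (c z.1 : ℂ) * pdSnd i F z := by
  have h1 : ContDiff ℝ ∞ (fun z : Pt q × Pt q => (c z.1 : ℂ)) :=
    Complex.ofRealCLM.contDiff.comp (hc.comp contDiff_fst)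
  funext z
  have h2 : pdSnd i (fun z : Pt q × Pt q => (c z.1 : ℂ)) z = 0 := by
    have : HasFDerivAt (fun z : Pt q × Pt q => (c z.1 : ℂ)) (Complex.ofRealCLM.comp
        ((fderiv ℝ c z.1).comp (ContinuousLinearMap.fst ℝ _ _))) z :=
      Complex.ofRealCLM.hasFDerivAt.comp z
        ((hc.differentiable (by simp) z.1).hasFDerivAt.comp z hasFDerivAt_fst)
    rw [pdSnd, this.fderiv]
    simp
  have := pdker_mul (h1.differentiable (by simp) z) (hF.differentiable (by simp) z) (Sum.inr i)
  refine this.trans ?_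
  change pdSnd i (fun z : Pt q × Pt q => (c z.1 : ℂ)) z * F z + _ = _
  rw [h2, zero_mul, zero_add]
  rfl

theorem pdSnd_sum {ι : Type*} {s : Finset ι} {F : ι → Pt q × Pt q → ℂ}
    (hF : ∀ i ∈ s, ContDiff ℝ ∞ (F i)) (k) :
    pdSnd k (fun z => ∑ i ∈ s, F i z) = fun z => ∑ i ∈ s, pdSnd k (F i) z := by
  funext z
  exact pdker_sum (fun i hi => (hF i hi).differentiable (by simp) z) (Sum.inr k)

theorem contDiff_coeff {c : Pt q → ℝ} (hc : ContDiff ℝ ∞ c) :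
    ContDiff ℝ ∞ (fun z : Pt q × Pt q => (c z.1 : ℂ)) :=
  Complex.ofRealCLM.contDiff.comp (hc.comp contDiff_fst)

end commute

namespace Frame

variable {q : ℕ} (X : Frame q)

/-- The derivative `∑_j B_j^k(x) ∂/∂ξ_j`, i.e. `∂/∂ζ_k` for `ξ = B(x) ζ`. -/
def E (k : Fin (q + 1)) (F : Pt q × Pt q → ℂ) : Pt q × Pt q → ℂ :=
  fun z => ∑ j, (X.B z.1 j k : ℂ) * pdSnd j F z

theorem E_last (F : Pt q × Pt q → ℂ) : X.E (Fin.last q) F = X.Dxi F := rfl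

theorem contDiff_E {F : Pt q × Pt q → ℂ} (hF : ContDiff ℝ ∞ F) (k) : ContDiff ℝ ∞ (X.E k F) :=
  ContDiff.sum fun j _ => (contDiff_coeff (X.contDiff_B j k)).mul (contDiff_pdSnd hF j)

theorem contDiff_iterate_Dxi {F : Pt q × Pt q → ℂ} (hF : ContDiff ℝ ∞ F) (β : ℕ) :
    ContDiff ℝ ∞ (X.Dxi^[β] F) := by
  induction β with
  | zero => exact hF
  | succ β ih =>
    rw [Function.iterate_succ_apply']
    exact X.contDiff_E ih (Fin.last q)

theorem contDiff_Dsym {F : Pt q × Pt q → ℂ} (hF : ContDiff ℝ ∞ F) (i) :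
    ContDiff ℝ ∞ (X.Dsym i F) := by
  refine (contDiff_pdFst hF i).add (ContDiff.sum fun k _ => ContDiff.sum fun p _ =>
    ContDiff.sum fun l _ => ContDiff.mul (Complex.ofRealCLM.contDiff.comp ?_) (contDiff_pdSnd hF k))
  exact ((((X.BD_B k p).pd i).1.comp contDiff_fst).mul ((X.smooth p l).comp contDiff_fst)).mul
    (coordForm (Sum.inr l)).contDiff

theorem contDiff_foldr_Dsym {F : Pt q × Pt q → ℂ} (hF : ContDiff ℝ ∞ F) (I : List (Fin (q + 1))) :
    ContDiff ℝ ∞ (I.foldr X.Dsym F) := by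
  induction I with
  | nil => exact hF
  | cons i I ih => exact X.contDiff_Dsym ih i

theorem pdSnd_E {F : Pt q × Pt q → ℂ} (hF : ContDiff ℝ ∞ F) (i k) :
    pdSnd i (X.E k F) = X.E k (pdSnd i F) := by
  unfold E
  rw [pdSnd_sum fun j _ => (contDiff_coeff (X.contDiff_B j k)).mul (contDiff_pdSnd hF j)]
  funext z
  refine Finset.sum_congr rfl fun j _ => ?_
  rw [pdSnd_coeff_mul (X.contDiff_B j k) (contDiff_pdSnd hF j)]
  change _ * pdSnd i (pdSnd j F) z = _
  rw [show pdSnd i (pdSnd j F) = pdSnd j (pdSnd i F) from pdker_comm hF (Sum.inr i) (Sum.inr j)]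

theorem E_comm {F : Pt q × Pt q → ℂ} (hF : ContDiff ℝ ∞ F) (k l) :
    X.E l (X.E k F) = X.E k (X.E l F) := by
  have h : ∀ k l z, X.E l (X.E k F) z = ∑ j, ∑ i, (X.B z.1 j l : ℂ) *
      ((X.B z.1 i k : ℂ) * pdSnd i (pdSnd j F) z) := by
    intro k l z
    rw [E]
    refine Finset.sum_congr rfl fun j _ => ?_
    rw [X.pdSnd_E hF, E, Finset.mul_sum]
  funext z
  rw [h, h, Finset.sum_comm]
  refine Finset.sum_congr rfl fun i _ => Finset.sum_congr rfl fun j _ => ?_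
  rw [show pdSnd i (pdSnd j F) = pdSnd j (pdSnd i F) from pdker_comm hF (Sum.inr i) (Sum.inr j)]
  ring

theorem iterate_Dxi_E {F : Pt q × Pt q → ℂ} (hF : ContDiff ℝ ∞ F) (β : ℕ) (k) :
    X.Dxi^[β] (X.E k F) = X.E k (X.Dxi^[β] F) := by
  induction β with
  | zero => rfl
  | succ β ih =>
    rw [Function.iterate_succ_apply', Function.iterate_succ_apply', ih, ← E_last, ← E_last]
    exact X.E_comm (X.contDiff_iterate_Dxi hF β) k (Fin.last q)

theorem _root_.MixedPDO.contDiff_foldr_pdSnd {F : Pt q × Pt q → ℂ} (hF : ContDiff ℝ ∞ F)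
    (α : List (Fin (q + 1))) : ContDiff ℝ ∞ (α.foldr pdSnd F) := by
  induction α with
  | nil => exact hF
  | cons i α ih => exact contDiff_pdSnd ih i

theorem foldr_pdSnd_E {F : Pt q × Pt q → ℂ} (hF : ContDiff ℝ ∞ F) (α : List (Fin (q + 1))) (k) :
    α.foldr pdSnd (X.E k F) =
      fun z => ∑ j, (X.B z.1 j k : ℂ) * (α ++ [j]).foldr pdSnd F z := by
  induction α with
  | nil => rfl
  | cons i α ih =>
    rw [List.foldr_cons, ih, pdSnd_sum fun j _ =>
      (contDiff_coeff (X.contDiff_B j k)).mul (contDiff_foldr_pdSnd hF _)]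
    funext z
    refine Finset.sum_congr rfl fun j _ => ?_
    rw [pdSnd_coeff_mul (X.contDiff_B j k) (contDiff_foldr_pdSnd hF _)]
    rfl

/-- The symbol estimates in the dual variable alone. -/
structure SB (m n : ℝ) (b : Pt q × Pt q → ℂ) : Prop where
  smooth : ContDiff ℝ ∞ b
  bound : ∀ (α : List (Fin (q + 1))) (β : ℕ), ∃ C : ℝ, ∀ x ξ : Pt q,
    ‖α.foldr pdSnd (X.Dxi^[β] b) (x, ξ)‖ ≤
      C * (1 + ‖ξ‖) ^ (m - β) * (1 + X.rho x ξ + √‖ξ‖) ^ (n - α.length)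

theorem SB.Dxi {m n : ℝ} {b : Pt q × Pt q → ℂ} (h : X.SB m n b) : X.SB (m - 1) n (X.Dxi b) := by
  refine ⟨X.contDiff_E h.1 (Fin.last q), fun α β => ?_⟩
  obtain ⟨C, hC⟩ := h.2 α (β + 1)
  refine ⟨C, fun x ξ => ?_⟩
  have := hC x ξ
  rw [Function.iterate_succ_apply, Nat.cast_succ, ← sub_sub, sub_right_comm] at this
  exact this

theorem SB.E {m n : ℝ} {b : Pt q × Pt q → ℂ} (h : X.SB m n b) (k) : X.SB m (n - 1) (X.E k b) := by
  refine ⟨X.contDiff_E h.1 k, fun α β => ?_⟩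
  choose C hC using fun j => h.2 (α ++ [j]) β
  choose D hD using fun j => (X.BD_B j k).bounded
  refine ⟨∑ j, D j * C j, fun x ξ => ?_⟩
  rw [X.iterate_Dxi_E h.1, X.foldr_pdSnd_E (X.contDiff_iterate_Dxi h.1 β), Finset.sum_mul,
    Finset.sum_mul]
  refine (norm_sum_le _ _).trans (Finset.sum_le_sum fun j _ => ?_)
  rw [norm_mul, Complex.norm_real, Real.norm_eq_abs]
  have h1 := hC j x ξ
  rw [List.length_append, List.length_singleton, Nat.cast_add, Nat.cast_one, add_comm (α.length : ℝ),
    ← sub_sub] at h1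
  rw [mul_assoc (D j), mul_assoc (D j)]
  exact mul_le_mul (hD j x) h1 (norm_nonneg _) ((abs_nonneg _).trans (hD j x))

/-- `B(x) ζ`. -/
def xi (z : Pt q × Pt q) : Pt q := WithLp.toLp 2 fun j => ∑ k, X.B z.1 j k * z.2 k

/-- `(x, ζ) ↦ (x, B(x) ζ)`. -/
def Psi (z : Pt q × Pt q) : Pt q × Pt q := (z.1, X.xi z)

theorem xi_apply (z : Pt q × Pt q) (j) : X.xi z j = ∑ k, X.B z.1 j k * z.2 k := rfl

theorem sum_A_mul_xi (z : Pt q × Pt q) (p) : ∑ l, X.A z.1 p l * X.xi z l = z.2 p := by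
  simp only [xi_apply, Finset.mul_sum]
  rw [Finset.sum_comm]
  simp only [← mul_assoc, ← Finset.sum_mul, sum_A_mul_B]
  simp

theorem M_Psi (z : Pt q × Pt q) (p) : X.M z.1 (X.xi z) p = z.2 p := X.sum_A_mul_xi z p

theorem rho_Psi (z : Pt q × Pt q) : X.rho z.1 (X.xi z) = pn z.2 := by
  simp only [rho, M_Psi, pn]

theorem exists_norm_xi_le : ∃ C : ℝ, 1 ≤ C ∧ ∀ z, ‖X.xi z‖ ≤ C * ‖z.2‖ ∧ ‖z.2‖ ≤ C * ‖X.xi z‖ := by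
  obtain ⟨C, -, hC⟩ := exists_norm_le_of_BD X.BD_B
  obtain ⟨D, -, hD⟩ := exists_norm_le_of_BD X.BD_A
  refine ⟨max 1 (max C D), le_max_left _ _, fun z => ⟨?_, ?_⟩⟩
  · refine (hC z.1 _ _ fun i => rfl).trans ?_
    gcongr
    exact (le_max_left C D).trans (le_max_right _ _)
  · refine (hD z.1 _ _ fun i => (X.sum_A_mul_xi z i).symm).trans ?_
    gcongr
    exact (le_max_right C D).trans (le_max_right _ _)

theorem contDiff_xi : ContDiff ℝ ∞ X.xi := by
  refine contDiff_euclidean.mpr fun j => ?_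
  simp only [xi_apply]
  refine ContDiff.sum fun k _ => ?_
  exact ((X.contDiff_B j k).comp contDiff_fst).mul (coordForm (Sum.inr k)).contDiff

theorem contDiff_Psi : ContDiff ℝ ∞ X.Psi := contDiff_fst.prodMk X.contDiff_xi

theorem fderiv_Psi (z w : Pt q × Pt q) : fderiv ℝ X.Psi z w = (w.1, WithLp.toLp 2 fun j =>
    ∑ k, ((∑ l, w.1 l * pd l (fun x => X.B x j k) z.1) * z.2 k + X.B z.1 j k * w.2 k)) := by
  have h1 : ∀ j k, HasFDerivAt (fun z : Pt q × Pt q => X.B z.1 j k * z.2 k)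
      (X.B z.1 j k • coordForm (Sum.inr k) +
        z.2 k • (fderiv ℝ (fun x => X.B x j k) z.1).comp (ContinuousLinearMap.fst ℝ _ _)) z :=
    fun j k => HasFDerivAt.mul
      ((((X.contDiff_B j k).differentiable (by simp) z.1).hasFDerivAt).comp z hasFDerivAt_fst)
      (coordForm (Sum.inr k)).hasFDerivAt
  have h2 := (X.contDiff_Psi.differentiable (by simp) z).hasFDerivAt
  have h3 : HasFDerivAt (fun z : Pt q × Pt q => z.1)
      ((ContinuousLinearMap.fst ℝ (Pt q) (Pt q)).comp (fderiv ℝ X.Psi z)) z :=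
    HasFDerivAt.comp (f := X.Psi) (g := fun z : Pt q × Pt q => z.1) z
      (ContinuousLinearMap.fst ℝ (Pt q) (Pt q)).hasFDerivAt h2
  refine Prod.ext (DFunLike.congr_fun (h3.unique hasFDerivAt_fst) w) ?_
  ext j
  have h4 : HasFDerivAt (fun z => X.xi z j)
      (((EuclideanSpace.proj j : Pt q →L[ℝ] ℝ).comp (ContinuousLinearMap.snd ℝ _ _)).comp
        (fderiv ℝ X.Psi z)) z :=
    ((EuclideanSpace.proj j : Pt q →L[ℝ] ℝ).comp
      (ContinuousLinearMap.snd ℝ (Pt q) (Pt q))).hasFDerivAt.comp z h2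
  have h5 := HasFDerivAt.fun_sum fun k (_ : k ∈ Finset.univ) => h1 j k
  have h6 := DFunLike.congr_fun (h4.unique h5) w
  simp only [sum_apply] at h6
  refine (show (fderiv ℝ X.Psi z w).2 j = _ from h6).trans (Finset.sum_congr rfl fun k _ => ?_)
  simp only [add_apply, smul_apply, smul_eq_mul, ContinuousLinearMap.comp_apply,
    ContinuousLinearMap.coe_fst', fderiv_apply_eq_sum_pd]
  simp only [coordForm, ContinuousLinearMap.comp_apply,
    ContinuousLinearMap.coe_snd', PiLp.proj_apply]
  ring

theorem pdSnd_comp_Psi {F : Pt q × Pt q → ℂ} (hF : ContDiff ℝ ∞ F) (k) (z : Pt q × Pt q) :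
    pdSnd k (fun z => F (X.Psi z)) z = X.E k F (X.Psi z) := by
  have h1 : HasFDerivAt (fun z => F (X.Psi z)) ((fderiv ℝ F (X.Psi z)).comp (fderiv ℝ X.Psi z)) z :=
    (hF.differentiable (by simp) _).hasFDerivAt.comp z
      (X.contDiff_Psi.differentiable (by simp) z).hasFDerivAt
  rw [pdSnd, h1.fderiv, ContinuousLinearMap.comp_apply, fderiv_apply_pair, fderiv_Psi]
  simp [basisVec, E, Psi]

theorem pdFst_comp_Psi {F : Pt q × Pt q → ℂ} (hF : ContDiff ℝ ∞ F) (i) :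
    pdFst i (fun z => F (X.Psi z)) = fun z => X.Dsym i F (X.Psi z) := by
  funext z
  have h1 : HasFDerivAt (fun z => F (X.Psi z)) ((fderiv ℝ F (X.Psi z)).comp (fderiv ℝ X.Psi z)) z :=
    (hF.differentiable (by simp) _).hasFDerivAt.comp z
      (X.contDiff_Psi.differentiable (by simp) z).hasFDerivAt
  rw [pdFst, h1.fderiv, ContinuousLinearMap.comp_apply, fderiv_apply_pair, fderiv_Psi, Dsym]
  congr 1
  · simp [basisVec, apply_ite Complex.ofReal]
  · refine Finset.sum_congr rfl fun k _ => ?_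
    simp only [← Finset.sum_mul, ← Complex.ofReal_sum]
    congr 2
    refine Finset.sum_congr rfl fun p _ => ?_
    simp only [Psi, mul_assoc, ← Finset.mul_sum, sum_A_mul_xi]
    simp [basisVec]

theorem foldr_pdFst_comp_Psi {F : Pt q × Pt q → ℂ} (hF : ContDiff ℝ ∞ F)
    (I : List (Fin (q + 1))) :
    I.foldr pdFst (fun z => F (X.Psi z)) = fun z => I.foldr X.Dsym F (X.Psi z) := by
  induction I with
  | nil => rfl
  | cons i I ih => rw [List.foldr_cons, ih, X.pdFst_comp_Psi (X.contDiff_foldr_Dsym hF I)]; rfl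

theorem _root_.MixedPDO.rpow_le_of_equiv {c r s : ℝ} (hc : 1 ≤ c) (hr : 0 < r) (hs : 0 < s)
    (h1 : r ≤ c * s) (h2 : s ≤ c * r) (m : ℝ) : r ^ m ≤ c ^ |m| * s ^ m := by
  have c0 : 0 < c := one_pos.trans_le hc
  rcases le_total 0 m with hm | hm
  · rw [abs_of_nonneg hm, ← Real.mul_rpow c0.le hs.le]
    gcongr
  · rw [abs_of_nonpos hm, Real.rpow_neg c0.le, ← Real.inv_rpow c0.le,
      ← Real.mul_rpow (by positivity) hs.le]
    refine Real.rpow_le_rpow_of_nonpos (by positivity) ?_ hm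
    rwa [inv_mul_le_iff₀ c0]

theorem SB.norm_le {m n : ℝ} {b : Pt q × Pt q → ℂ} (h : X.SB m n b) :
    ∃ C : ℝ, ∀ z, ‖b (X.Psi z)‖ ≤ C * (wR z.2 ^ m * wS z.2 ^ n) := by
  obtain ⟨C, hC⟩ := h.2 [] 0
  obtain ⟨c, c1, hc⟩ := X.exists_norm_xi_le
  have c0 : 0 < c := one_pos.trans_le c1
  refine ⟨|C| * c ^ |m| * c ^ |n|, fun z => ?_⟩
  obtain ⟨h1, h2⟩ := hc z
  have h3 : ∀ {u v : ℝ}, 0 ≤ u → 0 ≤ v → u ≤ c * v → √u ≤ c * √v := by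
    intro u v hu hv huv
    refine (Real.sqrt_le_sqrt huv).trans ?_
    rw [Real.sqrt_mul c0.le]
    gcongr
    exact Real.sqrt_le_iff.mpr ⟨c0.le, by nlinarith⟩
  have h4 := h3 (norm_nonneg _) (norm_nonneg _) h1
  have h5 := h3 (norm_nonneg _) (norm_nonneg _) h2
  have p0 : 0 ≤ pn z.2 := Real.sqrt_nonneg _
  have s1 := Real.sqrt_nonneg ‖X.xi z‖
  have s2 := Real.sqrt_nonneg ‖z.2‖
  have e := hC z.1 (X.xi z)
  simp only [List.length_nil, Nat.cast_zero, sub_zero, X.rho_Psi] at e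
  refine (show ‖b (X.Psi z)‖ ≤ _ from e).trans ?_
  have r1 := rpow_le_of_equiv (r := 1 + ‖X.xi z‖) (s := wR z.2) c1 (by positivity) (wR_pos _)
    (by unfold wR; nlinarith) (by unfold wR; nlinarith) m
  have r2 := rpow_le_of_equiv (r := 1 + pn z.2 + √‖X.xi z‖) (s := wS z.2) c1 (by positivity)
    (wS_pos _) (by unfold wS; nlinarith) (by unfold wS; nlinarith) n
  have w1 := wR_pos z.2
  have w2 := wS_pos z.2
  calc C * (1 + ‖X.xi z‖) ^ m * (1 + pn z.2 + √‖X.xi z‖) ^ n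
      ≤ |C| * (c ^ |m| * wR z.2 ^ m) * (c ^ |n| * wS z.2 ^ n) := by
        gcongr
        exact le_abs_self C
    _ = _ := by ring

theorem SB.WB {m n : ℝ} {b : Pt q × Pt q → ℂ} (h : X.SB m n b) (j : ℕ) :
    WB id wt0 j (fun (_ : Pt q) ζ => wR ζ ^ m * wS ζ ^ n) (fun x ζ => b (X.Psi (x, ζ))) := by
  induction j generalizing m n b with
  | zero =>
    obtain ⟨C, hC⟩ := SB.norm_le X h
    exact ⟨C, fun x ζ => hC (x, ζ)⟩
  | succ j ih =>
    obtain ⟨C, hC⟩ := SB.norm_le X h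
    refine ⟨⟨C, fun x ζ => hC (x, ζ)⟩, fun k => ?_⟩
    have e : (fun (x ζ : Pt q) => fderiv ℝ (fun ζ => b (X.Psi (x, ζ))) ζ (basisVec (id k))) =
        fun x ζ => X.E k b (X.Psi (x, ζ)) := by
      funext x ζ
      rw [← X.pdSnd_comp_Psi h.1, pdSnd]
      have h1 : HasFDerivAt (fun z => b (X.Psi z)) _ (x, ζ) :=
        ((h.1.comp X.contDiff_Psi).differentiable (by simp) (x, ζ)).hasFDerivAt
      have h2 : HasFDerivAt (fun ζ : Pt q => (x, ζ))
          ((0 : Pt q →L[ℝ] Pt q).prod (ContinuousLinearMap.id ℝ (Pt q))) ζ :=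
        (hasFDerivAt_const x ζ).prodMk (hasFDerivAt_id ζ)
      have h3 : HasFDerivAt (fun ζ => b (X.Psi (x, ζ))) _ ζ := h1.comp ζ h2
      rw [h3.fderiv, h1.fderiv]
      simp
    rw [e]
    by_cases hk : k = Fin.last q
    · subst hk
      have := ih (SB.Dxi X h)
      rw [E_last]
      convert this using 3 with x ζ
      rw [wt0, if_pos rfl, Real.rpow_sub_one (wR_pos ζ).ne']
      ring
    · have := ih (SB.E X h k)
      convert this using 3 with x ζ
      rw [wt0, if_neg hk, Real.rpow_sub_one (wS_pos ζ).ne']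
      ring

theorem IsSymbol.isFlat {m n : ℝ} {a : Pt q × Pt q → ℂ} (ha : X.IsSymbol m n a) :
    IsFlat m n (fun z => a (X.Psi z)) := by
  refine ⟨ha.1.comp X.contDiff_Psi, fun I j => ?_⟩
  rw [X.foldr_pdFst_comp_Psi ha.1]
  exact SB.WB X ⟨X.contDiff_foldr_Dsym ha.1 I, fun α β => ha.2 α β I⟩ j

end Frame

/-! ### The distribution kernel -/

section distribution

variable {q : ℕ}

/-- The integrable weight `(1 + ‖x‖)^{-r}`. -/
def dec {q : ℕ} (r : ℕ) (x : Pt q) : ℝ := ((1 + ‖x‖) ^ r)⁻¹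

theorem dec_pos (r : ℕ) (x : Pt q) : 0 < dec r x := by unfold dec; positivity

theorem integrable_dec : Integrable (dec (q + 2) : Pt q → ℝ) := by
  have h : ((Module.finrank ℝ (Pt q) : ℕ) : ℝ) < ((q + 2 : ℕ) : ℝ) := by
    rw [finrank_euclideanSpace, Fintype.card_fin]
    exact_mod_cast Nat.lt_succ_self _
  refine (integrable_one_add_norm h).congr (ae_of_all _ fun x => ?_)
  dsimp only
  rw [Real.rpow_neg (by positivity), Real.rpow_natCast, dec]

/-- The seminorm of order `(2q + 4, L)`. -/
def semi (L : ℕ) : Seminorm ℂ 𝓢(Pt q × Pt q, ℂ) :=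
  (Finset.Iic (2 * (q + 2), L)).sup fun m => SchwartzMap.seminorm ℂ m.1 m.2

theorem norm_iteratedFDeriv_slice_le (Φ : 𝓢(Pt q × Pt q, ℂ)) (x y : Pt q) (p : ℕ) :
    ‖iteratedFDeriv ℝ p (fun y => Φ (x, y)) y‖ ≤ ‖iteratedFDeriv ℝ p Φ (x, y)‖ := by
  have h0 : ContDiff ℝ p (fun w => Φ ((x, 0) + w)) :=
    (Φ.smooth p).comp (contDiff_const.add contDiff_id)
  have h := (ContinuousLinearMap.inr ℝ (Pt q) (Pt q)).iteratedFDeriv_comp_right h0 y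
    (le_refl (p : WithTop ℕ∞))
  have e : (fun y => Φ (x, y)) =
      (fun w => Φ ((x, 0) + w)) ∘ (ContinuousLinearMap.inr ℝ (Pt q) (Pt q)) := by
    funext y
    simp
  rw [e, h, iteratedFDeriv_comp_add_left]
  refine (ContinuousMultilinearMap.norm_compContinuousLinearMap_le _ _).trans ?_
  simp only [ContinuousLinearMap.inr_apply, Prod.mk_add_mk, add_zero, zero_add]
  refine mul_le_of_le_one_right (norm_nonneg _) ?_
  exact Finset.prod_le_one (fun _ _ => norm_nonneg _) fun _ _ => ContinuousLinearMap.norm_inr_le_one ..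

theorem norm_iteratedFDeriv_slice_le_dec (Φ : 𝓢(Pt q × Pt q, ℂ)) (x y : Pt q) {p L : ℕ}
    (hp : p ≤ L) : ‖iteratedFDeriv ℝ p (fun y => Φ (x, y)) y‖ ≤
      2 ^ (2 * (q + 2)) * semi L Φ * dec (q + 2) x * dec (q + 2) y := by
  have h := SchwartzMap.one_add_le_sup_seminorm_apply (𝕜 := ℂ) (m := (2 * (q + 2), L))
    (le_refl (2 * (q + 2))) hp Φ (x, y)
  have hz : (1 + ‖x‖) ^ (q + 2) * (1 + ‖y‖) ^ (q + 2) ≤ (1 + ‖(x, y)‖) ^ (2 * (q + 2)) := by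
    rw [two_mul, pow_add _ (q + 2) (q + 2)]
    have h1 : ‖x‖ ≤ ‖(x, y)‖ := norm_fst_le (x, y)
    have h2 : ‖y‖ ≤ ‖(x, y)‖ := norm_snd_le (x, y)
    gcongr
  have h3 : (1 + ‖x‖) ^ (q + 2) * (1 + ‖y‖) ^ (q + 2) *
      ‖iteratedFDeriv ℝ p (fun y => Φ (x, y)) y‖ ≤ 2 ^ (2 * (q + 2)) * semi L Φ := by
    exact (mul_le_mul hz (norm_iteratedFDeriv_slice_le Φ x y p) (norm_nonneg _)
      (by positivity)).trans h
  rw [dec, dec, mul_assoc _ (_⁻¹), ← mul_inv, ← div_eq_mul_inv, le_div_iff₀ (by positivity)]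
  linarith

theorem contDiff_slice_schwartz (Φ : 𝓢(Pt q × Pt q, ℂ)) (x : Pt q) :
    ContDiff ℝ ∞ (fun y => Φ (x, y)) := (Φ.smooth ⊤).comp (contDiff_const.prodMk contDiff_id)

theorem integrable_iteratedFDeriv_slice (Φ : 𝓢(Pt q × Pt q, ℂ)) (x : Pt q) (p : ℕ) :
    Integrable (fun y => ‖iteratedFDeriv ℝ p (fun y => Φ (x, y)) y‖) := by
  refine Integrable.mono' (integrable_dec.const_mul (2 ^ (2 * (q + 2)) * semi p Φ * dec (q + 2) x))
    ?_ (ae_of_all _ fun y => ?_)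
  · exact ((contDiff_slice_schwartz Φ x).continuous_iteratedFDeriv
      (by exact_mod_cast le_top)).norm.aestronglyMeasurable
  · rw [norm_norm]
    exact norm_iteratedFDeriv_slice_le_dec Φ x y le_rfl

theorem integrable_slice (Φ : 𝓢(Pt q × Pt q, ℂ)) (x : Pt q) : Integrable (fun y => Φ (x, y)) := by
  have := integrable_iteratedFDeriv_slice Φ x 0
  simp only [norm_iteratedFDeriv_zero] at this
  exact (integrable_norm_iff (contDiff_slice_schwartz Φ x).continuous.aestronglyMeasurable).mp this

/-- The partial Fourier transform in the second variable. -/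
def FT2 (Φ : 𝓢(Pt q × Pt q, ℂ)) (z : Pt q × Pt q) : ℂ := 𝓕 (fun y => Φ (z.1, y)) z.2

theorem FT2_eq (Φ : 𝓢(Pt q × Pt q, ℂ)) (z : Pt q × Pt q) :
    FT2 Φ z = ∫ y, Φ (z.1, y) * chr (-y) z.2 := by
  rw [FT2, Real.fourier_eq']
  congr 1
  funext y
  rw [smul_eq_mul, mul_comm, chr, inner_neg_left]
  congr 2
  push_cast
  ring

theorem norm_FT2_le (L : ℕ) : ∃ C : ℝ, 0 ≤ C ∧ ∀ (Φ : 𝓢(Pt q × Pt q, ℂ)) (x ξ : Pt q),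
    ‖FT2 Φ (x, ξ)‖ ≤ C * semi L Φ * (dec (q + 2) x * dec L ξ) := by
  obtain ⟨I, hI⟩ : ∃ I, I = ∫ y : Pt q, dec (q + 2) y := ⟨_, rfl⟩
  have I0 : 0 ≤ I := hI ▸ integral_nonneg fun y => (dec_pos _ y).le
  refine ⟨2 ^ L * (2 * (2 ^ L * ((L + 1) * (2 ^ (2 * (q + 2)) * I)))), by positivity,
    fun Φ x ξ => ?_⟩
  obtain ⟨D, hD⟩ : ∃ D, D = 2 ^ (2 * (q + 2)) * semi L Φ * dec (q + 2) x * I := ⟨_, rfl⟩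
  have S0 : 0 ≤ semi L Φ := apply_nonneg _ _
  have D0 : 0 ≤ D := by
    rw [hD]
    exact mul_nonneg (mul_nonneg (mul_nonneg (by positivity) S0) (dec_pos _ _).le) I0
  have hint : ∀ p ≤ L, ∫ y, ‖iteratedFDeriv ℝ p (fun y => Φ (x, y)) y‖ ≤ D := by
    intro p hp
    rw [hD, hI, ← integral_const_mul]
    exact integral_mono (integrable_iteratedFDeriv_slice Φ x p) (integrable_dec.const_mul _)
      fun y => norm_iteratedFDeriv_slice_le_dec Φ x y hp
  have key : ∀ n ≤ L, ‖ξ‖ ^ n * ‖FT2 Φ (x, ξ)‖ ≤ 2 ^ L * ((L + 1) * D) := by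
    intro n hn
    have h := Real.pow_mul_norm_iteratedFDeriv_fourier_le (K := 0) (N := ⊤)
      (contDiff_slice_schwartz Φ x) (fun k n hk _ => by
        have hk0 : k = 0 := by exact_mod_cast (nonpos_iff_eq_zero.mp hk)
        subst hk0
        simpa using integrable_iteratedFDeriv_slice Φ x n) (k := 0) (n := n) (by simp) le_top ξ
    simp only [norm_iteratedFDeriv_zero] at h
    refine (show ‖ξ‖ ^ n * ‖FT2 Φ (x, ξ)‖ ≤ _ from h).trans ?_
    have hs : ∑ p ∈ Finset.range (0 + 1) ×ˢ Finset.range (n + 1),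
        ∫ y, ‖y‖ ^ p.1 * ‖iteratedFDeriv ℝ p.2 (fun y => Φ (x, y)) y‖ ≤ (L + 1) * D := by
      rw [Finset.sum_product]
      simp only [zero_add, Finset.range_one, Finset.sum_singleton, pow_zero, one_mul]
      refine (Finset.sum_le_card_nsmul _ _ D fun p hp => hint p ?_).trans ?_
      · have := Finset.mem_range.mp hp
        omega
      · rw [Finset.card_range, nsmul_eq_mul]
        push_cast
        have : (n : ℝ) ≤ L := by exact_mod_cast hn
        gcongr
    have hpow : (2 * Real.pi) ^ 0 * (2 * ((0 : ℕ) : ℝ) + 2) ^ n ≤ (2 : ℝ) ^ L := by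
      rw [pow_zero, one_mul, Nat.cast_zero, mul_zero, zero_add]
      exact pow_le_pow_right₀ one_le_two hn
    exact mul_le_mul hpow hs (Finset.sum_nonneg fun p _ => integral_nonneg fun y => by positivity)
      (by positivity)
  have h0 := key 0 (Nat.zero_le L)
  have h1 := key L le_rfl
  have h2 : (1 + ‖ξ‖) ^ L ≤ 2 ^ L * (1 + ‖ξ‖ ^ L) := by
    have := add_pow_le zero_le_one (norm_nonneg ξ) L
    rw [one_pow] at this
    refine this.trans ?_
    gcongr
    · exact one_le_two
    · omega
  have h3 : (1 + ‖ξ‖) ^ L * ‖FT2 Φ (x, ξ)‖ ≤ 2 ^ L * (2 * (2 ^ L * ((L + 1) * D))) := by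
    calc (1 + ‖ξ‖) ^ L * ‖FT2 Φ (x, ξ)‖ ≤ 2 ^ L * (1 + ‖ξ‖ ^ L) * ‖FT2 Φ (x, ξ)‖ := by gcongr
      _ = 2 ^ L * (‖ξ‖ ^ 0 * ‖FT2 Φ (x, ξ)‖ + ‖ξ‖ ^ L * ‖FT2 Φ (x, ξ)‖) := by ring
      _ ≤ 2 ^ L * (2 ^ L * ((L + 1) * D) + 2 ^ L * ((L + 1) * D)) := by gcongr
      _ = _ := by ring
  have h4 : ‖FT2 Φ (x, ξ)‖ ≤ 2 ^ L * (2 * (2 ^ L * ((L + 1) * D))) * dec L ξ := by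
    rw [dec, ← div_eq_mul_inv, le_div_iff₀ (by positivity)]
    linarith
  refine h4.trans (le_of_eq ?_)
  rw [hD]
  ring

theorem continuous_chr_comp {α : Type*} [TopologicalSpace α] {f g : α → Pt q} (hf : Continuous f)
    (hg : Continuous g) : Continuous fun t => chr (f t) (g t) :=
  (contDiff_chr_uncurry (q := q) (n := 0)).continuous.comp (hf.prodMk hg)

theorem stronglyMeasurable_FT2 (Φ : 𝓢(Pt q × Pt q, ℂ)) : StronglyMeasurable (FT2 Φ) := by
  rw [funext (FT2_eq Φ)]
  refine StronglyMeasurable.integral_prod_right 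
    (f := fun (z : Pt q × Pt q) y => Φ (z.1, y) * chr (-y) z.2) ?_
  refine Continuous.stronglyMeasurable ?_
  have h1 : Continuous fun w : (Pt q × Pt q) × Pt q => Φ (w.1.1, w.2) :=
    Φ.continuous.comp (by fun_prop)
  exact h1.mul (continuous_chr_comp (by fun_prop) (by fun_prop))

theorem FT2_add (Φ Ψ : 𝓢(Pt q × Pt q, ℂ)) (z) : FT2 (Φ + Ψ) z = FT2 Φ z + FT2 Ψ z := by
  have h : ∀ Φ : 𝓢(Pt q × Pt q, ℂ), Integrable fun y => Φ (z.1, y) * chr (-y) z.2 := by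
    intro Φ
    refine (integrable_slice Φ z.1).mul_bdd (c := 1)
      (continuous_chr_comp (by fun_prop) (by fun_prop)).aestronglyMeasurable
      (ae_of_all _ fun y => (norm_chr _ _).le)
  rw [FT2_eq, FT2_eq, FT2_eq, ← integral_add (h Φ) (h Ψ)]
  congr 1
  funext y
  rw [add_apply, add_mul]

theorem FT2_smul (c : ℂ) (Φ : 𝓢(Pt q × Pt q, ℂ)) (z) : FT2 (c • Φ) z = c * FT2 Φ z := by
  rw [FT2_eq, FT2_eq, ← integral_const_mul]
  congr 1
  funext y
  rw [smul_apply, smul_eq_mul, mul_assoc]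

theorem tensor_apply (g f : 𝓢(Pt q, ℂ)) (x y : Pt q) : tensor g f (x, y) = g x * f y := rfl

theorem FT2_tensor (g f : 𝓢(Pt q, ℂ)) (z : Pt q × Pt q) :
    FT2 (tensor g f) z = g z.1 * 𝓕 (f : Pt q → ℂ) z.2 := by
  rw [FT2, Real.fourier_eq', Real.fourier_eq', ← integral_const_mul]
  congr 1
  funext y
  simp only [tensor_apply, smul_eq_mul]
  ring

/-- Symbols of polynomial growth in `ξ`. -/
def PolyGrowth (a : Pt q × Pt q → ℂ) : Prop :=
  ∃ (C : ℝ) (K : ℕ), ∀ x ξ : Pt q, ‖a (x, ξ)‖ ≤ C * (1 + ‖ξ‖) ^ K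

/-- The integrand of `⟨K, Φ⟩ = ∬ a(x,ξ) e^{2πi x·ξ} Φ̂(x, ξ)`. -/
def kerIntegrand (a : Pt q × Pt q → ℂ) (Φ : 𝓢(Pt q × Pt q, ℂ)) (z : Pt q × Pt q) : ℂ :=
  a z * chr z.1 z.2 * FT2 Φ z

theorem norm_kerIntegrand_le {a : Pt q × Pt q → ℂ} (ha : PolyGrowth a) :
    ∃ (C : ℝ) (L : ℕ), 0 ≤ C ∧ ∀ (Φ : 𝓢(Pt q × Pt q, ℂ)) (z : Pt q × Pt q),
      ‖kerIntegrand a Φ z‖ ≤ C * semi L Φ * (dec (q + 2) z.1 * dec (q + 2) z.2) := by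
  obtain ⟨C, K, hC⟩ := ha
  obtain ⟨D, D0, hD⟩ := norm_FT2_le (q := q) (K + (q + 2))
  refine ⟨|C| * D, K + (q + 2), by positivity, fun Φ z => ?_⟩
  rw [kerIntegrand, norm_mul, norm_mul, norm_chr, mul_one]
  have S0 : 0 ≤ semi (K + (q + 2)) Φ := apply_nonneg _ _
  have d1 := dec_pos (q + 2) z.1
  have d2 := dec_pos (K + (q + 2)) z.2
  calc ‖a z‖ * ‖FT2 Φ z‖ ≤ (|C| * (1 + ‖z.2‖) ^ K) *
        (D * semi (K + (q + 2)) Φ * (dec (q + 2) z.1 * dec (K + (q + 2)) z.2)) := by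
        refine mul_le_mul ((hC z.1 z.2).trans ?_) (hD Φ z.1 z.2) (norm_nonneg _) (by positivity)
        gcongr
        exact le_abs_self C
    _ = _ := by
        have e : (1 + ‖z.2‖) ^ K * dec (K + (q + 2)) z.2 = dec (q + 2) z.2 := by
          rw [dec, dec, pow_add]
          field_simp
        rw [← e]
        ring

theorem integrable_dec_prod :
    Integrable (fun z : Pt q × Pt q => dec (q + 2) z.1 * dec (q + 2) z.2) :=
  integrable_dec.mul_prod integrable_dec

theorem integrable_kerIntegrand {a : Pt q × Pt q → ℂ} (hc : Continuous a) (ha : PolyGrowth a)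
    (Φ : 𝓢(Pt q × Pt q, ℂ)) : Integrable (kerIntegrand a Φ) := by
  obtain ⟨C, L, -, hC⟩ := norm_kerIntegrand_le ha
  refine Integrable.mono' (integrable_dec_prod.const_mul (C * semi L Φ)) ?_ (ae_of_all _ (hC Φ))
  exact (hc.mul (continuous_chr_comp continuous_fst continuous_snd)).aestronglyMeasurable.mul
    (stronglyMeasurable_FT2 Φ).aestronglyMeasurable

/-- The distribution `Φ ↦ ∬ a(x,ξ) e^{2πi x·ξ} Φ̂(x, ξ)` as a continuous functional. -/
def kerCLM (a : Pt q × Pt q → ℂ) (hc : Continuous a) (ha : PolyGrowth a) :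
    𝓢(Pt q × Pt q, ℂ) →L[ℂ] ℂ :=
  SchwartzMap.mkCLMtoNormedSpace (fun Φ => ∫ z, kerIntegrand a Φ z)
    (fun Φ Ψ => by
      rw [← integral_add (integrable_kerIntegrand hc ha Φ) (integrable_kerIntegrand hc ha Ψ)]
      congr 1
      funext z
      simp only [kerIntegrand, FT2_add, mul_add])
    (fun c Φ => by
      rw [RingHom.id_apply, smul_eq_mul, ← integral_const_mul]
      congr 1
      funext z
      simp only [kerIntegrand, FT2_smul]
      ring)
    (by
      obtain ⟨C, L, C0, hC⟩ := norm_kerIntegrand_le ha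
      refine ⟨Finset.Iic (2 * (q + 2), L), C * ∫ z : Pt q × Pt q, dec (q + 2) z.1 * dec (q + 2) z.2,
        mul_nonneg C0 (integral_nonneg fun z => (mul_pos (dec_pos _ _) (dec_pos _ _)).le),
        fun Φ => ?_⟩
      refine (norm_integral_le_of_norm_le (integrable_dec_prod.const_mul (C * semi L Φ))
        (ae_of_all _ (hC Φ))).trans (le_of_eq ?_)
      rw [integral_const_mul]
      change C * semi L Φ * _ = C * _ * semi L Φ
      ring)

/-- The distribution kernel of `T_a`. -/
def kerDist (a : Pt q × Pt q → ℂ) (hc : Continuous a) (ha : PolyGrowth a) : 𝓢'(Pt q × Pt q, ℂ) :=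
  ContinuousLinearMap.toPointwiseConvergenceCLM ℂ (RingHom.id ℂ) _ _ (kerCLM a hc ha)

theorem kerDist_apply {a : Pt q × Pt q → ℂ} (hc : Continuous a) (ha : PolyGrowth a)
    (Φ : 𝓢(Pt q × Pt q, ℂ)) : kerDist a hc ha Φ = ∫ z, kerIntegrand a Φ z := rfl

theorem opIntegrand_eq (a : Pt q × Pt q → ℂ) (f : 𝓢(Pt q, ℂ)) (x ξ : Pt q) :
    opIntegrand a f x ξ = a (x, ξ) * 𝓕 (f : Pt q → ℂ) ξ * chr x ξ := rfl

theorem integrable_opIntegrand {a : Pt q × Pt q → ℂ} (hc : Continuous a) (ha : PolyGrowth a)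
    (f : 𝓢(Pt q, ℂ)) (x : Pt q) : Integrable (opIntegrand a f x) := by
  obtain ⟨C, K, hC⟩ := ha
  have hF := (𝓕 f).one_add_le_sup_seminorm_apply (𝕜 := ℂ) (m := (K + (q + 2), 0))
    (le_refl _) (le_refl 0)
  set S := 2 ^ (K + (q + 2)) * ((Finset.Iic (K + (q + 2), 0)).sup
    fun m => SchwartzMap.seminorm ℂ m.1 m.2) (𝓕 f)
  simp only [norm_iteratedFDeriv_zero, SchwartzMap.fourier_coe] at hF
  refine Integrable.mono' (integrable_dec.const_mul (|C| * S)) ?_ (ae_of_all _ fun ξ => ?_)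
  · have h1 : Continuous (𝓕 (f : Pt q → ℂ)) := by
      rw [← SchwartzMap.fourier_coe]
      exact (𝓕 f).continuous
    have h2 : Continuous fun ξ => a (x, ξ) := by fun_prop
    exact ((h2.mul h1).mul (continuous_chr_comp continuous_const continuous_id)).aestronglyMeasurable
  · rw [opIntegrand_eq, norm_mul, norm_mul, norm_chr, mul_one, dec, ← div_eq_mul_inv,
      le_div_iff₀ (by positivity)]
    calc ‖a (x, ξ)‖ * ‖𝓕 (f : Pt q → ℂ) ξ‖ * (1 + ‖ξ‖) ^ (q + 2)
        ≤ |C| * (1 + ‖ξ‖) ^ K * ‖𝓕 (f : Pt q → ℂ) ξ‖ * (1 + ‖ξ‖) ^ (q + 2) := by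
          gcongr
          refine (hC x ξ).trans ?_
          gcongr
          exact le_abs_self C
      _ = |C| * ((1 + ‖ξ‖) ^ (K + (q + 2)) * ‖𝓕 (f : Pt q → ℂ) ξ‖) := by rw [pow_add]; ring
      _ ≤ |C| * S := by
          gcongr
          exact hF ξ

theorem kerIntegrand_tensor (a : Pt q × Pt q → ℂ) (g f : 𝓢(Pt q, ℂ)) (x ξ : Pt q) :
    kerIntegrand a (tensor g f) (x, ξ) = opIntegrand a f x ξ * g x := by
  rw [kerIntegrand, FT2_tensor, opIntegrand_eq]
  ring

theorem integral_kerIntegrand_tensor (a : Pt q × Pt q → ℂ) (g f : 𝓢(Pt q, ℂ)) (x : Pt q) :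
    ∫ ξ, kerIntegrand a (tensor g f) (x, ξ) = op a f x * g x := by
  simp only [kerIntegrand_tensor, integral_mul_const]
  rfl

theorem integrable_op_mul {a : Pt q × Pt q → ℂ} (hc : Continuous a) (ha : PolyGrowth a)
    (f g : 𝓢(Pt q, ℂ)) : Integrable (fun x => op a f x * g x) := by
  simp only [← integral_kerIntegrand_tensor]
  exact (integrable_kerIntegrand hc ha (tensor g f)).integral_prod_left

theorem integral_op_mul {a : Pt q × Pt q → ℂ} (hc : Continuous a) (ha : PolyGrowth a)
    (f g : 𝓢(Pt q, ℂ)) : ∫ x, op a f x * g x = kerDist a hc ha (tensor g f) := by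
  simp only [← integral_kerIntegrand_tensor]
  rw [kerDist_apply]
  exact (integral_prod _ (integrable_kerIntegrand hc ha (tensor g f))).symm

end distribution

/-! ### The density of the kernel off the diagonal -/

theorem chr_mul_chr_neg {q : ℕ} (x y ξ : Pt q) : chr x ξ * chr (-y) ξ = chr (x - y) ξ := by
  rw [chr, chr, chr, ← Complex.exp_add, inner_neg_left, inner_sub_left]
  congr 1
  push_cast
  ring

namespace Frame

variable {q : ℕ} (X : Frame q)

/-- `A(x) ξ`. -/
def zeta (z : Pt q × Pt q) : Pt q := WithLp.toLp 2 (X.M z.1 z.2)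

theorem zeta_xi (x ζ : Pt q) : X.zeta (x, X.xi (x, ζ)) = ζ := by
  ext k
  exact X.sum_A_mul_xi (x, ζ) k

theorem xi_zeta (x ξ : Pt q) : X.xi (x, X.zeta (x, ξ)) = ξ := by
  ext j
  change ∑ k, X.B x j k * ∑ l, X.A x k l * ξ l = ξ j
  simp only [Finset.mul_sum]
  rw [Finset.sum_comm]
  simp only [← mul_assoc, ← Finset.sum_mul, sum_B_mul_A]
  simp

theorem continuous_zeta : Continuous X.zeta := by
  refine (PiLp.continuous_toLp 2 _).comp (continuous_pi fun k => ?_)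
  refine continuous_finsetSum _ fun l _ => ((X.smooth k l).continuous.comp continuous_fst).mul ?_
  exact (coordForm (Sum.inr l)).continuous

theorem exists_norm_zeta_le : ∃ C : ℝ, 1 ≤ C ∧ ∀ x ξ : Pt q, ‖X.zeta (x, ξ)‖ ≤ C * ‖ξ‖ ∧
    ‖ξ‖ ≤ C * ‖X.zeta (x, ξ)‖ := by
  obtain ⟨C, h1, hC⟩ := X.exists_norm_xi_le
  refine ⟨C, h1, fun x ξ => ?_⟩
  have := hC (x, X.zeta (x, ξ))
  rw [xi_zeta] at this
  exact this.symm

theorem IsSymbol.polyGrowth {m n : ℝ} {a : Pt q × Pt q → ℂ} (ha : X.IsSymbol m n a) :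
    PolyGrowth a := by
  obtain ⟨C, hC⟩ := SB.norm_le X ⟨ha.1, fun α β => ha.2 α β []⟩
  obtain ⟨c, c1, hc⟩ := X.exists_norm_zeta_le
  obtain ⟨k, hk⟩ := exists_nat_ge m
  obtain ⟨l, hl⟩ := exists_nat_ge n
  refine ⟨|C| * 2 ^ l * c ^ (k + l), k + l, fun x ξ => ?_⟩
  have h := hC (x, X.zeta (x, ξ))
  simp only [Psi, xi_zeta] at h
  refine h.trans ?_
  set ζ := X.zeta (x, ξ)
  have w1 := one_le_wR ζ
  have w2 := one_le_wS ζ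
  have w3 := wS_le_two_wR ζ
  have w4 : wR ζ ≤ c * (1 + ‖ξ‖) := by
    have := (hc x ξ).1
    unfold wR
    linarith
  have e1 : wR ζ ^ m ≤ wR ζ ^ k := by
    rw [← Real.rpow_natCast]
    exact Real.rpow_le_rpow_of_exponent_le w1 hk
  have e2 : wS ζ ^ n ≤ (2 * wR ζ) ^ l := by
    refine (Real.rpow_le_rpow_of_exponent_le w2 hl).trans ?_
    rw [Real.rpow_natCast]
    exact pow_le_pow_left₀ (by linarith) w3 l
  have p1 : 0 ≤ wR ζ ^ m := Real.rpow_nonneg (by linarith) _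
  have p2 : 0 ≤ wS ζ ^ n := Real.rpow_nonneg (by linarith) _
  calc C * (wR ζ ^ m * wS ζ ^ n) ≤ |C| * (wR ζ ^ k * (2 * wR ζ) ^ l) := by
        refine mul_le_mul (le_abs_self C) (mul_le_mul e1 e2 p2 (by positivity)) (by positivity)
          (abs_nonneg C)
    _ = |C| * 2 ^ l * wR ζ ^ (k + l) := by rw [mul_pow, pow_add]; ring
    _ ≤ |C| * 2 ^ l * (c * (1 + ‖ξ‖)) ^ (k + l) := by gcongr
    _ = _ := by rw [mul_pow]; ring

/-- The change of variables `ξ = B(x) ζ`. -/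
theorem integral_eq_J_mul (x : Pt q) (h : Pt q → ℂ) :
    ∫ ξ, h ξ = (X.J x : ℂ) * ∫ ζ, h (X.xi (x, ζ)) := by
  set L : Pt q →L[ℝ] Pt q := LinearMap.toContinuousLinearMap (Matrix.toLpLin 2 2 (X.B x)) with hL
  have hLx : ∀ ζ, X.xi (x, ζ) = L ζ := fun ζ => rfl
  have hdet : |L.det| = X.J x := by
    rw [hL, LinearMap.det_toContinuousLinearMap, LinearMap.det_toLpLin, J]
  have hinj : Function.Injective fun ζ => X.xi (x, ζ) :=
    Function.LeftInverse.injective (g := fun ξ => X.zeta (x, ξ)) fun ζ => X.zeta_xi x ζ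
  have hsurj : Function.Surjective fun ζ => X.xi (x, ζ) := fun ξ => ⟨_, X.xi_zeta x ξ⟩
  have key := integral_image_eq_integral_abs_det_fderiv_smul (volume : Measure (Pt q))
    (s := Set.univ) (f := fun ζ => X.xi (x, ζ)) (f' := fun _ => L) MeasurableSet.univ
    (fun ζ _ => by simp only [hLx]; exact L.hasFDerivWithinAt) hinj.injOn h
  rw [Set.image_univ, hsurj.range_eq, setIntegral_univ, setIntegral_univ] at key
  rw [key, hdet, integral_smul, Complex.real_smul]

theorem inner_sub_xi (x y ζ : Pt q) :
    inner ℝ (x - y) (X.xi (x, ζ)) = inner ℝ (X.theta (x, y)) ζ := by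
  simp only [PiLp.inner_apply, xi_apply, theta_apply, PiLp.sub_apply, RCLike.inner_apply,
    conj_trivial, Finset.sum_mul, Finset.mul_sum]
  rw [Finset.sum_comm]
  refine Finset.sum_congr rfl fun k _ => Finset.sum_congr rfl fun j _ => ?_
  ring

/-- The symbol truncated at frequencies of size `2^j`. -/
def truncSymbol (a : Pt q × Pt q → ℂ) (j : ℕ) (z : Pt q × Pt q) : ℂ := a z * cutj j (X.zeta z)

theorem continuous_truncSymbol {a : Pt q × Pt q → ℂ} (ha : Continuous a) (j : ℕ) :
    Continuous (X.truncSymbol a j) :=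
  ha.mul ((contDiff_cutj j).continuous.comp X.continuous_zeta)

theorem norm_truncSymbol_le (a : Pt q × Pt q → ℂ) (j : ℕ) (z : Pt q × Pt q) :
    ‖X.truncSymbol a j z‖ ≤ ‖a z‖ := by
  rw [truncSymbol, norm_mul]
  exact mul_le_of_le_one_right (norm_nonneg _) (norm_cutj_le _ _)

theorem polyGrowth_truncSymbol {a : Pt q × Pt q → ℂ} (ha : PolyGrowth a) (j : ℕ) :
    PolyGrowth (X.truncSymbol a j) := by
  obtain ⟨C, K, hC⟩ := ha
  exact ⟨C, K, fun x ξ => (X.norm_truncSymbol_le a j _).trans (hC x ξ)⟩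

theorem integrable_truncSymbol {a : Pt q × Pt q → ℂ} (ha : Continuous a) (j : ℕ) (x : Pt q) :
    Integrable fun ξ => X.truncSymbol a j (x, ξ) := by
  obtain ⟨c, c1, hc⟩ := X.exists_norm_zeta_le
  have h1 := X.continuous_truncSymbol ha j
  refine Continuous.integrable_of_hasCompactSupport (by fun_prop)
    (HasCompactSupport.of_support_subset_isCompact
      (isCompact_closedBall (0 : Pt q) (c * (2 * 2 ^ j))) fun ξ hξ => ?_)
  by_contra h
  refine hξ ?_
  have h2 : c * (2 * 2 ^ j) < ‖ξ‖ := not_le.mp (by simpa using h)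
  have h3 := (hc x ξ).2
  have h4 : 2 * 2 ^ j ≤ ‖X.zeta (x, ξ)‖ := by
    by_contra h5
    have : c * ‖X.zeta (x, ξ)‖ ≤ c * (2 * 2 ^ j) := by
      gcongr
      exact (not_le.mp h5).le
    linarith
  simp only [truncSymbol, cutj_eq_zero h4, mul_zero]

theorem integral_truncSymbol_mul_chr (a : Pt q × Pt q → ℂ) (j : ℕ) (x y : Pt q) :
    ∫ ξ, X.truncSymbol a j (x, ξ) * chr (x - y) ξ =
      (X.J x : ℂ) * Gc j (fun z => a (X.Psi z)) (X.T (x, y)) := by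
  rw [X.integral_eq_J_mul x, Gc]
  congr 2
  funext ζ
  rw [truncSymbol, zeta_xi, chr, inner_sub_xi]
  rfl

theorem integral_kerIntegrand_truncSymbol {a : Pt q × Pt q → ℂ} (ha : Continuous a) (j : ℕ)
    (Φ : 𝓢(Pt q × Pt q, ℂ)) (x : Pt q) :
    ∫ ξ, kerIntegrand (X.truncSymbol a j) Φ (x, ξ) =
      ∫ y, (X.J x : ℂ) * Gc j (fun z => a (X.Psi z)) (X.T (x, y)) * Φ (x, y) := by
  have e1 : ∀ ξ, kerIntegrand (X.truncSymbol a j) Φ (x, ξ) =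
      ∫ y, X.truncSymbol a j (x, ξ) * Φ (x, y) * chr (x - y) ξ := by
    intro ξ
    rw [kerIntegrand, FT2_eq, ← integral_const_mul]
    congr 1
    funext y
    rw [← chr_mul_chr_neg]
    ring
  simp only [e1]
  rw [integral_integral_swap]
  · congr 1
    funext y
    rw [← integral_truncSymbol_mul_chr, ← integral_mul_const]
    congr 1
    funext ξ
    ring
  · refine ((X.integrable_truncSymbol ha j x).mul_prod (integrable_slice Φ x)).mul_bdd (c := 1)
      (continuous_chr_comp (by fun_prop) (by fun_prop)).aestronglyMeasurable
      (ae_of_all _ fun y => (norm_chr _ _).le)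

/-- The kernel `k(x, y) = J(x) G_p(x, Θ_0(x, y))`. -/
def kernel (a : Pt q × Pt q → ℂ) (z : Pt q × Pt q) : ℂ :=
  (X.J z.1 : ℂ) * Glim (fun z => a (X.Psi z)) (X.T z)

theorem kerXY_kernel {m n : ℝ} (hm : -1 < m) (hn : -(q : ℝ) < n) {a : Pt q × Pt q → ℂ}
    (ha : X.IsSymbol m n a) : X.KerXY (q + n) (1 + m) (X.kernel a) :=
  ⟨fun z => (X.J z.1 : ℂ) * Glim (fun z => a (X.Psi z)) z,
    X.BD_J.mult.mul_Ker (Ker_Glim hm hn (IsSymbol.isFlat X ha)), fun _ _ => rfl⟩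

theorem contDiffOn_kernel {m n : ℝ} (hm : -1 < m) (hn : -(q : ℝ) < n) {a : Pt q × Pt q → ℂ}
    (ha : X.IsSymbol m n a) : ContDiffOn ℝ ∞ (X.kernel a) (offDiag q) := by
  obtain ⟨G, hG, h⟩ := X.kerXY_kernel hm hn ha
  exact (hG.1.comp X.contDiff_T.contDiffOn fun z hz => X.T_mem_punct hz).congr h

theorem tendsto_integral_truncSymbol {a : Pt q × Pt q → ℂ} (hc : Continuous a) (ha : PolyGrowth a)
    (Φ : 𝓢(Pt q × Pt q, ℂ)) :
    Filter.Tendsto (fun j => ∫ z, kerIntegrand (X.truncSymbol a j) Φ z) Filter.atTop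
      (nhds (kerDist a hc ha Φ)) := by
  rw [kerDist_apply]
  refine tendsto_integral_of_dominated_convergence (fun z => ‖kerIntegrand a Φ z‖)
    (fun j => (integrable_kerIntegrand (X.continuous_truncSymbol hc j)
      (X.polyGrowth_truncSymbol ha j) Φ).1) (integrable_kerIntegrand hc ha Φ).norm
    (fun j => ae_of_all _ fun z => ?_) (ae_of_all _ fun z => ?_)
  · rw [kerIntegrand, kerIntegrand, norm_mul, norm_mul, norm_mul, norm_mul]
    gcongr
    exact X.norm_truncSymbol_le a j z
  · have := (((tendsto_cutj (X.zeta z)).const_mul (a z)).mul_const (chr z.1 z.2)).mul_const (FT2 Φ z)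
    rw [mul_one] at this
    exact this

theorem isDensityOffDiag_kernel {m n : ℝ} (hm : -1 < m) (hn : -(q : ℝ) < n)
    {a : Pt q × Pt q → ℂ} (ha : X.IsSymbol m n a) (hg : PolyGrowth a) :
    IsDensityOffDiag (kerDist a ha.smooth.continuous hg) (X.kernel a) := by
  intro Φ hΦ hsupp
  have hc := ha.smooth.continuous
  have hflat := IsSymbol.isFlat X ha
  set p : Pt q × Pt q → ℂ := fun z => a (X.Psi z) with hp
  have cJ : Continuous X.J := X.BD_J.1.continuous
  have cF : ∀ j, Continuous fun z : Pt q × Pt q => (X.J z.1 : ℂ) * Gc j p (X.T z) * Φ z := by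
    intro j
    have h1 : Continuous (Gc j p) := continuous_Gc hflat.smooth j
    have h2 : Continuous X.T := X.contDiff_T.continuous
    exact ((Complex.continuous_ofReal.comp (cJ.comp continuous_fst)).mul (h1.comp h2)).mul
      Φ.continuous
  have e1 : ∀ j, ∫ z, kerIntegrand (X.truncSymbol a j) Φ z =
      ∫ z : Pt q × Pt q, (X.J z.1 : ℂ) * Gc j p (X.T z) * Φ z := by
    intro j
    have i1 : Integrable (fun z : Pt q × Pt q => (X.J z.1 : ℂ) * Gc j p (X.T z) * Φ z) :=
      (cF j).integrable_of_hasCompactSupport hΦ.mul_left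
    calc _ = ∫ x, ∫ ξ, kerIntegrand (X.truncSymbol a j) Φ (x, ξ) :=
          integral_prod _ (integrable_kerIntegrand (X.continuous_truncSymbol hc j)
            (X.polyGrowth_truncSymbol hg j) Φ)
      _ = ∫ x, ∫ y, (X.J x : ℂ) * Gc j p (X.T (x, y)) * Φ (x, y) := by
          simp only [X.integral_kerIntegrand_truncSymbol hc]
          rfl
      _ = _ := (integral_prod _ i1).symm
  have lim1 := X.tendsto_integral_truncSymbol hc hg Φ
  simp only [e1] at lim1
  refine tendsto_nhds_unique lim1 ?_
  obtain ⟨C, hC⟩ := norm_Gc_le hm hn le_rfl hflat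
  set W : Pt q × Pt q → ℝ := fun z => X.J z.1 * (C * (‖X.theta z‖ ^ (-(q + n + 0)) *
    fd (X.theta z) ^ (-(2 * (1 + m))))) with hW
  have cW : ContinuousOn W (tsupport Φ) := by
    have h1 : Continuous X.theta := X.contDiff_theta.continuous
    have h2 : ∀ z ∈ tsupport Φ, X.theta z ≠ 0 := fun z hz => X.T_mem_punct (hsupp hz)
    refine (cJ.comp continuous_fst).continuousOn.mul (continuousOn_const.mul
      ((h1.norm.continuousOn.rpow_const fun z hz => Or.inl (norm_pos_iff.mpr (h2 z hz)).ne').mul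
      ((continuous_fd.comp h1).continuousOn.rpow_const fun z hz => Or.inl (fd_pos (h2 z hz)).ne')))
  obtain ⟨D, hD⟩ := hΦ.isCompact.exists_bound_of_continuousOn cW
  refine tendsto_integral_of_dominated_convergence (fun z => D * ‖Φ z‖)
    (fun j => (cF j).aestronglyMeasurable)
    ((Φ.continuous.integrable_of_hasCompactSupport hΦ).norm.const_mul D)
    (fun j => ae_of_all _ fun z => ?_) (ae_of_all _ fun z => ?_)
  · by_cases hz : z ∈ tsupport Φ
    · rw [norm_mul]
      refine mul_le_mul_of_nonneg_right ?_ (norm_nonneg _)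
      refine le_trans ?_ ((le_abs_self _).trans (hD z hz))
      have J0 : 0 ≤ X.J z.1 := abs_nonneg _
      rw [norm_mul, Complex.norm_real, Real.norm_of_nonneg J0, hW]
      exact mul_le_mul_of_nonneg_left (hC j (X.T z) (X.T_mem_punct (hsupp hz))) J0
    · rw [image_eq_zero_of_notMem_tsupport hz]
      simp
  · by_cases hz : z ∈ tsupport Φ
    · obtain ⟨C', -, hC'⟩ := tendsto_Gc_and_rate hm hn hflat
      exact (((hC' (X.T z) (X.T_mem_punct (hsupp hz))).1).const_mul _).mul_const _
    · rw [image_eq_zero_of_notMem_tsupport hz]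
      simp

end Frame

end MixedPDO

end

theorem mainTheorem5 (q : ℕ) (X : Frame q) (m n : ℝ) (hm : -1 < m) (hn : -(q : ℝ) < n)
    (a : Pt q × Pt q → ℂ) (ha : X.IsSymbol m n a) :
    ∃ K : 𝓢'(Pt q × Pt q, ℂ),
      (∀ (f : 𝓢(Pt q, ℂ)) (x : Pt q), Integrable (opIntegrand a f x)) ∧
      (∀ f g : 𝓢(Pt q, ℂ),
        Integrable (fun x => op a f x * g x) ∧ ∫ x, op a f x * g x = K (tensor g f)) ∧
      ∃ k : Pt q × Pt q → ℂ,
        ContDiffOn ℝ ∞ k (offDiag q) ∧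
        IsDensityOffDiag K k ∧
        ∀ (I : List (Fin (q + 1))) (γ : List (Fin q ⊕ Fin q))
          (l : List (Fin (q + 1) ⊕ Fin (q + 1))) (M : ℝ), 0 ≤ M →
          ∃ C : ℝ, ∀ x y : Pt q, x ≠ y →
            ‖I.foldr X.Dker (γ.foldr X.Xker (l.foldr pdker k)) (x, y)‖ ≤
              C / (‖x - y‖ ^ ((q : ℝ) + n + γ.length + M) *
                X.qdist x y ^ (2 * (1 + m + l.length))) := by
  have hc := ha.smooth.continuous
  have hg := Frame.IsSymbol.polyGrowth X ha
  refine ⟨kerDist a hc hg, integrable_opIntegrand hc hg, fun f g =>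
    ⟨integrable_op_mul hc hg f g, integral_op_mul hc hg f g⟩, X.kernel a,
    X.contDiffOn_kernel hm hn ha, X.isDensityOffDiag_kernel hm hn ha hg, fun I γ l M hM => ?_⟩
  have hl : (0 : ℝ) ≤ l.length := Nat.cast_nonneg _
  have hγ : (0 : ℝ) ≤ γ.length := Nat.cast_nonneg _
  exact Frame.KerXY.bound X (by linarith) (by linarith)
    (Frame.KerXY.words X (X.kerXY_kernel hm hn ha) I γ l) hM
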